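/- **Setting.** Let $0<q<1$, $0<p<1$ with $q^{2n}\notin p^{\mathbb Z}$ for all $n\ge 1$, and put $\theta(x)=\prod_{i\ge 0}(1-xp^i)(1-p^{i+1}/x)$ for $x\neq 0$, $\theta(x_1,\dots,x_r)=\prod_i\theta(x_i)$. Let $M$ be the field of meromorphic functions of $\lambda\in\mathbb C$, $(T_nf)(\lambda)=f(\lambda+n)$, and let $D$ be the algebra of difference operators $\sum_i f_iT_{n_i}$ on $M$, with $D_{mm}=MT_{-m}$ and $D_{mn}=0$ for $m\ne n$. Let $R(\lambda,u)$ be the elliptic $R$-matrix on $V\otimes V$, $V=\mathbb Ce_1\oplus\mathbb Ce_{-1}$, with $R(\lambda,u)(e_i\otimes e_j)=\sum_{x,y}R^{ij}_{xy}(\lambda,u)\,e_x\otimes e_y$, whose non-zero entries are $R^{11}_{11}=R^{-1,-1}_{-1,-1}=1$ and $$R^{1,-1}_{1,-1}=\tfrac{\theta(u,q^{2(\lambda+2)})}{\theta(q^2u,q^{2(\lambda+1)})},\quad R^{-1,1}_{1,-1}=\tfrac{\theta(q^2,q^{-2(\lambda+1)}u)}{\theta(q^2u,q^{-2(\lambda+1)})},\quad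 R^{1,-1}_{-1,1}=\tfrac{\theta(q^2,q^{2(\lambda+1)}u)}{\theta(q^2u,q^{2(\lambda+1)})},\quad R^{-1,1}_{-1,1}=\tfrac{\theta(u,q^{-2\lambda})}{\theta(q^2u,q^{-2(\lambda+1)})}.$$ For a set $S\subseteq\mathbb C\setminus\{0\}$ with $q^2S\subseteq S$, let $\mathcal E(S)$ be the elliptic $U(2)$ dynamical quantum group with spectral parameters in $S$: the unital $\mathbb C$-algebra generated by $L_{ab}(z)$, $\det^{-1}(z)$ ($a,b=\pm1$, $z\in S$) and two commuting copies $\mu_l(f)$, $\mu_r(f)$, $f\in M$, of $M$, with the relations $\mu_l(f)L_{ab}(z)=L_{ab}(z)\mu_l(T_af)$, $\mu_r(f)L_{ab}(z)=L_{ab}(z)\mu_r(T_bf)$, $$\sum_{x,y}\mu_l\bigl(R^{xy}_{ac}(\cdot,\tfrac{z_1}{z_2})\bigr)L_{xb}(z_1)L_{yd}(z_2)=\sum_{x,y}\mu_r\bigl(R^{bd}_{xy}(\cdot,\tfrac{z_1}{z_2})\bigr)L_{cy}(z_2)L_{ax}(z_1)$$ (both sides multiplied by $\theta(q^2z_1/z_2)$,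 so that the relation makes sense for all $z_1,z_2\in S$), and $\det(z)\det^{-1}(z)=1=\det^{-1}(z)\det(z)$. Here $\alpha=L_{1,1}$, $\beta=L_{1,-1}$, $\gamma=L_{-1,1}$, $\delta=L_{-1,-1}$, $\det(z)=\mu_r(F)\mu_l(F^{-1})[\alpha(z)\delta(q^2z)-\gamma(z)\beta(q^2z)]$ and $F(\lambda)=q^\lambda\theta(q^{-2(\lambda+1)})$. It is bigraded by $L_{ab}(z)\in\mathcal E(S)_{ab}$, with the other generators in degree $(0,0)$, and it has the multiplicative comultiplication $\Delta L_{ab}(z)=\sum_xL_{ax}(z)\otimes L_{xb}(z)$, $\Delta\det^{-1}(z)=\det^{-1}(z)\otimes\det^{-1}(z)$, $\Delta\mu_l(f)=\mu_l(f)\otimes 1$, $\Delta\mu_r(f)=1\otimes\mu_r(f)$, with values in $\mathcal E(S)\otimes_M\mathcal E(S)$, where $\mu_r(f)a\otimes b=a\otimes\mu_l(f)b$, and the counit $\varepsilon\colon\mathcal E(S)\to D$, $\varepsilon(L_{ab}(z))=\delta_{ab}T_{-a}$, $\varepsilon(\det^{-1}(z))=1$, $\varepsilon(\mu_l(f))=\varepsilon(\mu_r(f))=f$.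 The co-opposite $\mathcal E(S)^{\mathrm{cop}}$ is the same algebra with $\mu_l,\mu_r$ interchanged, the two degrees interchanged, and $\Delta$ followed by the flip. Let $W,Z$ be two such sets with $w/z\notin q^{2\mathbb Z}p^{\mathbb Z}$ for all $w\in W$, $z\in Z$, and let $\langle\cdot,\cdot\rangle\colon\mathcal U\times\mathcal A\to D$, $\mathcal U=\mathcal E(W)^{\mathrm{cop}}$, $\mathcal A=\mathcal E(Z)$, be the cobraiding given by the $R$-matrix, i.e. a $\mathbb C$-bilinear map with $\langle\mathcal U_{\alpha\beta},\mathcal A_{\gamma\delta}\rangle\subseteq D_{\alpha+\delta,\beta+\gamma}$; $\langle\mu_l(f)X,a\rangle=\langle X,\mu_l(f)a\rangle=f\circ\langle X,a\rangle$; $\langle X\mu_r(f),a\rangle=\langle X,a\mu_r(f)\rangle=\langle X,a\rangle\circ f$; $\langle XY,a\rangle=\sum\langle X,a_{(1)}\rangle T_\rho\langle Y,a_{(2)}\rangle$ where $\Delta(a)=\sum a_{(1)}\otimes a_{(2)}$, $a_{(1)}\in\mathcal A_{\gamma\rho}$, $a_{(2)}\in\mathcal A_{\rho\delta}$; $\langle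 X,ab\rangle=\sum\langle X_{(1)},a\rangle T_\rho\langle X_{(2)},b\rangle$ where $\Delta(X)=\sum X_{(1)}\otimes X_{(2)}$, $X_{(1)}\in\mathcal U_{\alpha\rho}$, $X_{(2)}\in\mathcal U_{\rho\beta}$; $\langle X,1\rangle=\varepsilon(X)$, $\langle 1,a\rangle=\varepsilon(a)$ (moment maps, degrees and comultiplication being those of $\mathcal U$ and $\mathcal A$, respectively); and $\langle L_{ij}(w),L_{kl}(z)\rangle=R^{jl}_{ik}(\lambda,w/z)\,T_{-i-k}$. Let $N\in\mathbb Z_{\ge0}$, $z\in Z$, and for $0\le k\le N$ put $v_k(z)=\gamma(z)\gamma(q^2z)\cdots\gamma(q^{2(N-k-1)}z)\,\alpha(q^{2(N-k)}z)\cdots\alpha(q^{2(N-1)}z)\in\mathcal E(Z)$. **Theorem.** There are matrix elements $t^N_{kj}(z)\in\mathcal E(Z)$, $0\le k,j\le N$, with $\Delta(v_k(z))=\sum_{j=0}^Nt^N_{kj}(z)\otimes v_j(z)$ for all $k$, and any elements with this property satisfy, for all $w\in W$ and $0\le k,j\le N$, $$\begin{aligned} \langle\alpha(w),t^N_{kj}(z)\rangle&=\delta_{k,j}\,\frac{\theta(q^{2(1-N+k)}w/z,\;q^{2(\lambda+N-k+1)})}{\theta(q^2w/z,\;q^{2(\lambda+1)})}\,T_{N-2k-1},\\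 \langle\beta(w),t^N_{kj}(z)\rangle&=\delta_{k,j-1}\,\frac{\theta(q^{2(N-k)},\;q^{-2(\lambda+N-k)}w/z)}{\theta(q^2w/z,\;q^{-2(\lambda+1)})}\,T_{N-2k-1},\\ \langle\gamma(w),t^N_{kj}(z)\rangle&=\delta_{j,k-1}\,\frac{\theta(q^{2k},\;q^{2(\lambda-k+2)}w/z)}{\theta(q^2w/z,\;q^{2(\lambda+1)})}\,T_{N-2k+1},\\ \langle\delta(w),t^N_{kj}(z)\rangle&=\delta_{k,j}\,\frac{\theta(q^{2(k-\lambda-1)},\;q^{2(1-k)}w/z)}{\theta(q^2w/z,\;q^{-2(\lambda+1)})}\,T_{N-2k+1},\\ \langle{\det}^{-1}(w),t^N_{kj}(z)\rangle&=\delta_{k,j}\,q^{-N}\,\frac{\theta(q^2w/z)}{\theta(q^{2(1-N)}w/z)}\,T_{N-2k}, \end{aligned}$$ where the functions of $\lambda$ on the right are elements of $M$. -/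

import Mathlib

noncomputable section
namespace EllU2
open Filter Topology

/-- The algebra of functions `ℂ → ℂ` that are meromorphic on all of `ℂ`. -/
def merSub : Subalgebra ℂ (ℂ → ℂ) where
  carrier := {f | Meromorphic f}
  mul_mem' hf hg := Meromorphic.mul hf hg
  add_mem' hf hg := Meromorphic.add hf hg
  algebraMap_mem' c := Meromorphic.const c

/-- The ideal of those that vanish off a discrete closed set. -/
def merNull : Ideal merSub where
  carrier := {f | f.1 =ᶠ[codiscrete ℂ] 0}
  add_mem' {f g} hf hg := by
    have hf' : f.1 =ᶠ[codiscrete ℂ] 0 := hf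
    have hg' : g.1 =ᶠ[codiscrete ℂ] 0 := hg
    change (f.1 + g.1) =ᶠ[codiscrete ℂ] 0
    simpa using hf'.add hg'
  zero_mem' := EventuallyEq.refl (codiscrete ℂ) (0 : ℂ → ℂ)
  smul_mem' c f hf := by
    have hf' : f.1 =ᶠ[codiscrete ℂ] 0 := hf
    change (c.1 * f.1) =ᶠ[codiscrete ℂ] 0
    simpa using (EventuallyEq.refl (codiscrete ℂ) c.1).mul hf'

theorem mer_dichotomy {f : ℂ → ℂ} (hf : Meromorphic f) :
    f =ᶠ[codiscrete ℂ] 0 ∨ ∀ᶠ x in codiscrete ℂ, f x ≠ 0 := by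
  by_cases h : ∃ x ∈ Set.univ, meromorphicOrderAt f x ≠ ⊤
  · right
    exact MeromorphicAt.MeromorphicOn.codiscreteWithin_setOfPred_ne_zero
      (hf.meromorphicOn (s := Set.univ))
      ((MeromorphicOn.exists_meromorphicOrderAt_ne_top_iff_forall_mem
        (hf.meromorphicOn (s := Set.univ)) isConnected_univ).1 h)
  · left
    push Not at h
    refine mem_codiscreteWithin_iff_forall_mem_nhdsNE.2 fun x hx => ?_
    filter_upwards [meromorphicOrderAt_eq_top_iff.1 (h x hx)] with y hy
    exact Or.inl hy

theorem not_eventually_codiscrete_false : ¬ ∀ᶠ _ in codiscrete ℂ, False := by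
  intro h
  have := mem_codiscreteWithin_iff_forall_mem_nhdsNE.1 h 0 trivial
  simp only [Set.compl_univ, Set.union_empty] at this
  exact (NeBot.ne (inferInstanceAs (𝓝[≠] (0 : ℂ)).NeBot)) (Filter.empty_mem_iff_bot.1 this)

instance merNull_isMaximal : merNull.IsMaximal := by
  rw [Ideal.isMaximal_iff]
  refine ⟨fun h => ?_, fun J x hJ hx hxJ => ?_⟩
  · have h1 : ((1 : ℂ → ℂ)) =ᶠ[codiscrete ℂ] 0 := h
    exact not_eventually_codiscrete_false (h1.mono fun x hx => by simp at hx)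
  · have hne := (mer_dichotomy x.2).resolve_left hx
    let y : merSub := ⟨x.1⁻¹, Meromorphic.inv x.2⟩
    have h1 : 1 - y * x ∈ merNull := by
      change (1 - x.1⁻¹ * x.1) =ᶠ[codiscrete ℂ] 0
      filter_upwards [hne] with t ht
      simp [inv_mul_cancel₀ ht]
    have := J.add_mem (hJ h1) (J.mul_mem_left y hxJ)
    simpa using this

/-- The field of meromorphic functions on `ℂ`: functions meromorphic at every point, where two
functions that agree off a discrete closed set are identified. -/
def Mer : Type := merSub ⧸ merNull

instance : CommRing Mer := inferInstanceAs (CommRing (merSub ⧸ merNull))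

theorem isField_Mer : IsField Mer :=
  (Ideal.Quotient.maximal_ideal_iff_isField_quotient merNull).1 merNull_isMaximal

open Classical in
instance : Field Mer where
  inv a := if h : a = 0 then 0 else (isField_Mer.mul_inv_cancel h).choose
  exists_pair_ne := isField_Mer.exists_pair_ne
  mul_inv_cancel a h := by
    rw [dif_neg h]
    exact (isField_Mer.mul_inv_cancel h).choose_spec
  inv_zero := dif_pos rfl
  nnqsmul := _
  nnqsmul_def := fun _ _ => rfl
  qsmul := _
  qsmul_def := fun _ _ => rfl

/-- The class of a meromorphic function. -/
def mkM : merSub →+* Mer := Ideal.Quotient.mk merNull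

instance : Algebra ℂ Mer := (mkM.comp (algebraMap ℂ merSub)).toAlgebra

theorem mkM_surjective : Function.Surjective mkM := Ideal.Quotient.mk_surjective

theorem mkM_eq_iff {f g : merSub} : mkM f = mkM g ↔ f.1 =ᶠ[codiscrete ℂ] g.1 := by
  refine (Ideal.Quotient.eq (I := merNull)).trans ?_
  change (f.1 - g.1) =ᶠ[codiscrete ℂ] 0 ↔ _
  exact eventuallyEq_iff_sub.symm

/-- The element of `Mer` given by a meromorphic function (and `0` if `f` is not meromorphic). -/
def toM (f : ℂ → ℂ) : Mer :=
  open Classical in if h : Meromorphic f then mkM ⟨f, h⟩ else 0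

theorem toM_of {f : ℂ → ℂ} (h : Meromorphic f) : toM f = mkM ⟨f, h⟩ := dif_pos h

theorem toM_eq_iff {f g : ℂ → ℂ} (hf : Meromorphic f) (hg : Meromorphic g) :
    toM f = toM g ↔ f =ᶠ[codiscrete ℂ] g := by
  rw [toM_of hf, toM_of hg, mkM_eq_iff]

theorem toM_neg {f : ℂ → ℂ} (hf : Meromorphic f) : toM (fun x => -f x) = -toM f := by
  rw [toM_of hf, toM_of hf.fun_neg, ← map_neg]
  rfl

theorem toM_zero : toM (fun _ => 0) = 0 := by
  rw [toM_of (Meromorphic.const 0), ← map_zero mkM]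
  rfl

theorem toM_ne_zero {f : ℂ → ℂ} (hf : Meromorphic f) (h : ∃ᶠ x in codiscrete ℂ, f x ≠ 0) :
    toM f ≠ 0 := by
  rw [← toM_zero, Ne, toM_eq_iff hf (Meromorphic.const 0)]
  exact fun h' => h (h'.mono fun x hx => by simpa using hx)

theorem tendsto_add_codiscrete (α : ℂ) :
    Tendsto (fun x : ℂ => x + α) (codiscrete ℂ) (codiscrete ℂ) := by
  intro s hs
  rw [mem_map, codiscrete, mem_codiscreteWithin_iff_forall_mem_nhdsNE] at *
  intro x _
  have h := hs (x + α) trivial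
  simp only [Set.compl_univ, Set.union_empty] at h ⊢
  have hc : Tendsto (fun x : ℂ => x + α) (𝓝[≠] x) (𝓝[≠] (x + α)) :=
    tendsto_nhdsWithin_of_tendsto_nhds_of_eventually_within _
      ((continuous_add_const α).continuousAt.tendsto.mono_left nhdsWithin_le_nhds)
      (by filter_upwards [self_mem_nhdsWithin] with y hy; simpa using hy)
  exact hc h

/-- Translation on meromorphic functions, before passing to the quotient. -/
def shiftSub (α : ℂ) : merSub →+* merSub where
  toFun f := ⟨fun x => f.1 (x + α),
    Meromorphic.meromorphic_fun_comp_add_const_iff_meromorphic.2 f.2⟩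
  map_one' := rfl
  map_mul' _ _ := rfl
  map_zero' := rfl
  map_add' _ _ := rfl

/-- The automorphism `(T_α f)(x) = f(x + α)` of the field of meromorphic functions. -/
def shift (α : ℂ) : Mer →ₐ[ℂ] Mer where
  toRingHom := Ideal.Quotient.lift merNull (mkM.comp (shiftSub α)) fun f hf =>
    (mkM_eq_iff (g := 0)).2 ((tendsto_add_codiscrete α).eventually
      (show ∀ᶠ x in codiscrete ℂ, f.1 x = (0 : ℂ → ℂ) x from hf))
  commutes' _ := rfl

theorem shift_mkM (α : ℂ) (f : merSub) : shift α (mkM f) = mkM (shiftSub α f) := rfl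

theorem shift_shift (α β : ℂ) (f : Mer) : shift α (shift β f) = shift (α + β) f := by
  obtain ⟨f, rfl⟩ := mkM_surjective f
  simp only [shift_mkM]
  refine congrArg mkM (Subtype.ext (funext fun x => ?_))
  change f.1 (x + α + β) = f.1 (x + (α + β))
  rw [add_assoc]

theorem shift_zero (f : Mer) : shift 0 f = f := by
  obtain ⟨f, rfl⟩ := mkM_surjective f
  rw [shift_mkM]
  refine congrArg mkM (Subtype.ext (funext fun x => ?_))
  change f.1 (x + 0) = f.1 x
  rw [add_zero]

/-- The operator of multiplication by `f` on the space of meromorphic functions. -/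
def mulOp (f : Mer) : Module.End ℂ Mer := LinearMap.mulLeft ℂ f

/-- The shift operator `T_n` on the space of meromorphic functions. -/
def T (n : ℤ) : Module.End ℂ Mer := (shift (n : ℂ)).toLinearMap

theorem mulOp_mul (f g : Mer) : mulOp (f * g) = mulOp f * mulOp g := by
  ext h; simp [mulOp]

theorem T_zero : T 0 = 1 := by
  ext h; simp [T, shift_zero]

theorem T_add (m n : ℤ) : T (m + n) = T m * T n := by
  ext h; simp [T, shift_shift]

theorem T_mulOp (n : ℤ) (f : Mer) : T n * mulOp f = mulOp (shift n f) * T n := by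
  ext h; simp [T, mulOp]

theorem mulOp_one : mulOp 1 = 1 := by
  ext h; simp [mulOp]

theorem mulOp_zero : mulOp 0 = 0 := by
  ext h; simp [mulOp]

theorem mulOp_add (f g : Mer) : mulOp (f + g) = mulOp f + mulOp g := by
  ext h; simp [mulOp, add_mul]

theorem mulOp_const (c : ℂ) : mulOp (algebraMap ℂ Mer c) = algebraMap ℂ _ c := by
  ext h; simp [mulOp, Algebra.smul_def]


/-- The parameters `q` and `p` of the elliptic quantum group, in general position: no positive
power of `q²` is an integer power of `p`, so that `θ(q²), θ(q⁴), …` do not vanish. -/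
structure Params where
  q : ℝ
  p : ℝ
  q_pos : 0 < q
  q_lt_one : q < 1
  p_pos : 0 < p
  p_lt_one : p < 1
  generic : ∀ n : ℕ, 0 < n → ∀ m : ℤ, q ^ (2 * n) ≠ p ^ m

variable (P : Params)

/-- `(a; p)_∞ = ∏_{i ≥ 0} (1 - a pⁱ)`. -/
def poch (a : ℂ) : ℂ := ∏' i : ℕ, (1 - a * (P.p : ℂ) ^ i)

/-- The theta function `θ(x) = (x; p)_∞ (p/x; p)_∞`, for `x ≠ 0`. -/
def theta (x : ℂ) : ℂ := poch P x * poch P (P.p / x)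

/-- `q^{2x}` for complex `x`. -/
def qq (x : ℂ) : ℂ := (P.q : ℂ) ^ (2 * x)

theorem summable_poch (a : ℂ) : Summable fun i : ℕ => ‖-(a * (P.p : ℂ) ^ i)‖ := by
  have h := (summable_geometric_of_lt_one P.p_pos.le P.p_lt_one).mul_left ‖a‖
  refine h.congr fun i => ?_
  simp [abs_of_pos P.p_pos]

theorem multipliable_poch (a : ℂ) : Multipliable fun i : ℕ => (1 - a * (P.p : ℂ) ^ i) := by
  simpa only [sub_eq_add_neg] using multipliable_one_add_of_summable (summable_poch P a)

theorem poch_eq (a : ℂ) : poch P a = (1 - a) * poch P (a * P.p) := by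
  have hs : Multipliable fun i : ℕ => (1 - a * (P.p : ℂ) ^ (i + 1)) := by
    refine (multipliable_poch P (a * P.p)).congr fun i => ?_
    ring
  have h := tprod_eq_zero_mul' (f := fun i : ℕ => (1 - a * (P.p : ℂ) ^ i)) hs
  have h2 : ∏' i : ℕ, (1 - a * (P.p : ℂ) ^ (i + 1)) = poch P (a * P.p) :=
    tprod_congr fun i => by ring
  rw [h2, pow_zero, mul_one] at h
  exact h

theorem poch_ne_zero {a : ℂ} (h : ∀ i : ℕ, a * (P.p : ℂ) ^ i ≠ 1) : poch P a ≠ 0 := by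
  have := tprod_one_add_ne_zero_of_summable (f := fun i : ℕ => -(a * (P.p : ℂ) ^ i))
    (fun i hi => h i (by linear_combination -hi)) (summable_poch P a)
  simpa only [poch, sub_eq_add_neg] using this

theorem differentiable_poch : Differentiable ℂ (poch P) := by
  intro x
  have hK : IsOpen (Metric.ball (0 : ℂ) (‖x‖ + 1)) := Metric.isOpen_ball
  have h := (((summable_geometric_of_lt_one P.p_pos.le P.p_lt_one).mul_left
    (‖x‖ + 1)).hasProdLocallyUniformlyOn_nat_one_add (R := ℂ)
      (f := fun (i : ℕ) (a : ℂ) => -(a * (P.p : ℂ) ^ i)) hK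
      (.of_forall fun n y hy => by
        have hy' : ‖y‖ ≤ ‖x‖ + 1 := by simpa using (Metric.mem_ball.1 hy).le
        have : 0 ≤ P.p ^ n := pow_nonneg P.p_pos.le n
        simp only [norm_neg, norm_mul, norm_pow, Complex.norm_real, Real.norm_eq_abs,
          abs_of_pos P.p_pos]
        gcongr)
      (fun n => by fun_prop)).differentiableOn
    (.of_forall fun _ => by
      simpa [Finset.prod_fn] using DifferentiableOn.finsetProd (fun _ _ => by fun_prop)) hK
  have h2 := h.differentiableAt (hK.mem_nhds (by simp : x ∈ Metric.ball (0 : ℂ) (‖x‖ + 1)))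
  exact h2.congr_of_eventuallyEq (.of_forall fun y => by simp only [poch, sub_eq_add_neg])

theorem theta_inv {x : ℂ} (hx : x ≠ 0) : theta P x⁻¹ = -x⁻¹ * theta P x := by
  simp only [theta]
  rw [poch_eq P x⁻¹, poch_eq P x]
  have e1 : (P.p : ℂ) / x⁻¹ = x * P.p := by field_simp
  have e2 : x⁻¹ * (P.p : ℂ) = P.p / x := by field_simp
  rw [e1, e2]
  field_simp
  ring

theorem theta_ne_zero {x : ℂ} (hx : x ≠ 0) (h : ∀ m : ℤ, x ≠ (P.p : ℂ) ^ m) : theta P x ≠ 0 := by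
  have hp : (P.p : ℂ) ≠ 0 := by exact_mod_cast P.p_pos.ne'
  refine mul_ne_zero (poch_ne_zero P fun i hi => h (-(i : ℤ)) ?_)
    (poch_ne_zero P fun i hi => h ((i : ℤ) + 1) ?_)
  · rw [zpow_neg, zpow_natCast]
    exact eq_inv_of_mul_eq_one_left hi
  · rw [zpow_add₀ hp, zpow_natCast, zpow_one]
    field_simp at hi
    linear_combination -hi

theorem qq_ne_zero (x : ℂ) : qq P x ≠ 0 := by
  have hq : (P.q : ℂ) ≠ 0 := by exact_mod_cast P.q_pos.ne'
  simp [qq, Complex.cpow_eq_zero_iff, hq]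

theorem qq_add (x y : ℂ) : qq P (x + y) = qq P x * qq P y := by
  have hq : (P.q : ℂ) ≠ 0 := by exact_mod_cast P.q_pos.ne'
  rw [qq, mul_add, Complex.cpow_add _ _ hq, qq, qq]

theorem qq_neg (x : ℂ) : qq P (-x) = (qq P x)⁻¹ := by
  rw [qq, mul_neg, Complex.cpow_neg, qq]

theorem qq_natCast (n : ℕ) : qq P n = (P.q : ℂ) ^ (2 * n) := by
  rw [qq, ← Complex.cpow_natCast]
  push_cast
  rfl

theorem differentiable_qq : Differentiable ℂ (qq P) := by
  have hq : (P.q : ℂ) ≠ 0 := by exact_mod_cast P.q_pos.ne'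
  have : qq P = fun x => Complex.exp (Complex.log P.q * (2 * x)) := by
    ext x; rw [qq, Complex.cpow_def_of_ne_zero hq]
  rw [this]
  fun_prop

/-- The functions `x ↦ θ(u q^{2(s x + c)})` are entire, hence meromorphic. -/
theorem differentiable_theta_qq (s c u : ℂ) (hu : u ≠ 0) :
    Differentiable ℂ fun x : ℂ => theta P (qq P (s * x + c) * u) := by
  have h1 : Differentiable ℂ fun x : ℂ => qq P (s * x + c) :=
    (differentiable_qq P).comp (by fun_prop)
  have h2 : ∀ x, qq P (s * x + c) * u ≠ 0 := fun x => mul_ne_zero (qq_ne_zero P _) hu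
  unfold theta
  refine ((differentiable_poch P).comp (h1.mul_const u)).mul ((differentiable_poch P).comp ?_)
  exact Differentiable.fun_div (differentiable_const _) (h1.mul_const u) h2

theorem meromorphic_of_differentiable {f : ℂ → ℂ} (hf : Differentiable ℂ f) : Meromorphic f :=
  fun x => (hf.analyticAt x).meromorphicAt

theorem meromorphic_theta (s c u : ℂ) (hu : u ≠ 0) :
    Meromorphic fun x : ℂ => theta P (qq P (s * x + c) * u) :=
  meromorphic_of_differentiable (differentiable_theta_qq P s c u hu)

theorem eventually_theta_ne_zero (s c u : ℂ) (hs : s ≠ 0) (hu : u ≠ 0) :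
    ∀ᶠ x in codiscrete ℂ, theta P (qq P (s * x + c) * u) ≠ 0 := by
  refine (mer_dichotomy (meromorphic_theta P s c u hu)).resolve_left fun h => ?_
  have h0 : (fun x : ℂ => theta P (qq P (s * x + c) * u)) = 0 := by
    refine AnalyticOnNhd.eq_of_frequently_eq (z₀ := 0)
      (fun x _ => (differentiable_theta_qq P s c u hu).analyticAt x) analyticOnNhd_const ?_
    have := mem_codiscreteWithin_iff_forall_mem_nhdsNE.1 h 0 trivial
    simp only [Set.compl_univ, Set.union_empty] at this
    exact Eventually.frequently this
  -- at a suitable point the argument of `θ` is `-1`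
  have hq : (P.q : ℂ) ≠ 0 := by exact_mod_cast P.q_pos.ne'
  have hl : Complex.log P.q ≠ 0 := by
    rw [← Complex.ofReal_log P.q_pos.le]
    exact_mod_cast (Real.log_neg P.q_pos P.q_lt_one).ne
  let y : ℂ := Complex.log (-u⁻¹) / (2 * Complex.log P.q)
  have hy : qq P y = -u⁻¹ := by
    rw [qq, Complex.cpow_def_of_ne_zero hq]
    have : Complex.log P.q * (2 * y) = Complex.log (-u⁻¹) := by
      simp only [y]; field_simp
    rw [this, Complex.exp_log (by simpa using hu)]
  have hx := congrFun h0 ((y - c) / s)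
  have e : s * ((y - c) / s) + c = y := by field_simp; ring
  simp only [e, hy, Pi.zero_apply] at hx
  refine theta_ne_zero P (x := -u⁻¹ * u) (by simp [hu]) (fun m hm => ?_) hx
  rw [neg_mul, inv_mul_cancel₀ hu] at hm
  have h1 : (-1 : ℝ) = P.p ^ m := by exact_mod_cast hm
  have := zpow_pos P.p_pos m
  linarith

theorem theta_qq_ne_zero {n : ℕ} (hn : 0 < n) : theta P (qq P n) ≠ 0 := by
  refine theta_ne_zero P (qq_ne_zero P _) fun m hm => P.generic n hn m ?_
  rw [qq_natCast] at hm
  exact_mod_cast hm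


/-- `θ(q²u) · R(·, u)`, where `R` is the elliptic dynamical `R`-matrix; `rNum P u i j x y` is the
coefficient `R^{ij}_{xy}` of `e_x ⊗ e_y` in `R (e_i ⊗ e_j)`, times `θ(q²u)`.
Indices: `true` stands for `1`, `false` for `-1`. -/
def rNum (u : ℂ) : Bool → Bool → Bool → Bool → Mer
  | true, true, true, true => toM fun _ => theta P (qq P 1 * u)
  | true, false, true, false => toM fun x =>
      theta P u * theta P (qq P (x + 2)) / theta P (qq P (x + 1))
  | false, true, true, false => toM fun x =>
      theta P (qq P 1) * theta P (qq P (-(x + 1)) * u) / theta P (qq P (-(x + 1)))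
  | true, false, false, true => toM fun x =>
      theta P (qq P 1) * theta P (qq P (x + 1) * u) / theta P (qq P (x + 1))
  | false, true, false, true => toM fun x =>
      theta P u * theta P (qq P (-x)) / theta P (qq P (-(x + 1)))
  | false, false, false, false => toM fun _ => theta P (qq P 1 * u)
  | _, _, _, _ => 0

/-- The entries `R^{ij}_{xy}(·, u)` of the elliptic `R`-matrix, for `θ(q²u) ≠ 0`. -/
def rMat (u : ℂ) (i j x y : Bool) : Mer := (theta P (qq P 1 * u))⁻¹ • rNum P u i j x y

/-- The weight of the basis vectors `e_1`, `e_{-1}`. -/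
def wt : Bool → ℤ
  | true => 1
  | false => -1

/-- A set of non-zero spectral parameters that is stable under multiplication by `q²`. -/
structure SpectralSet where
  carrier : Set ℂ
  ne_zero : ∀ z ∈ carrier, z ≠ 0
  mul_mem : ∀ z ∈ carrier, (P.q : ℂ) ^ 2 * z ∈ carrier

variable {P}

theorem SpectralSet.pow_mem (S : SpectralSet P) (n : ℕ) {z : ℂ} (hz : z ∈ S.carrier) :
    (P.q : ℂ) ^ (2 * n) * z ∈ S.carrier := by
  induction n with
  | zero => simpa using hz
  | succ n ih =>
    have := S.mul_mem _ ih
    rwa [← mul_assoc, ← pow_add, add_comm 2 (2 * n)] at this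

/-- The spectral parameter `q^{2n} z`. -/
def SpectralSet.up (S : SpectralSet P) (n : ℕ) (z : S.carrier) : S.carrier :=
  ⟨(P.q : ℂ) ^ (2 * n) * z, S.pow_mem n z.2⟩

variable (S : SpectralSet P)

/-- Generators: `L_{ab}(z)`, `det⁻¹(z)`, and two copies `f(λ)`, `f(μ)` of the field of
meromorphic functions. -/
inductive Gen : Type
  | L (a b : Bool) (z : S.carrier)
  | detInv (z : S.carrier)
  | ml (f : Mer)
  | mr (f : Mer)

/-- The function `F(λ) = q^λ θ(q^{-2(λ+1)})`. -/
def detF (P : Params) : Mer := toM fun x => (P.q : ℂ) ^ x * theta P (qq P (-(x + 1)))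

/-- `det(z) = F(μ) F(λ)⁻¹ [α(z) δ(q²z) - γ(z) β(q²z)]`, in the free algebra. -/
def detFree (z : S.carrier) : FreeAlgebra ℂ (Gen S) :=
  FreeAlgebra.ι ℂ (Gen.mr (detF P)) * FreeAlgebra.ι ℂ (Gen.ml (detF P)⁻¹) *
    (FreeAlgebra.ι ℂ (Gen.L true true z) * FreeAlgebra.ι ℂ (Gen.L false false (S.up 1 z)) -
      FreeAlgebra.ι ℂ (Gen.L false true z) * FreeAlgebra.ι ℂ (Gen.L true false (S.up 1 z)))

/-- The defining relations. In the `RLL`-relations both sides are multiplied by `θ(q² z₁/z₂)`, so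
that they make sense for all `z₁`, `z₂`. -/
inductive Rel : FreeAlgebra ℂ (Gen S) → FreeAlgebra ℂ (Gen S) → Prop
  | ml_add (f g : Mer) : Rel (FreeAlgebra.ι ℂ (Gen.ml (f + g)))
      (FreeAlgebra.ι ℂ (Gen.ml f) + FreeAlgebra.ι ℂ (Gen.ml g))
  | ml_mul (f g : Mer) : Rel (FreeAlgebra.ι ℂ (Gen.ml (f * g)))
      (FreeAlgebra.ι ℂ (Gen.ml f) * FreeAlgebra.ι ℂ (Gen.ml g))
  | ml_const (c : ℂ) : Rel (FreeAlgebra.ι ℂ (Gen.ml (algebraMap ℂ Mer c)))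
      (algebraMap ℂ (FreeAlgebra ℂ (Gen S)) c)
  | mr_add (f g : Mer) : Rel (FreeAlgebra.ι ℂ (Gen.mr (f + g)))
      (FreeAlgebra.ι ℂ (Gen.mr f) + FreeAlgebra.ι ℂ (Gen.mr g))
  | mr_mul (f g : Mer) : Rel (FreeAlgebra.ι ℂ (Gen.mr (f * g)))
      (FreeAlgebra.ι ℂ (Gen.mr f) * FreeAlgebra.ι ℂ (Gen.mr g))
  | mr_const (c : ℂ) : Rel (FreeAlgebra.ι ℂ (Gen.mr (algebraMap ℂ Mer c)))
      (algebraMap ℂ (FreeAlgebra ℂ (Gen S)) c)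
  | ml_mr (f g : Mer) : Rel (FreeAlgebra.ι ℂ (Gen.ml f) * FreeAlgebra.ι ℂ (Gen.mr g))
      (FreeAlgebra.ι ℂ (Gen.mr g) * FreeAlgebra.ι ℂ (Gen.ml f))
  | ml_L (f : Mer) (a b : Bool) (z : S.carrier) :
      Rel (FreeAlgebra.ι ℂ (Gen.ml f) * FreeAlgebra.ι ℂ (Gen.L a b z))
        (FreeAlgebra.ι ℂ (Gen.L a b z) * FreeAlgebra.ι ℂ (Gen.ml (shift (wt a) f)))
  | mr_L (f : Mer) (a b : Bool) (z : S.carrier) :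
      Rel (FreeAlgebra.ι ℂ (Gen.mr f) * FreeAlgebra.ι ℂ (Gen.L a b z))
        (FreeAlgebra.ι ℂ (Gen.L a b z) * FreeAlgebra.ι ℂ (Gen.mr (shift (wt b) f)))
  | RLL (a b c d : Bool) (z₁ z₂ : S.carrier) :
      Rel (∑ x, ∑ y, FreeAlgebra.ι ℂ (Gen.ml (rNum P (z₁ / z₂) x y a c)) *
          FreeAlgebra.ι ℂ (Gen.L x b z₁) * FreeAlgebra.ι ℂ (Gen.L y d z₂))
        (∑ x, ∑ y, FreeAlgebra.ι ℂ (Gen.mr (rNum P (z₁ / z₂) b d x y)) *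
          FreeAlgebra.ι ℂ (Gen.L c y z₂) * FreeAlgebra.ι ℂ (Gen.L a x z₁))
  | det_detInv (z : S.carrier) : Rel (detFree S z * FreeAlgebra.ι ℂ (Gen.detInv z)) 1
  | detInv_det (z : S.carrier) : Rel (FreeAlgebra.ι ℂ (Gen.detInv z) * detFree S z) 1

/-- The elliptic `U(2)` dynamical quantum group with spectral parameters in `S`. -/
def Ell : Type := RingQuot (Rel S)

instance : Ring (Ell S) := inferInstanceAs (Ring (RingQuot (Rel S)))
instance : Algebra ℂ (Ell S) := inferInstanceAs (Algebra ℂ (RingQuot (Rel S)))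

/-- The quotient map from the free algebra. -/
def Ell.mk : FreeAlgebra ℂ (Gen S) →ₐ[ℂ] Ell S := RingQuot.mkAlgHom ℂ (Rel S)

theorem Ell.mk_rel {x y : FreeAlgebra ℂ (Gen S)} (h : Rel S x y) : Ell.mk S x = Ell.mk S y :=
  RingQuot.mkAlgHom_rel ℂ h

variable {S}

/-- The image of a generator. -/
def Ell.gen (g : Gen S) : Ell S := Ell.mk S (FreeAlgebra.ι ℂ g)

/-- The generator `L_{ab}(z)`. -/
def Ell.L (a b : Bool) (z : S.carrier) : Ell S := Ell.gen (Gen.L a b z)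

/-- `α(z) = L_{1,1}(z)`. -/
def Ell.alpha (z : S.carrier) : Ell S := Ell.L true true z

/-- `β(z) = L_{1,-1}(z)`. -/
def Ell.beta (z : S.carrier) : Ell S := Ell.L true false z

/-- `γ(z) = L_{-1,1}(z)`. -/
def Ell.gamma (z : S.carrier) : Ell S := Ell.L false true z

/-- `δ(z) = L_{-1,-1}(z)`. -/
def Ell.delta (z : S.carrier) : Ell S := Ell.L false false z

/-- The inverse determinant `det⁻¹(z)`. -/
def Ell.detInv (z : S.carrier) : Ell S := Ell.gen (Gen.detInv z)

/-- The left moment map `f ↦ f(λ)`. -/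
def Ell.ml (f : Mer) : Ell S := Ell.gen (Gen.ml f)

/-- The right moment map `f ↦ f(μ)`. -/
def Ell.mr (f : Mer) : Ell S := Ell.gen (Gen.mr f)

/-- The determinant `det(z)`. -/
def Ell.det (z : S.carrier) : Ell S := Ell.mk S (detFree S z)

variable (S)
/-- The weights `(k, l)` of the generators. -/
def Gen.weight : Gen S → ℤ × ℤ
  | .L a b _ => (wt a, wt b)
  | .detInv _ => 0
  | .ml _ => 0
  | .mr _ => 0

/-- The component of bidegree `(k, l)`, spanned by the monomials of total weight `(k, l)`. -/
def Ell.gr (k l : ℤ) : Submodule ℂ (Ell S) :=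
  Submodule.span ℂ {a | ∃ w : List (Gen S),
    (w.map (Gen.weight S)).sum = (k, l) ∧ (w.map Ell.gen).prod = a}

variable {S}

section relations

theorem Ell.ml_add (f g : Mer) : (Ell.ml (f + g) : Ell S) = Ell.ml f + Ell.ml g := by
  simpa using! Ell.mk_rel S (Rel.ml_add f g)

theorem Ell.ml_mul (f g : Mer) : (Ell.ml (f * g) : Ell S) = Ell.ml f * Ell.ml g := by
  simpa using! Ell.mk_rel S (Rel.ml_mul f g)

theorem Ell.ml_const (c : ℂ) : (Ell.ml (algebraMap ℂ Mer c) : Ell S) = algebraMap ℂ _ c := by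
  simpa using! Ell.mk_rel S (Rel.ml_const c)

theorem Ell.mr_add (f g : Mer) : (Ell.mr (f + g) : Ell S) = Ell.mr f + Ell.mr g := by
  simpa using! Ell.mk_rel S (Rel.mr_add f g)

theorem Ell.mr_mul (f g : Mer) : (Ell.mr (f * g) : Ell S) = Ell.mr f * Ell.mr g := by
  simpa using! Ell.mk_rel S (Rel.mr_mul f g)

theorem Ell.mr_const (c : ℂ) : (Ell.mr (algebraMap ℂ Mer c) : Ell S) = algebraMap ℂ _ c := by
  simpa using! Ell.mk_rel S (Rel.mr_const c)

theorem Ell.ml_mr (f g : Mer) : (Ell.ml f * Ell.mr g : Ell S) = Ell.mr g * Ell.ml f := by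
  simpa using! Ell.mk_rel S (Rel.ml_mr f g)

theorem Ell.ml_L (f : Mer) (a b : Bool) (z : S.carrier) :
    Ell.ml f * Ell.L a b z = Ell.L a b z * Ell.ml (shift (wt a) f) := by
  simpa using! Ell.mk_rel S (Rel.ml_L f a b z)

theorem Ell.mr_L (f : Mer) (a b : Bool) (z : S.carrier) :
    Ell.mr f * Ell.L a b z = Ell.L a b z * Ell.mr (shift (wt b) f) := by
  simpa using! Ell.mk_rel S (Rel.mr_L f a b z)

theorem Ell.RLL (a b c d : Bool) (z₁ z₂ : S.carrier) :
    ∑ x, ∑ y, Ell.ml (rNum P (z₁ / z₂) x y a c) * Ell.L x b z₁ * Ell.L y d z₂ =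
      ∑ x, ∑ y, Ell.mr (rNum P (z₁ / z₂) b d x y) * Ell.L c y z₂ * Ell.L a x z₁ := by
  have h := Ell.mk_rel S (Rel.RLL a b c d z₁ z₂)
  simp only [map_sum, map_mul] at h
  exact h

theorem Ell.det_eq (z : S.carrier) : Ell.det z = Ell.mr (detF P) * Ell.ml (detF P)⁻¹ *
    (Ell.L true true z * Ell.L false false (S.up 1 z) -
      Ell.L false true z * Ell.L true false (S.up 1 z)) := by
  simp only [Ell.det, detFree, map_mul, map_sub]
  rfl

theorem Ell.det_detInv (z : S.carrier) : Ell.det z * Ell.detInv z = 1 := by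
  simpa using! Ell.mk_rel S (Rel.det_detInv z)

theorem Ell.detInv_det (z : S.carrier) : Ell.detInv z * Ell.det z = 1 := by
  simpa using! Ell.mk_rel S (Rel.detInv_det z)

theorem Ell.ml_one : (Ell.ml 1 : Ell S) = 1 := by simpa using Ell.ml_const (S := S) 1

theorem Ell.mr_one : (Ell.mr 1 : Ell S) = 1 := by simpa using Ell.mr_const (S := S) 1

theorem Ell.ml_neg (f : Mer) : (Ell.ml (-f) : Ell S) = -Ell.ml f := by
  have h := Ell.ml_mul (S := S) (algebraMap ℂ Mer (-1)) f
  rw [Ell.ml_const] at h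
  simpa using h

theorem Ell.mr_neg (f : Mer) : (Ell.mr (-f) : Ell S) = -Ell.mr f := by
  have h := Ell.mr_mul (S := S) (algebraMap ℂ Mer (-1)) f
  rw [Ell.mr_const] at h
  simpa using h

theorem Ell.ml_zero : (Ell.ml 0 : Ell S) = 0 := by
  simpa using Ell.ml_const (S := S) 0

theorem Ell.mr_zero : (Ell.mr 0 : Ell S) = 0 := by
  simpa using Ell.mr_const (S := S) 0

theorem Ell.ml_LL (f : Mer) (a b c d : Bool) (h : wt a + wt c = 0) (z z' : S.carrier) :
    Ell.ml f * (Ell.L a b z * Ell.L c d z') = Ell.L a b z * Ell.L c d z' * Ell.ml f := by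
  rw [← mul_assoc, Ell.ml_L, mul_assoc, Ell.ml_L, shift_shift, ← mul_assoc, ← Int.cast_add,
    add_comm, h, Int.cast_zero, shift_zero]

theorem Ell.mr_LL (f : Mer) (a b c d : Bool) (h : wt b + wt d = 0) (z z' : S.carrier) :
    Ell.mr f * (Ell.L a b z * Ell.L c d z') = Ell.L a b z * Ell.L c d z' * Ell.mr f := by
  rw [← mul_assoc, Ell.mr_L, mul_assoc, Ell.mr_L, shift_shift, ← mul_assoc, ← Int.cast_add,
    add_comm, h, Int.cast_zero, shift_zero]

theorem Ell.ml_comm (f g : Mer) : (Ell.ml f * Ell.ml g : Ell S) = Ell.ml g * Ell.ml f := by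
  rw [← Ell.ml_mul, mul_comm, Ell.ml_mul]

theorem Ell.mr_comm (f g : Mer) : (Ell.mr f * Ell.mr g : Ell S) = Ell.mr g * Ell.mr f := by
  rw [← Ell.mr_mul, mul_comm, Ell.mr_mul]

theorem Ell.ml_det (f : Mer) (z : S.carrier) : Commute (Ell.ml f) (Ell.det z) := by
  rw [Ell.det_eq]
  refine Commute.mul_right (Commute.mul_right (Ell.ml_mr _ _) (Ell.ml_comm _ _)) ?_
  exact Commute.sub_right (Ell.ml_LL _ _ _ _ _ rfl _ _) (Ell.ml_LL _ _ _ _ _ rfl _ _)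

theorem Ell.mr_det (f : Mer) (z : S.carrier) : Commute (Ell.mr f) (Ell.det z) := by
  rw [Ell.det_eq]
  refine Commute.mul_right (Commute.mul_right (Ell.mr_comm _ _) (Ell.ml_mr _ _).symm) ?_
  exact Commute.sub_right (Ell.mr_LL _ _ _ _ _ rfl _ _) (Ell.mr_LL _ _ _ _ _ rfl _ _)

theorem Ell.commute_detInv {a : Ell S} {z : S.carrier} (h : Commute a (Ell.det z)) :
    Commute a (Ell.detInv z) := by
  change a * Ell.detInv z = Ell.detInv z * a
  calc a * Ell.detInv z = Ell.detInv z * Ell.det z * (a * Ell.detInv z) := by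
        rw [Ell.detInv_det, one_mul]
    _ = Ell.detInv z * (a * Ell.det z) * Ell.detInv z := by rw [h.eq]; noncomm_ring
    _ = Ell.detInv z * a := by
        rw [mul_assoc, mul_assoc, Ell.det_detInv, mul_one]

end relations

section residual

variable (P)

/-- At `u = q⁻²` the cleared `R`-matrix degenerates. -/
theorem rNum_diag : theta P (qq P 1 * (qq P 1)⁻¹) = 0 := by
  rw [mul_inv_cancel₀ (qq_ne_zero P 1), theta, poch_eq]
  simp

theorem mer1 (s c : ℂ) : Meromorphic fun x : ℂ => theta P (qq P (s * x + c)) := by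
  simpa using meromorphic_theta P s c 1 one_ne_zero

theorem rNum_res_ab :
    rNum P (qq P 1)⁻¹ true false true false = -rNum P (qq P 1)⁻¹ false true true false := by
  have h1 : Meromorphic fun x => theta P (qq P 1) * theta P (qq P (-(x + 1)) * (qq P 1)⁻¹) /
      theta P (qq P (-(x + 1))) := by
    have e1 := meromorphic_theta P (-1) (-1) (qq P 1)⁻¹ (inv_ne_zero (qq_ne_zero P 1))
    have e2 := mer1 P (-1) (-1)
    have e : ∀ x : ℂ, -1 * x + -1 = -(x + 1) := fun x => by ring
    simp only [e] at e1 e2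
    fun_prop
  simp only [rNum]
  rw [← toM_neg h1]
  congr 1
  ext x
  have h2 : qq P (-(x + 1)) * (qq P 1)⁻¹ = (qq P (x + 2))⁻¹ := by
    rw [← qq_neg, ← qq_neg, ← qq_add]; ring_nf
  have h3 : qq P (x + 2) = qq P (x + 1) * qq P 1 := by rw [← qq_add]; ring_nf
  rw [h2, qq_neg P (x + 1), theta_inv P (qq_ne_zero P _), theta_inv P (qq_ne_zero P _),
    theta_inv P (qq_ne_zero P _), h3]
  have := qq_ne_zero P 1
  have := qq_ne_zero P (x + 1)
  by_cases h : theta P (qq P (x + 1)) = 0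
  · simp [h]
  · field_simp

theorem rNum_res_cd :
    rNum P (qq P 1)⁻¹ false true false true = -rNum P (qq P 1)⁻¹ true false false true := by
  have h1 : Meromorphic fun x => theta P (qq P 1) * theta P (qq P (x + 1) * (qq P 1)⁻¹) /
      theta P (qq P (x + 1)) := by
    have e1 := meromorphic_theta P 1 1 (qq P 1)⁻¹ (inv_ne_zero (qq_ne_zero P 1))
    have e2 := mer1 P 1 1
    simp only [one_mul] at e1 e2
    fun_prop
  simp only [rNum]
  rw [← toM_neg h1]
  congr 1
  ext x
  have h2 : qq P (x + 1) * (qq P 1)⁻¹ = qq P x := by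
    rw [qq_add, mul_assoc, mul_inv_cancel₀ (qq_ne_zero P 1), mul_one]
  rw [h2, qq_neg P (x + 1), qq_neg P x, theta_inv P (qq_ne_zero P _), theta_inv P (qq_ne_zero P _),
    theta_inv P (qq_ne_zero P _), qq_add P x 1]
  have := qq_ne_zero P 1
  have := qq_ne_zero P x
  by_cases h : theta P (qq P x * qq P 1) = 0
  · simp [h]
  · field_simp

theorem rNum_res_ne : rNum P (qq P 1)⁻¹ true false true false ≠ 0 := by
  have e1 := mer1 P 1 2
  have e2 := mer1 P 1 1
  have n1 := eventually_theta_ne_zero P 1 2 1 one_ne_zero one_ne_zero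
  have n2 := eventually_theta_ne_zero P 1 1 1 one_ne_zero one_ne_zero
  have n3 : theta P (qq P 1) ≠ 0 := by simpa using theta_qq_ne_zero P (n := 1) one_pos
  simp only [one_mul, mul_one] at e1 e2 n1 n2
  refine toM_ne_zero (by fun_prop) fun h => not_eventually_codiscrete_false ?_
  filter_upwards [h, n1, n2] with x h h1 h2
  refine h ?_
  rw [theta_inv P (qq_ne_zero P 1)]
  exact div_ne_zero (mul_ne_zero (mul_ne_zero (neg_ne_zero.2 (inv_ne_zero (qq_ne_zero P 1))) n3) h1)
    h2

theorem detF_ne_zero : detF P ≠ 0 := by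
  have hq : (P.q : ℂ) ≠ 0 := by exact_mod_cast P.q_pos.ne'
  have e := mer1 P (-1) (-1)
  have n := eventually_theta_ne_zero P (-1) (-1) 1 (by norm_num) one_ne_zero
  have e' : ∀ x : ℂ, -1 * x + -1 = -(x + 1) := fun x => by ring
  simp only [e', mul_one] at e n
  have e3 : Meromorphic fun x : ℂ => (P.q : ℂ) ^ x := by
    have : (fun x : ℂ => (P.q : ℂ) ^ x) = fun x => Complex.exp (Complex.log P.q * x) := by
      ext x; rw [Complex.cpow_def_of_ne_zero hq]
    rw [this]
    exact meromorphic_of_differentiable (by fun_prop)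
  refine toM_ne_zero (by fun_prop) fun h => not_eventually_codiscrete_false ?_
  filter_upwards [h, n] with x h h1
  exact h (mul_ne_zero (by simp [Complex.cpow_eq_zero_iff, hq]) h1)

variable {P}

theorem up_ratio (z : S.carrier) : (z : ℂ) / (S.up 1 z : ℂ) = (qq P 1)⁻¹ := by
  have h1 := qq_natCast P 1
  have h2 := qq_ne_zero P 1
  have h3 := S.ne_zero _ z.2
  rw [Nat.cast_one] at h1
  have h4 : ((S.up 1 z : S.carrier) : ℂ) = qq P 1 * z := by rw [h1]; rfl
  rw [h4]
  field_simp

theorem Ell.res_left (b d : Bool) (z : S.carrier) :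
    Ell.ml (rNum P (qq P 1)⁻¹ true false true false) *
      (Ell.L true b z * Ell.L false d (S.up 1 z) - Ell.L false b z * Ell.L true d (S.up 1 z)) =
    ∑ x, ∑ y, Ell.mr (rNum P (qq P 1)⁻¹ b d x y) * Ell.L false y (S.up 1 z) * Ell.L true x z := by
  have h := Ell.RLL true b false d z (S.up 1 z)
  rw [up_ratio] at h
  rw [← h]
  have e := rNum_res_ab P
  have e' : rNum P (qq P 1)⁻¹ false true true false =
    -rNum P (qq P 1)⁻¹ true false true false := by rw [e, neg_neg]
  simp only [Fintype.sum_bool, e']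
  simp only [rNum, Ell.ml_neg, Ell.ml_zero]
  noncomm_ring

theorem Ell.ml_cancel {f : Mer} (hf : f ≠ 0) {a b : Ell S} (h : Ell.ml f * a = Ell.ml f * b) :
    a = b := by
  have := congrArg (fun t => Ell.ml f⁻¹ * t) h
  simpa [← mul_assoc, ← Ell.ml_mul, inv_mul_cancel₀ hf, Ell.ml_one] using this

theorem Ell.res_same (b : Bool) (z : S.carrier) :
    Ell.L true b z * Ell.L false b (S.up 1 z) = Ell.L false b z * Ell.L true b (S.up 1 z) := by
  rw [← sub_eq_zero]
  refine Ell.ml_cancel (rNum_res_ne P) ?_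
  rw [Ell.res_left, mul_zero]
  have h0 : toM (fun _ => theta P (qq P 1 * (qq P 1)⁻¹)) = 0 := by
    rw [rNum_diag]; exact toM_zero
  cases b <;> simp [rNum, Ell.mr_zero, h0]

theorem Ell.res_anti (z : S.carrier) :
    Ell.L true false z * Ell.L false true (S.up 1 z) -
      Ell.L false false z * Ell.L true true (S.up 1 z) =
    -(Ell.L true true z * Ell.L false false (S.up 1 z) -
      Ell.L false true z * Ell.L true false (S.up 1 z)) := by
  refine Ell.ml_cancel (rNum_res_ne P) ?_
  rw [mul_neg, Ell.res_left, Ell.res_left]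
  have e1 := rNum_res_ab P
  have e2 := rNum_res_cd P
  simp only [Fintype.sum_bool, e1, e2]
  simp only [rNum, Ell.mr_neg, Ell.mr_zero]
  noncomm_ring

end residual

open TensorProduct

variable (S)

/-- The subspace of `E ⊗_ℂ E` spanned by all `μ_r(f)a ⊗ b - a ⊗ μ_l(f)b`. -/
def Ell.J : Submodule ℂ (Ell S ⊗[ℂ] Ell S) :=
  Submodule.span ℂ {t | ∃ (f : Mer) (a b : Ell S), (Ell.mr f * a) ⊗ₜ b - a ⊗ₜ (Ell.ml f * b) = t}

/-- The tensor product `E ⊗_M E` over the field `M` of meromorphic functions, where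
`μ_r(f)a ⊗ b = a ⊗ μ_l(f)b`. -/
abbrev Ell.TP : Type := (Ell S ⊗[ℂ] Ell S) ⧸ Ell.J S

variable {S}

/-- The class of `a ⊗ b` in `E ⊗_M E`. -/
def Ell.tp (a b : Ell S) : Ell.TP S := (Ell.J S).mkQ (a ⊗ₜ b)

theorem Ell.tp_mr (f : Mer) (a b : Ell S) :
    (Ell.J S).mkQ ((Ell.mr f * a) ⊗ₜ b) = (Ell.J S).mkQ (a ⊗ₜ (Ell.ml f * b)) := by
  rw [← sub_eq_zero, ← map_sub, Submodule.mkQ_apply, Submodule.Quotient.mk_eq_zero]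
  exact Submodule.subset_span ⟨f, a, b, rfl⟩

theorem Ell.J_mul {j : Ell S ⊗[ℂ] Ell S} (hj : j ∈ Ell.J S) (t : Ell S ⊗[ℂ] Ell S) :
    j * t ∈ Ell.J S := by
  induction hj using Submodule.span_induction with
  | mem x hx =>
    obtain ⟨f, a, b, rfl⟩ := hx
    induction t with
    | zero => simp
    | tmul c d =>
      rw [sub_mul, Algebra.TensorProduct.tmul_mul_tmul, Algebra.TensorProduct.tmul_mul_tmul,
        mul_assoc, mul_assoc]
      exact Submodule.subset_span ⟨f, a * c, b * d, rfl⟩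
    | add x y hx hy => rw [mul_add]; exact add_mem hx hy
  | zero => simp
  | add x y _ _ hx hy => rw [add_mul]; exact add_mem hx hy
  | smul c x _ hx => rw [smul_mul_assoc]; exact Submodule.smul_mem _ _ hx

theorem Ell.tmul_J {c d : Ell S} (σ : Mer → Mer) (hc : ∀ f, c * Ell.mr f = Ell.mr (σ f) * c)
    (hd : ∀ f, d * Ell.ml f = Ell.ml (σ f) * d) {j : Ell S ⊗[ℂ] Ell S} (hj : j ∈ Ell.J S) :
    c ⊗ₜ d * j ∈ Ell.J S := by
  induction hj using Submodule.span_induction with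
  | mem x hx =>
    obtain ⟨f, a, b, rfl⟩ := hx
    rw [mul_sub, Algebra.TensorProduct.tmul_mul_tmul, Algebra.TensorProduct.tmul_mul_tmul,
      ← mul_assoc, ← mul_assoc, hc, hd, mul_assoc, mul_assoc]
    exact Submodule.subset_span ⟨σ f, c * a, d * b, rfl⟩
  | zero => simp
  | add x y _ _ hx hy => rw [mul_add]; exact add_mem hx hy
  | smul c x _ hx => rw [mul_smul_comm]; exact Submodule.smul_mem _ _ hx

/-- The comultiplication on the generators. -/
def Ell.comulGen : Gen S → Ell S ⊗[ℂ] Ell S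
  | .L a b z => ∑ x, Ell.L a x z ⊗ₜ Ell.L x b z
  | .detInv z => Ell.detInv z ⊗ₜ Ell.detInv z
  | .ml f => Ell.ml f ⊗ₜ 1
  | .mr f => 1 ⊗ₜ Ell.mr f

/-- The multiplicative extension of `comulGen` to the free algebra. -/
def Ell.comulFree : FreeAlgebra ℂ (Gen S) →ₐ[ℂ] Ell S ⊗[ℂ] Ell S :=
  FreeAlgebra.lift ℂ Ell.comulGen

theorem Ell.comulFree_ι (g : Gen S) :
    Ell.comulFree (FreeAlgebra.ι ℂ g) = Ell.comulGen g := by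
  simp [Ell.comulFree]

theorem Ell.L_ml (f : Mer) (a b : Bool) (z : S.carrier) :
    Ell.L a b z * Ell.ml f = Ell.ml (shift (-(wt a : ℂ)) f) * Ell.L a b z := by
  rw [Ell.ml_L, shift_shift, add_neg_cancel, shift_zero]

theorem Ell.L_mr (f : Mer) (a b : Bool) (z : S.carrier) :
    Ell.L a b z * Ell.mr f = Ell.mr (shift (-(wt b : ℂ)) f) * Ell.L a b z := by
  rw [Ell.mr_L, shift_shift, add_neg_cancel, shift_zero]

theorem Ell.comulGen_J (g : Gen S) {j : Ell S ⊗[ℂ] Ell S} (hj : j ∈ Ell.J S) :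
    Ell.comulGen g * j ∈ Ell.J S := by
  cases g with
  | L a b z =>
    rw [Ell.comulGen, Finset.sum_mul]
    exact sum_mem fun x _ => Ell.tmul_J (shift (-(wt x : ℂ))) (fun f => Ell.L_mr f a x z)
      (fun f => Ell.L_ml f x b z) hj
  | detInv z =>
    exact Ell.tmul_J id (fun f => (Ell.commute_detInv (Ell.mr_det f z)).symm.eq)
      (fun f => (Ell.commute_detInv (Ell.ml_det f z)).symm.eq) hj
  | ml f => exact Ell.tmul_J id (fun g => Ell.ml_mr f g) (fun g => by simp) hj
  | mr f => exact Ell.tmul_J id (fun g => by simp) (fun g => (Ell.ml_mr g f).symm) hj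

theorem Ell.comulFree_J (x : FreeAlgebra ℂ (Gen S)) {j : Ell S ⊗[ℂ] Ell S} (hj : j ∈ Ell.J S) :
    Ell.comulFree x * j ∈ Ell.J S := by
  induction x using FreeAlgebra.induction generalizing j with
  | grade0 r =>
    rw [AlgHom.commutes, ← Algebra.smul_def]
    exact Submodule.smul_mem _ _ hj
  | grade1 g => rw [Ell.comulFree_ι]; exact Ell.comulGen_J g hj
  | mul a b ha hb => rw [map_mul, mul_assoc]; exact ha (hb hj)
  | add a b ha hb => rw [map_add, add_mul]; exact add_mem (ha hj) (hb hj)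

theorem Ell.comulFree_det (z : S.carrier) :
    (Ell.J S).mkQ (Ell.comulFree (detFree S z)) =
      (Ell.J S).mkQ (Ell.det z ⊗ₜ Ell.det z) := by
  have h1 := Ell.res_same true z
  have h2 := Ell.res_same false z
  have h3 : Ell.L true false z * Ell.L false true (S.up 1 z) =
      Ell.L false false z * Ell.L true true (S.up 1 z) -
      (Ell.L true true z * Ell.L false false (S.up 1 z) -
      Ell.L false true z * Ell.L true false (S.up 1 z)) := by
    rw [sub_eq_add_neg, ← Ell.res_anti z]
    abel
  set D := Ell.L true true z * Ell.L false false (S.up 1 z) -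
      Ell.L false true z * Ell.L true false (S.up 1 z) with hD
  have hDD : (∑ x, Ell.L true x z ⊗ₜ[ℂ] Ell.L x true z) *
        (∑ x, Ell.L false x (S.up 1 z) ⊗ₜ[ℂ] Ell.L x false (S.up 1 z)) -
      (∑ x, Ell.L false x z ⊗ₜ[ℂ] Ell.L x true z) *
        (∑ x, Ell.L true x (S.up 1 z) ⊗ₜ[ℂ] Ell.L x false (S.up 1 z)) = D ⊗ₜ D := by
    simp only [Fintype.sum_bool, add_mul, mul_add, Algebra.TensorProduct.tmul_mul_tmul, h1, h2, h3]
    simp only [hD, sub_tmul, tmul_sub]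
    abel
  have key : Ell.comulFree (detFree S z) =
      (Ell.ml (detF P)⁻¹ * D) ⊗ₜ (Ell.mr (detF P) * D) := by
    simp only [detFree, map_mul, map_sub, Ell.comulFree_ι, Ell.comulGen]
    rw [hDD, Algebra.TensorProduct.tmul_mul_tmul, Algebra.TensorProduct.tmul_mul_tmul,
      one_mul, mul_one]
  have hF : Ell.ml (detF P) * (Ell.mr (detF P) * (Ell.ml (detF P)⁻¹ * D)) =
      Ell.mr (detF P) * D := by
    rw [← mul_assoc, Ell.ml_mr, mul_assoc, ← mul_assoc (Ell.ml (detF P)), ← Ell.ml_mul,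
      mul_inv_cancel₀ (detF_ne_zero P), Ell.ml_one, one_mul]
  rw [key, Ell.det_eq, ← hD, mul_assoc, Ell.tp_mr, hF]

theorem Ell.comulFree_RLL (a b c d : Bool) (z₁ z₂ : S.carrier) :
    (Ell.J S).mkQ (∑ x, ∑ y, (Ell.ml (rNum P (z₁ / z₂) x y a c) ⊗ₜ[ℂ] (1 : Ell S)) *
          (∑ s, Ell.L x s z₁ ⊗ₜ[ℂ] Ell.L s b z₁) * (∑ t, Ell.L y t z₂ ⊗ₜ[ℂ] Ell.L t d z₂)) =
    (Ell.J S).mkQ (∑ x, ∑ y, ((1 : Ell S) ⊗ₜ[ℂ] Ell.mr (rNum P (z₁ / z₂) b d x y)) *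
          (∑ t, Ell.L c t z₂ ⊗ₜ[ℂ] Ell.L t y z₂) * (∑ s, Ell.L a s z₁ ⊗ₜ[ℂ] Ell.L s x z₁)) := by
  have hL : (∑ x, ∑ y, (Ell.ml (rNum P (z₁ / z₂) x y a c) ⊗ₜ[ℂ] (1 : Ell S)) *
          (∑ s, Ell.L x s z₁ ⊗ₜ[ℂ] Ell.L s b z₁) * (∑ t, Ell.L y t z₂ ⊗ₜ[ℂ] Ell.L t d z₂)) =
      ∑ s, ∑ t, (∑ x, ∑ y, Ell.ml (rNum P (z₁ / z₂) x y a c) * Ell.L x s z₁ * Ell.L y t z₂) ⊗ₜ[ℂ]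
        (Ell.L s b z₁ * Ell.L t d z₂) := by
    simp only [Fintype.sum_bool, add_mul, mul_add, Algebra.TensorProduct.tmul_mul_tmul,
      one_mul, add_tmul, mul_assoc]
    abel
  have hR : (∑ x, ∑ y, ((1 : Ell S) ⊗ₜ[ℂ] Ell.mr (rNum P (z₁ / z₂) b d x y)) *
          (∑ t, Ell.L c t z₂ ⊗ₜ[ℂ] Ell.L t y z₂) * (∑ s, Ell.L a s z₁ ⊗ₜ[ℂ] Ell.L s x z₁)) =
      ∑ s, ∑ t, (Ell.L c t z₂ * Ell.L a s z₁) ⊗ₜ[ℂ]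
        (∑ x, ∑ y, Ell.mr (rNum P (z₁ / z₂) b d x y) * Ell.L t y z₂ * Ell.L s x z₁) := by
    simp only [Fintype.sum_bool, add_mul, mul_add, Algebra.TensorProduct.tmul_mul_tmul,
      one_mul, tmul_add, mul_assoc]
    abel
  rw [hL, hR]
  simp only [Ell.RLL a _ c _ z₁ z₂, ← Ell.RLL _ b _ d z₁ z₂]
  simp only [TensorProduct.sum_tmul, TensorProduct.tmul_sum, map_sum, mul_assoc, Ell.tp_mr]
  simp only [Fintype.sum_bool]
  abel

theorem Ell.comulFree_rel {x y : FreeAlgebra ℂ (Gen S)} (h : Rel S x y) :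
    (Ell.J S).mkQ (Ell.comulFree x) = (Ell.J S).mkQ (Ell.comulFree y) := by
  cases h with
  | ml_add f g => simp only [map_add, Ell.comulFree_ι, Ell.comulGen, Ell.ml_add, add_tmul]
  | ml_mul f g =>
    simp only [map_mul, Ell.comulFree_ι, Ell.comulGen, Ell.ml_mul,
      Algebra.TensorProduct.tmul_mul_tmul, mul_one]
  | ml_const c =>
    rw [AlgHom.commutes, Ell.comulFree_ι, Ell.comulGen, Ell.ml_const]
    rfl
  | mr_add f g => simp only [map_add, Ell.comulFree_ι, Ell.comulGen, Ell.mr_add, tmul_add]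
  | mr_mul f g =>
    simp only [map_mul, Ell.comulFree_ι, Ell.comulGen, Ell.mr_mul,
      Algebra.TensorProduct.tmul_mul_tmul, mul_one]
  | mr_const c =>
    rw [AlgHom.commutes, Ell.comulFree_ι, Ell.comulGen, Ell.mr_const,
      Algebra.algebraMap_eq_smul_one, tmul_smul, Algebra.algebraMap_eq_smul_one]
    rfl
  | ml_mr f g =>
    simp only [map_mul, Ell.comulFree_ι, Ell.comulGen,
      Algebra.TensorProduct.tmul_mul_tmul, mul_one, one_mul]
  | ml_L f a b z =>
    simp only [map_mul, Ell.comulFree_ι, Ell.comulGen, Finset.mul_sum, Finset.sum_mul,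
      Algebra.TensorProduct.tmul_mul_tmul, mul_one, one_mul, Ell.ml_L]
  | mr_L f a b z =>
    simp only [map_mul, Ell.comulFree_ι, Ell.comulGen, Finset.mul_sum, Finset.sum_mul,
      Algebra.TensorProduct.tmul_mul_tmul, mul_one, one_mul, Ell.mr_L]
  | RLL a b c d z₁ z₂ =>
    simp only [map_mul, map_sum (Ell.comulFree (S := S)), Ell.comulFree_ι, Ell.comulGen]
    exact Ell.comulFree_RLL a b c d z₁ z₂
  | det_detInv z =>
    have h := Ell.comulFree_det z
    rw [← sub_eq_zero, ← map_sub, Submodule.mkQ_apply, Submodule.Quotient.mk_eq_zero] at h ⊢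
    have h' := Ell.J_mul h (Ell.detInv z ⊗ₜ Ell.detInv z)
    rw [sub_mul, Algebra.TensorProduct.tmul_mul_tmul, Ell.det_detInv] at h'
    rw [map_mul, Ell.comulFree_ι, Ell.comulGen, map_one]
    exact h'
  | detInv_det z =>
    have h := Ell.comulFree_det z
    rw [← sub_eq_zero, ← map_sub, Submodule.mkQ_apply, Submodule.Quotient.mk_eq_zero] at h ⊢
    have h' := Ell.comulGen_J (Gen.detInv z) h
    rw [Ell.comulGen, mul_sub, Algebra.TensorProduct.tmul_mul_tmul, Ell.detInv_det] at h'
    rw [map_mul, Ell.comulFree_ι, Ell.comulGen, map_one]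
    exact h'

/-- Left multiplication by the comultiplication of an element of the free algebra. -/
def Ell.comulActFree : FreeAlgebra ℂ (Gen S) →ₐ[ℂ] Module.End ℂ (Ell.TP S) :=
  FreeAlgebra.lift ℂ fun g => (Ell.J S).mapQ (Ell.J S) (LinearMap.mulLeft ℂ (Ell.comulGen g))
    fun _ hj => Ell.comulGen_J g hj

theorem Ell.comulActFree_apply (x : FreeAlgebra ℂ (Gen S)) (t : Ell S ⊗[ℂ] Ell S) :
    Ell.comulActFree x ((Ell.J S).mkQ t) = (Ell.J S).mkQ (Ell.comulFree x * t) := by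
  induction x using FreeAlgebra.induction generalizing t with
  | grade0 r =>
    rw [AlgHom.commutes, AlgHom.commutes, ← Algebra.smul_def]
    simp
  | grade1 g =>
    rw [Ell.comulFree_ι, Ell.comulActFree, FreeAlgebra.lift_ι_apply]
    rfl
  | mul a b ha hb => rw [map_mul, map_mul Ell.comulFree, Module.End.mul_apply, hb, ha, mul_assoc]
  | add a b ha hb => rw [map_add, map_add Ell.comulFree, LinearMap.add_apply, hb, ha, add_mul, map_add]

/-- The action of `E` on `E ⊗_M E` by left multiplication with the comultiplication. -/
def Ell.comulAct : Ell S →ₐ[ℂ] Module.End ℂ (Ell.TP S) :=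
  RingQuot.liftAlgHom ℂ ⟨Ell.comulActFree, fun x y h => by
    refine LinearMap.ext fun t => ?_
    obtain ⟨t, rfl⟩ := (Ell.J S).mkQ_surjective t
    have h' := Ell.comulFree_rel h
    rw [Ell.comulActFree_apply, Ell.comulActFree_apply]
    rw [← sub_eq_zero, ← map_sub, Submodule.mkQ_apply, Submodule.Quotient.mk_eq_zero] at h' ⊢
    rw [← sub_mul]
    exact Ell.J_mul h' t⟩

/-- The comultiplication `Δ : E → E ⊗_M E`. It is characterized by `comul_mk`: on a product of
generators it is the product of the comultiplications of the generators. -/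
def Ell.comul : Ell S →ₗ[ℂ] Ell.TP S :=
  (LinearMap.applyₗ ((Ell.J S).mkQ 1)).comp Ell.comulAct.toLinearMap

theorem Ell.comul_mk (x : FreeAlgebra ℂ (Gen S)) :
    Ell.comul (Ell.mk S x) = (Ell.J S).mkQ (Ell.comulFree x) := by
  have h : Ell.comulAct (Ell.mk S x) = Ell.comulActFree x :=
    RingQuot.liftAlgHom_mkAlgHom_apply ℂ _ _ x
  have h2 := Ell.comulActFree_apply x 1
  rw [mul_one] at h2
  rw [← h2, ← h]
  rfl

/-- The counit on the generators. -/
def Ell.counitGen : Gen S → Module.End ℂ Mer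
  | .L a b _ => if a = b then T (-wt a) else 0
  | .detInv _ => 1
  | .ml f => mulOp f
  | .mr f => mulOp f

/-- The counit `ε : E → D`, with values in the difference operators. -/
def Ell.counit : Ell S →ₐ[ℂ] Module.End ℂ Mer :=
  RingQuot.liftAlgHom ℂ ⟨FreeAlgebra.lift ℂ Ell.counitGen, fun x y h => by
    have hdet : ∀ z : S.carrier, FreeAlgebra.lift ℂ Ell.counitGen (detFree S z) = 1 := by
      intro z
      simp only [detFree, map_mul, map_sub, FreeAlgebra.lift_ι_apply, Ell.counitGen]
      simp [← mulOp_mul, ← T_add, wt, mul_inv_cancel₀ (detF_ne_zero P), T_zero, mulOp_one]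
    cases h with
    | ml_add f g => simp [Ell.counitGen, mulOp_add]
    | ml_mul f g => simp [Ell.counitGen, mulOp_mul]
    | ml_const c => simp [Ell.counitGen, mulOp_const]
    | mr_add f g => simp [Ell.counitGen, mulOp_add]
    | mr_mul f g => simp [Ell.counitGen, mulOp_mul]
    | mr_const c => simp [Ell.counitGen, mulOp_const]
    | ml_mr f g => simp [Ell.counitGen, ← mulOp_mul, mul_comm]
    | ml_L f a b z =>
      by_cases hab : a = b <;> simp [Ell.counitGen, hab, T_mulOp, shift_shift, shift_zero]
    | mr_L f a b z =>
      by_cases hab : a = b <;> simp [Ell.counitGen, hab, T_mulOp, shift_shift, shift_zero]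
    | RLL a b c d z₁ z₂ =>
      cases a <;> cases b <;> cases c <;> cases d <;>
        simp [Ell.counitGen, rNum, mulOp_zero, mul_assoc, ← T_add, wt]
    | det_detInv z => simp [hdet, Ell.counitGen]
    | detInv_det z => simp [hdet, Ell.counitGen]⟩

/-- The component of bidegree `(m, n)` of the algebra of difference operators: it is
`{f T_{-m}}` for `m = n` and `{0}` for `m ≠ n`. -/
def Dgr (m n : ℤ) : Set (Module.End ℂ Mer) :=
  {φ | φ = 0 ∨ m = n ∧ ∃ f : Mer, φ = mulOp f * T (-m)}

/-- `pair` is a pairing `U × A → D` of dynamical bialgebroids, where `U` is the co-opposite of the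
elliptic quantum group with spectral parameters in `W` and `A` is the elliptic quantum group with
spectral parameters in `Z`, and its values on the generators `L_{ij}(w)`, `L_{kl}(z)` are given by
the `R`-matrix. In `U` the moment maps and the two degrees are interchanged,
`μ_l^U = μ_r`, `μ_r^U = μ_l`, `U_{αβ} = E_{βα}`, and `Δ^U` is `Δ` followed by the flip.
By `target` all values of `pair` are difference operators, that is, sums of operators `f T_n`. -/
structure IsEllPairing (W Z : SpectralSet P)
    (pair : Ell W →ₗ[ℂ] Ell Z →ₗ[ℂ] Module.End ℂ Mer) : Prop where
  /-- `⟨U_{αβ}, A_{γδ}⟩ ⊆ D_{α+δ, β+γ}` -/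
  target : ∀ (α β γ δ : ℤ) (X : Ell W) (a : Ell Z), X ∈ Ell.gr W β α → a ∈ Ell.gr Z γ δ →
    pair X a ∈ Dgr (α + δ) (β + γ)
  /-- `⟨μ_l^U(f) X, a⟩ = f ∘ ⟨X, a⟩` -/
  left_moment_fst : ∀ (f : Mer) (X : Ell W) (a : Ell Z),
    pair (Ell.mr f * X) a = mulOp f * pair X a
  /-- `⟨X, μ_l(f) a⟩ = f ∘ ⟨X, a⟩` -/
  left_moment_snd : ∀ (f : Mer) (X : Ell W) (a : Ell Z),
    pair X (Ell.ml f * a) = mulOp f * pair X a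
  /-- `⟨X μ_r^U(f), a⟩ = ⟨X, a⟩ ∘ f` -/
  right_moment_fst : ∀ (f : Mer) (X : Ell W) (a : Ell Z),
    pair (X * Ell.ml f) a = pair X a * mulOp f
  /-- `⟨X, a μ_r(f)⟩ = ⟨X, a⟩ ∘ f` -/
  right_moment_snd : ∀ (f : Mer) (X : Ell W) (a : Ell Z),
    pair X (a * Ell.mr f) = pair X a * mulOp f
  /-- `⟨XY, a⟩ = ∑ ⟨X, a₁⟩ T_ρ ⟨Y, a₂⟩` if `Δ(a) = ∑ a₁ ⊗ a₂` with `a₁ ∈ A_{γρ}`, `a₂ ∈ A_{ρδ}` -/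
  mul_fst : ∀ (X Y : Ell W) (a : Ell Z) (ι : Type) [Fintype ι] (a₁ a₂ : ι → Ell Z)
    (γ δ : ℤ) (ρ : ι → ℤ), (∀ i, a₁ i ∈ Ell.gr Z γ (ρ i)) → (∀ i, a₂ i ∈ Ell.gr Z (ρ i) δ) →
    Ell.comul a = ∑ i, Ell.tp (a₁ i) (a₂ i) →
    pair (X * Y) a = ∑ i, pair X (a₁ i) * T (ρ i) * pair Y (a₂ i)
  /-- `⟨X, ab⟩ = ∑ ⟨X₂, a⟩ T_ρ ⟨X₁, b⟩` if `Δ(X) = ∑ X₁ ⊗ X₂`, that is `Δ^U(X) = ∑ X₂ ⊗ X₁`,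
  with `X₂ ∈ U_{αρ}`, `X₁ ∈ U_{ρβ}` -/
  mul_snd : ∀ (X : Ell W) (a b : Ell Z) (ι : Type) [Fintype ι] (X₁ X₂ : ι → Ell W)
    (α β : ℤ) (ρ : ι → ℤ), (∀ i, X₁ i ∈ Ell.gr W β (ρ i)) → (∀ i, X₂ i ∈ Ell.gr W (ρ i) α) →
    Ell.comul X = ∑ i, Ell.tp (X₁ i) (X₂ i) →
    pair X (a * b) = ∑ i, pair (X₂ i) a * T (ρ i) * pair (X₁ i) b
  /-- `⟨X, 1⟩ = ε(X)` -/
  counit_fst : ∀ X : Ell W, pair X 1 = Ell.counit X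
  /-- `⟨1, a⟩ = ε(a)` -/
  counit_snd : ∀ a : Ell Z, pair 1 a = Ell.counit a
  /-- `⟨L_{ij}(w), L_{kl}(z)⟩ = R^{jl}_{ik}(λ, w/z) T_{-ω(i)-ω(k)}` -/
  gen : ∀ (i j k l : Bool) (w : W.carrier) (z : Z.carrier),
    pair (Ell.L i j w) (Ell.L k l z) = mulOp (rMat P (w / z) j l i k) * T (-wt i - wt k)

/-- `v_k(z) = γ(z) γ(q²z) ⋯ γ(q^{2(N-k-1)}z) α(q^{2(N-k)}z) ⋯ α(q^{2(N-1)}z)`, for `0 ≤ k ≤ N`. -/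
def Ell.vec (N k : ℕ) (z : S.carrier) : Ell S :=
  ((List.range (N - k)).map fun i => Ell.gamma (S.up i z)).prod *
    ((List.range k).map fun i => Ell.alpha (S.up (N - k + i) z)).prod

/-- `t k j`, for `0 ≤ k, j ≤ N`, are the matrix elements `t^N_{kj}(z)` of the corepresentation on
the span of `v_0(z), …, v_N(z)`: `Δ(v_k(z)) = ∑_j t^N_{kj}(z) ⊗ v_j(z)`. -/
def IsMatrixElements (N : ℕ) (z : S.carrier) (t : ℕ → ℕ → Ell S) : Prop :=
  ∀ k ≤ N, Ell.comul (Ell.vec N k z) = ∑ j ∈ Finset.range (N + 1), Ell.tp (t k j) (Ell.vec N j z)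

end EllU2

end

open EllU2

/-! The vector `v_k` is a product of `k` letters `α` and `N-k` letters `γ` with spectral parameters
`z, q²z, …`. At ratio `q⁻²` the `R`-matrix degenerates and the RLL relations give `α(y)γ(q²y) =
γ(y)α(q²y)`. Hence every word with `k` letters `α` equals `v_k`, whatever the order of its letters
(`Ell.word_eq_vec`). Applying `Δ` letter by letter to any such word expands `Δ(v_k)` in the `v_j`,
with coefficients `Ell.row` in the first tensor factor. This proves existence.

The elements `v_0, …, v_N` are independent over the left moment map
(`IsEllPairing.eq_of_sum_tp_eq`): in the pairing, `β(w)` raises the index by one with a nonzero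
coefficient and the counit sees only `v_N`, so `⟨β(w)^(N-j), ·⟩` is nonzero on `v_j` and kills the
other `v_i`. The matrix elements are therefore unique, and all words for `v_k` have the same row
coefficients. This freedom is the main device: each formula is computed with the most convenient
word.

Pairing `L_{ab}(w)` with a row multiplied on the right by one more letter gives a recursion with
coefficients in the `R`-matrix. By weight conservation, a final `α` changes `⟨α(w), ·⟩` and `⟨β(w),
·⟩` only by a shift, and a final `γ` does the same for `⟨γ(w), ·⟩` and `⟨δ(w), ·⟩`. So `γ⋯γα⋯α`
serves the first two and `α⋯αγ⋯γ` the last two, and what remains are the pure words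
(`IsEllPairing.pair_row_gammas`, `IsEllPairing.pair_row_alphas`). There the diagonal entries
telescope, and the off-diagonal ones need a single three-term theta identity (`theta_fusion`), an
instance of the addition formula for `θ`.

The inverse determinant is grouplike of bidegree zero, so it pairs multiplicatively. On generators
it acts by the inverse of the scalar `q θ(u)/θ(q²u)` times a shift, and the product over the letters
of a word telescopes. -/

noncomputable section
namespace EllU2
open Filter Topology

/-! ### Theta functions of degree two and the addition formula. -/

section thetaAddition
variable (P : Params)
open Real

/-- The Laurent coefficient of index `n` of `f`, up to the factor `2π`, computed on the circle
of radius `R`. -/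
def laurentCoeff (f : ℂ → ℂ) (n : ℤ) (R : ℝ) : ℂ :=
  ∫ t in (0 : ℝ)..2 * π, circleMap 0 R t ^ (-n) * f (circleMap 0 R t)

theorem laurentCoeff_eq_circleIntegral (f : ℂ → ℂ) (n : ℤ) {R : ℝ} (hR : 0 < R) :
    Complex.I * laurentCoeff f n R = ∮ z in C(0, R), (z - 0)⁻¹ • (z ^ (-n) * f z) := by
  rw [laurentCoeff, circleIntegral, ← intervalIntegral.integral_const_mul]
  refine intervalIntegral.integral_congr fun t _ => ?_
  have : circleMap 0 R t ≠ 0 := circleMap_ne_center hR.ne'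
  simp only [deriv_circleMap, smul_eq_mul, sub_zero]
  field_simp

/-- Cauchy's theorem on an annulus: the integrand is holomorphic away from the origin. -/
theorem laurentCoeff_radius {f : ℂ → ℂ} (hf : DifferentiableOn ℂ f {0}ᶜ) (n : ℤ) {r R : ℝ}
    (hr : 0 < r) (hR : r ≤ R) : laurentCoeff f n R = laurentCoeff f n r := by
  have hg : ∀ z : ℂ, z ≠ 0 → DifferentiableAt ℂ (fun z => z ^ (-n) * f z) z := fun z hz =>
    (differentiableAt_zpow.2 (Or.inl hz)).mul
      (hf.differentiableAt (isOpen_compl_singleton.mem_nhds hz))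
  refine mul_left_cancel₀ Complex.I_ne_zero ?_
  rw [laurentCoeff_eq_circleIntegral f n hr,
    laurentCoeff_eq_circleIntegral f n (hr.trans_le hR)]
  refine Complex.circleIntegral_sub_center_inv_smul_eq_of_differentiable_on_annulus_off_countable
    hr hR Set.countable_empty (fun z hz => ?_) (fun z hz => ?_)
  · refine (hg z ?_).continuousAt.continuousWithinAt
    rintro rfl
    exact hz.2 (Metric.mem_ball_self hr)
  · refine hg z ?_
    rintro rfl
    exact hz.1.2 (Metric.mem_closedBall_self hr.le)

theorem continuous_comp_circleMap {f : ℂ → ℂ} (hf : DifferentiableOn ℂ f {0}ᶜ) {R : ℝ}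
    (hR : 0 < R) : Continuous fun t : ℝ => f (circleMap 0 R t) :=
  hf.continuousOn.comp_continuous (continuous_circleMap 0 R)
    fun _ => circleMap_ne_center hR.ne'

/-- On a circle about the origin the Laurent coefficients are, up to nonzero factors, the Fourier
coefficients of a continuous function. If all are zero the Fourier series is summable, so it
converges pointwise to the function. -/
theorem eq_zero_of_laurentCoeff {f : ℂ → ℂ} (hf : DifferentiableOn ℂ f {0}ᶜ)
    (h : ∀ n : ℤ, ∀ R : ℝ, 0 < R → laurentCoeff f n R = 0) {z : ℂ} (hz : z ≠ 0) : f z = 0 := by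
  have hR : 0 < ‖z‖ := norm_pos_iff.2 hz
  set R := ‖z‖
  have : Fact (0 < 2 * π) := ⟨two_pi_pos⟩
  have hper : Function.Periodic (fun t : ℝ => f (circleMap 0 R t)) (2 * π) := fun t => by
    simp only [periodic_circleMap 0 R t]
  let F : C(AddCircle (2 * π), ℂ) :=
    ⟨hper.lift, continuous_quot_lift _ (continuous_comp_circleMap hf hR)⟩
  have hF : ∀ t : ℝ, F (t : AddCircle (2 * π)) = f (circleMap 0 R t) := fun t => rfl
  have hc : ∀ n, fourierCoeff F n = 0 := fun n => by
    rw [fourierCoeff_eq_intervalIntegral F n 0, zero_add]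
    have : ∫ x in (0 : ℝ)..2 * π, @fourier (2 * π) (-n) x • F x =
        (R : ℂ) ^ n * laurentCoeff f n R := by
      rw [laurentCoeff, ← intervalIntegral.integral_const_mul]
      refine intervalIntegral.integral_congr fun t _ => ?_
      have hRc : (R : ℂ) ≠ 0 := by exact_mod_cast hR.ne'
      have h2 : (2 * π : ℂ) ≠ 0 := by exact_mod_cast two_pi_pos.ne'
      simp only [hF, fourier_coe_apply, smul_eq_mul, circleMap_zero, mul_zpow,
        ← Complex.exp_int_mul]
      rw [zpow_neg, ← mul_assoc, ← mul_assoc, mul_inv_cancel₀ (zpow_ne_zero _ hRc), one_mul]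
      congr 2
      push_cast
      field_simp
    rw [this, h n R hR, mul_zero, smul_zero]
  have hs : Summable (fourierCoeff F) := by
    rw [show fourierCoeff F = fun _ => 0 from funext hc]
    exact summable_zero
  have := has_pointwise_sum_fourier_series_of_summable hs ((Complex.arg z : ℝ) : AddCircle (2 * π))
  simp only [hc, zero_smul] at this
  have h0 := this.unique hasSum_zero
  rw [hF, circleMap_zero, Complex.norm_mul_exp_arg_mul_I] at h0
  exact h0

/-- The theta functions of degree two: holomorphic functions on `ℂ \ {0}` with
`f(px) = x⁻² f(x)`, extended by `0`. -/
def thetaSpace : Submodule ℂ (ℂ → ℂ) where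
  carrier := {f | DifferentiableOn ℂ f {0}ᶜ ∧ (∀ x, x ≠ 0 → f (P.p * x) = x⁻¹ ^ 2 * f x) ∧ f 0 = 0}
  add_mem' {f g} hf hg := ⟨hf.1.add hg.1, fun x hx => by
    simp only [Pi.add_apply, hf.2.1 x hx, hg.2.1 x hx]; ring, by simp [hf.2.2, hg.2.2]⟩
  zero_mem' := ⟨differentiableOn_const 0, fun x hx => by simp, rfl⟩
  smul_mem' c f hf := ⟨hf.1.const_smul c, fun x hx => by
    simp only [Pi.smul_apply, smul_eq_mul, hf.2.1 x hx]; ring, by simp [hf.2.2]⟩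

-- The coefficient of index `n` may be computed on the circle of radius `pR`; there `f(px) = x⁻²
-- f(x)` turns it into the coefficient of index `n+2` on the circle of radius `R`.
variable {P} in
theorem laurentCoeff_add_two {f : ℂ → ℂ} (hf : f ∈ thetaSpace P) (n : ℤ) {R : ℝ} (hR : 0 < R) :
    laurentCoeff f (n + 2) R = (P.p : ℂ) ^ n * laurentCoeff f n R := by
  have hp : (P.p : ℂ) ≠ 0 := by exact_mod_cast P.p_pos.ne'
  rw [laurentCoeff_radius hf.1 n (r := P.p * R) (mul_pos P.p_pos hR)
    (by nlinarith [P.p_lt_one]), laurentCoeff, laurentCoeff, ← intervalIntegral.integral_const_mul]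
  refine intervalIntegral.integral_congr fun t _ => ?_
  have hz : circleMap 0 R t ≠ 0 := circleMap_ne_center hR.ne'
  have e : circleMap 0 (P.p * R) t = P.p * circleMap 0 R t := by
    simp [circleMap_zero, mul_assoc]
  simp only [e, hf.2.1 _ hz, mul_zpow]
  have h2 : circleMap 0 R t ^ (-(n + 2)) =
      circleMap 0 R t ^ (-n) * (circleMap 0 R t)⁻¹ ^ 2 := by
    rw [neg_add, zpow_add₀ hz, zpow_neg _ 2, inv_pow]
    norm_cast
  rw [h2, zpow_neg (P.p : ℂ)]
  field_simp

variable {P} in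
theorem thetaSpace_eq_zero {f : ℂ → ℂ} (hf : f ∈ thetaSpace P) (h0 : laurentCoeff f 0 1 = 0)
    (h1 : laurentCoeff f 1 1 = 0) : f = 0 := by
  have hp : (P.p : ℂ) ≠ 0 := by exact_mod_cast P.p_pos.ne'
  -- The recursion has step two, so two consecutive coefficients are carried through the induction,
  -- upwards and downwards.
  have hall : ∀ n : ℤ, laurentCoeff f n 1 = 0 ∧ laurentCoeff f (n + 1) 1 = 0 := by
    intro n
    induction n using Int.induction_on with
    | zero => exact ⟨h0, by simpa using h1⟩
    | succ n ih =>
      refine ⟨ih.2, ?_⟩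
      rw [add_assoc, one_add_one_eq_two, laurentCoeff_add_two hf _ one_pos, ih.1, mul_zero]
    | pred n ih =>
      have h := laurentCoeff_add_two hf (-(n : ℤ) - 1) one_pos
      rw [show -(n : ℤ) - 1 + 2 = -n + 1 by ring, ih.2] at h
      refine ⟨((mul_eq_zero.1 h.symm).resolve_left (zpow_ne_zero _ hp)), ?_⟩
      rw [sub_add_cancel]
      exact ih.1
  funext z
  by_cases hz : z = 0
  · rw [hz]; exact hf.2.2
  refine eq_zero_of_laurentCoeff hf.1 (fun n R hR => ?_) hz
  rcases le_total R 1 with h | h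
  · rw [← laurentCoeff_radius hf.1 n hR h]; exact (hall n).1
  · rw [laurentCoeff_radius hf.1 n one_pos h]; exact (hall n).1

/-- The two Laurent coefficients that determine a theta function of degree two. -/
def thetaCoeffs : thetaSpace P →ₗ[ℂ] (Fin 2 → ℂ) where
  toFun f i := laurentCoeff f.1 (i : ℕ) 1
  map_add' f g := by
    funext i
    simp only [laurentCoeff, Pi.add_apply, Submodule.coe_add, mul_add]
    have hc : Continuous fun t : ℝ => circleMap 0 1 t ^ (-((i : ℕ) : ℤ)) :=
      (continuous_circleMap 0 1).zpow₀ _ fun t => Or.inl (circleMap_ne_center one_ne_zero)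
    exact intervalIntegral.integral_add
      ((hc.mul (continuous_comp_circleMap f.2.1 one_pos)).intervalIntegrable _ _)
      ((hc.mul (continuous_comp_circleMap g.2.1 one_pos)).intervalIntegrable _ _)
  map_smul' c f := by
    funext i
    simp only [laurentCoeff, Pi.smul_apply, Submodule.coe_smul, smul_eq_mul, RingHom.id_apply]
    rw [← intervalIntegral.integral_const_mul]
    exact intervalIntegral.integral_congr fun t _ => by ring

/-- The space has dimension at most two, since two Laurent coefficients determine an element. The
functions `e i` are images of the unit vectors under a left inverse of the coefficient map, so that
map need not be shown surjective. -/
theorem exists_thetaSpace_coords : ∃ (c : Fin 2 → thetaSpace P → ℂ) (e : Fin 2 → ℂ → ℂ),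
    ∀ (f : thetaSpace P) (x : ℂ), f.1 x = c 0 f * e 0 x + c 1 f * e 1 x := by
  have hinj : LinearMap.ker (thetaCoeffs P) = ⊥ := by
    refine LinearMap.ker_eq_bot'.2 fun f hf => Subtype.ext ?_
    exact thetaSpace_eq_zero f.2 (congrFun hf 0) (congrFun hf 1)
  obtain ⟨s, hs⟩ := (thetaCoeffs P).exists_leftInverse_of_injective hinj
  refine ⟨fun i f => thetaCoeffs P f i, fun i x => (s (Pi.single i 1)).1 x, fun f x => ?_⟩
  have h : f = s (thetaCoeffs P f) := (LinearMap.congr_fun hs f).symm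
  have h2 : thetaCoeffs P f =
      thetaCoeffs P f 0 • Pi.single 0 1 + thetaCoeffs P f 1 • Pi.single 1 1 := by
    funext i; fin_cases i <;> simp
  conv_lhs => rw [h, h2, map_add, map_smul, map_smul]
  simp

theorem theta_p_mul {x : ℂ} (hx : x ≠ 0) : theta P (P.p * x) = -x⁻¹ * theta P x := by
  have hp : (P.p : ℂ) ≠ 0 := by exact_mod_cast P.p_pos.ne'
  have h1 : (P.p : ℂ) / (P.p * x) = x⁻¹ := by field_simp
  rw [theta, theta, h1, poch_eq P x⁻¹, poch_eq P x, mul_comm (P.p : ℂ) x, mul_comm x⁻¹,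
    ← div_eq_mul_inv]
  field_simp
  ring

theorem differentiableAt_theta {x : ℂ} (hx : x ≠ 0) : DifferentiableAt ℂ (theta P) x := by
  unfold theta
  exact (differentiable_poch P x).mul (((differentiable_poch P) _).comp x
    ((differentiableAt_const _).fun_div differentiableAt_id hx))

/-- `x ↦ θ(xy, x/y)`, as a theta function of degree two. -/
def thetaPair (y : ℂ) (hy : y ≠ 0) : thetaSpace P :=
  ⟨fun x => if x = 0 then 0 else theta P (x * y) * theta P (x / y), by
    have hp : (P.p : ℂ) ≠ 0 := by exact_mod_cast P.p_pos.ne'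
    refine ⟨?_, fun x hx => ?_, if_pos rfl⟩
    · refine DifferentiableOn.congr (f := fun x => theta P (x * y) * theta P (x / y))
        (fun x hx => ?_) fun x hx => if_neg hx
      have hx : x ≠ 0 := hx
      refine (DifferentiableAt.mul ?_ ?_).differentiableWithinAt
      · exact (differentiableAt_theta P (mul_ne_zero hx hy)).comp x
          (differentiableAt_id.mul_const y)
      · exact (differentiableAt_theta P (div_ne_zero hx hy)).comp x
          (differentiableAt_id.div_const y)
    · simp only [hx, hp, mul_eq_zero, or_self, if_false]
      rw [mul_assoc, theta_p_mul P (mul_ne_zero hx hy), mul_div_assoc,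
        theta_p_mul P (div_ne_zero hx hy)]
      field_simp⟩

/-- The antisymmetric `4 × 4` matrix of the values of `B` has rank at most two, so its determinant
is zero; that determinant is the square of the Pfaffian, which is the asserted relation. -/
theorem plucker_of_antisymm {a b c d : ℂ} {B : ℂ → ℂ → ℂ} {c₀ c₁ e₀ e₁ : ℂ → ℂ}
    (h : ∀ x ∈ ({a, b, c, d} : Set ℂ), ∀ y ∈ ({a, b, c, d} : Set ℂ),
      B x y = c₀ y * e₀ x + c₁ y * e₁ x)
    (hB : ∀ x ∈ ({a, b, c, d} : Set ℂ), ∀ y ∈ ({a, b, c, d} : Set ℂ), B x y = -B y x) :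
    B a b * B c d - B a d * B c b = B a c * B b d := by
  have hd : ∀ x ∈ ({a, b, c, d} : Set ℂ), B x x = 0 := fun x hx => by
    linear_combination (1 / 2) * hB x hx x hx
  have ha : a ∈ ({a, b, c, d} : Set ℂ) := by simp
  have hb : b ∈ ({a, b, c, d} : Set ℂ) := by simp
  have hc : c ∈ ({a, b, c, d} : Set ℂ) := by simp
  have hd' : d ∈ ({a, b, c, d} : Set ℂ) := by simp
  have key : (B a b * B c d - B a c * B b d + B a d * B b c) ^ 2 =
      Matrix.det !![B a a, B a b, B a c, B a d; B b a, B b b, B b c, B b d;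
        B c a, B c b, B c c, B c d; B d a, B d b, B d c, B d d] := by
    rw [hd a ha, hd b hb, hd c hc, hd d hd', hB b hb a ha, hB c hc a ha, hB c hc b hb,
      hB d hd' a ha, hB d hd' b hb, hB d hd' c hc]
    simp [Matrix.det_succ_row_zero, Fin.sum_univ_succ, Fin.succAbove]
    ring
  have hz : Matrix.det !![B a a, B a b, B a c, B a d; B b a, B b b, B b c, B b d;
        B c a, B c b, B c c, B c d; B d a, B d b, B d c, B d d] = 0 := by
    rw [h a ha a ha, h a ha b hb, h a ha c hc, h a ha d hd', h b hb a ha, h b hb b hb,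
      h b hb c hc, h b hb d hd', h c hc a ha, h c hc b hb, h c hc c hc, h c hc d hd',
      h d hd' a ha, h d hd' b hb, h d hd' c hc, h d hd' d hd']
    simp [Matrix.det_succ_row_zero, Fin.sum_univ_succ, Fin.succAbove]
    ring
  have h0 := pow_eq_zero_iff two_ne_zero |>.1 (key.trans hz)
  rw [hB c hc b hb]
  linear_combination h0

/-- The addition formula for `θ`. -/
theorem theta_addition {a b c d : ℂ} (ha : a ≠ 0) (hb : b ≠ 0) (hc : c ≠ 0) (hd : d ≠ 0) :
    theta P (a * b) * theta P (a / b) * theta P (c * d) * theta P (c / d) -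
      theta P (a * d) * theta P (a / d) * theta P (c * b) * theta P (c / b) =
    c / b * (theta P (b * d) * theta P (b / d) * theta P (a * c) * theta P (a / c)) := by
  obtain ⟨k, e, hke⟩ := exists_thetaSpace_coords P
  have hne : ∀ x ∈ ({a, b, c, d} : Set ℂ), x ≠ 0 := by
    rintro x (rfl | rfl | rfl | rfl) <;> assumption
  -- The factor `x⁻¹` makes the kernel antisymmetric, by `θ(1/x) = -x⁻¹ θ(x)`. For fixed `y` the
  -- rest is a theta function of degree two in `x`, which gives the rank bound.
  have h := plucker_of_antisymm (a := a) (b := b) (c := c) (d := d)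
    (B := fun x y => x⁻¹ * (theta P (x * y) * theta P (x / y)))
    (c₀ := fun y => if hy : y = 0 then 0 else k 0 (thetaPair P y hy))
    (c₁ := fun y => if hy : y = 0 then 0 else k 1 (thetaPair P y hy))
    (e₀ := fun x => x⁻¹ * e 0 x) (e₁ := fun x => x⁻¹ * e 1 x)
    (fun x hx y hy => by
      have := hke (thetaPair P y (hne y hy)) x
      rw [thetaPair] at this
      simp only [hne x hx, hne y hy, if_false, dif_neg, not_false_eq_true] at this ⊢
      rw [this, thetaPair]
      ring)
    (fun x hx y hy => by
      have hx := hne x hx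
      have hy := hne y hy
      rw [mul_comm y x, ← inv_div x y, theta_inv P (div_ne_zero hx hy)]
      field_simp)
  field_simp at h ⊢
  linear_combination h

/-- The three-term identity behind the fusion of the `R`-matrix. -/
theorem theta_three_term {k n y u : ℂ} (hk : k ≠ 0) (hn : n ≠ 0) (hy : y ≠ 0) (hu : u ≠ 0) :
    theta P (n ^ 2) * theta P (k ^ 2 * u / y ^ 2) * theta P (u / n ^ 2) *
        theta P (k ^ 2 * y ^ 2) =
      theta P (n ^ 2 * k ^ 2) * theta P (u / y ^ 2) * theta P (k ^ 2 * u / n ^ 2) *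
        theta P (y ^ 2) +
      y ^ 2 * (theta P (k ^ 2) * theta P (n ^ 2 / y ^ 2) * theta P (k ^ 2 * u) *
        theta P (u / (n ^ 2 * y ^ 2))) := by
  -- The four points are chosen so that their pairwise products and quotients are, up to inversion,
  -- the twelve arguments wanted; this is why the statement is written in squares.
  have h := theta_addition P (a := n * k * y) (b := n / (k * y)) (c := u * k / (n * y))
    (d := y / (k * n)) (by positivity) (by positivity) (by positivity) (by positivity)
  have e1 : n * k * y * (n / (k * y)) = n ^ 2 := by field_simp
  have e2 : n * k * y / (n / (k * y)) = k ^ 2 * y ^ 2 := by field_simp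
  have e3 : u * k / (n * y) * (y / (k * n)) = u / n ^ 2 := by field_simp
  have e4 : u * k / (n * y) / (y / (k * n)) = k ^ 2 * u / y ^ 2 := by field_simp
  have e5 : n * k * y * (y / (k * n)) = y ^ 2 := by field_simp
  have e6 : n * k * y / (y / (k * n)) = n ^ 2 * k ^ 2 := by field_simp
  have e7 : u * k / (n * y) * (n / (k * y)) = u / y ^ 2 := by field_simp
  have e8 : u * k / (n * y) / (n / (k * y)) = k ^ 2 * u / n ^ 2 := by field_simp
  have e9 : n / (k * y) * (y / (k * n)) = (k ^ 2)⁻¹ := by field_simp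
  have e10 : n / (k * y) / (y / (k * n)) = n ^ 2 / y ^ 2 := by field_simp
  have e11 : n * k * y * (u * k / (n * y)) = k ^ 2 * u := by field_simp
  have e12 : n * k * y / (u * k / (n * y)) = (u / (n ^ 2 * y ^ 2))⁻¹ := by field_simp
  rw [e1, e2, e3, e4, e5, e6, e7, e8, e9, e10, e11, e12, theta_inv P (by positivity),
    theta_inv P (by positivity)] at h
  have h2 : k ^ 2 * u / n ^ 2 * (-(k ^ 2)⁻¹ * theta P (k ^ 2) * theta P (n ^ 2 / y ^ 2) *
      theta P (k ^ 2 * u) * (-(u / (n ^ 2 * y ^ 2))⁻¹ * theta P (u / (n ^ 2 * y ^ 2)))) =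
      y ^ 2 * (theta P (k ^ 2) * theta P (n ^ 2 / y ^ 2) * theta P (k ^ 2 * u) *
        theta P (u / (n ^ 2 * y ^ 2))) := by field_simp
  rw [h2] at h
  linear_combination h

end thetaAddition

/-! ### Difference operators with meromorphic coefficients, and the entries of the `R`-matrix. -/

section operators
variable (P : Params)

theorem toM_mul {f g : ℂ → ℂ} (hf : Meromorphic f) (hg : Meromorphic g) :
    toM (fun x => f x * g x) = toM f * toM g := by
  rw [toM_of hf, toM_of hg, ← map_mul]
  exact toM_of (f := fun x => f x * g x) (hf.mul hg)

theorem toM_add {f g : ℂ → ℂ} (hf : Meromorphic f) (hg : Meromorphic g) :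
    toM (fun x => f x + g x) = toM f + toM g := by
  rw [toM_of hf, toM_of hg, ← map_add]
  exact toM_of (f := fun x => f x + g x) (hf.add hg)

theorem toM_const (c : ℂ) : toM (fun _ => c) = algebraMap ℂ Mer c := by
  rw [toM_of (Meromorphic.const c)]
  rfl

theorem shift_toM {f : ℂ → ℂ} (hf : Meromorphic f) (c : ℂ) :
    shift c (toM f) = toM fun x => f (x + c) := by
  rw [toM_of hf, shift_mkM,
    toM_of (Meromorphic.meromorphic_fun_comp_add_const_iff_meromorphic.2 hf)]
  rfl

theorem toM_congr {f g : ℂ → ℂ} (hf : Meromorphic f) (hg : Meromorphic g)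
    (h : ∀ᶠ x in codiscrete ℂ, f x = g x) : toM f = toM g :=
  (toM_eq_iff hf hg).2 h

theorem toM_ne_zero_of_eventually {f : ℂ → ℂ} (hf : Meromorphic f)
    (h : ∀ᶠ x in codiscrete ℂ, f x ≠ 0) : toM f ≠ 0 :=
  toM_ne_zero hf fun h' => not_eventually_codiscrete_false <| by
    filter_upwards [h, h'] with x h1 h2 using h2 h1

theorem T_mul_T (m n : ℤ) : T m * T n = T (m + n) := (T_add m n).symm

theorem mulOp_T_mul (f g : Mer) (a b c : ℤ) :
    mulOp f * T a * T b * (mulOp g * T c) =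
      mulOp (f * shift ((a + b : ℤ) : ℂ) g) * T (a + b + c) := by
  rw [mul_assoc (mulOp f), T_mul_T, mul_assoc, ← mul_assoc (T _), T_mulOp, mulOp_mul, T_add (a + b)]
  simp only [mul_assoc]

/-- Reduces a composition of difference operators to an identity between functions off a discrete
closed set. The second coefficient is evaluated at the point shifted by `a + b`. -/
theorem differenceOp_mul {f g h : ℂ → ℂ} {a b c d : ℤ} (hf : Meromorphic f) (hg : Meromorphic g)
    (hh : Meromorphic h) (hd : d = a + b + c)
    (e : ∀ᶠ x in codiscrete ℂ, f x * g (x + (a + b : ℤ)) = h x) :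
    mulOp (toM f) * T a * T b * (mulOp (toM g) * T c) = mulOp (toM h) * T d := by
  have hg' : Meromorphic fun x => g (x + ((a + b : ℤ) : ℂ)) :=
    Meromorphic.meromorphic_fun_comp_add_const_iff_meromorphic.2 hg
  rw [mulOp_T_mul, shift_toM hg, ← toM_mul hf hg', ← hd]
  congr 2
  exact toM_congr (hf.mul hg') hh e

theorem Meromorphic.theta_comp {g : ℂ → ℂ} (hg : Differentiable ℂ g) (h0 : ∀ x, g x ≠ 0) :
    Meromorphic fun x => theta P (g x) :=
  meromorphic_of_differentiable fun x =>
    (differentiableAt_theta P (h0 x)).comp x (hg x)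

attribute [fun_prop] Meromorphic.theta_comp
attribute [fun_prop] differentiable_qq

theorem eventually_theta_qq_ne_zero (c : ℂ) : ∀ᶠ x in codiscrete ℂ, theta P (qq P (x + c)) ≠ 0 := by
  simpa using eventually_theta_ne_zero P 1 c 1 one_ne_zero one_ne_zero

theorem theta_qq_neg (x : ℂ) : theta P (qq P (-x)) = -(qq P x)⁻¹ * theta P (qq P x) := by
  rw [qq_neg, theta_inv P (qq_ne_zero P x)]

theorem theta_qq_zero : theta P (qq P 0) = 0 := by
  have : qq P 0 = 1 := by simp [qq]
  rw [this, theta, poch_eq]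
  simp

theorem qq_zero : qq P 0 = 1 := by simp [qq]

theorem qq_intCast (m : ℤ) : qq P m = (P.q : ℂ) ^ (2 * m) := by
  rw [qq, ← Complex.cpow_intCast]
  push_cast
  rfl

/-- `u` is not in the lattice `q^{2ℤ} p^ℤ`. -/
def OffLattice (u : ℂ) : Prop :=
  u ≠ 0 ∧ ∀ m n : ℤ, u ≠ (P.q : ℂ) ^ (2 * m) * (P.p : ℂ) ^ n

variable {P}

theorem OffLattice.theta_ne {u : ℂ} (hu : OffLattice P u) {c : ℂ} (m : ℤ) (hc : c = m) :
    theta P (qq P c * u) ≠ 0 := by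
  subst hc
  refine theta_ne_zero P (mul_ne_zero (qq_ne_zero P _) hu.1) fun n hn => hu.2 (-m) n ?_
  have hq : (P.q : ℂ) ≠ 0 := by exact_mod_cast P.q_pos.ne'
  rw [← hn, qq_intCast, ← mul_assoc, ← zpow_add₀ hq]
  simp

theorem OffLattice.theta_ne' {u : ℂ} (hu : OffLattice P u) : theta P u ≠ 0 := by
  simpa [qq_zero] using hu.theta_ne (c := 0) 0 (by simp)

/-- The letter in position `n` of a word has spectral parameter `q^{2n}z`, so its ratio to `w` is
`q^{-2n}w/z`, again off the lattice. -/
theorem OffLattice.mul {u : ℂ} (hu : OffLattice P u) (n : ℕ) : OffLattice P (qq P (-n) * u) := by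
  have hq : (P.q : ℂ) ≠ 0 := by exact_mod_cast P.q_pos.ne'
  refine ⟨mul_ne_zero (qq_ne_zero P _) hu.1, fun m l h => hu.2 (m + n) l ?_⟩
  rw [show (-(n : ℂ)) = ((-(n : ℤ) : ℤ) : ℂ) by push_cast; rfl, qq_intCast] at h
  rw [mul_add, zpow_add₀ hq, mul_right_comm, ← h, mul_neg, zpow_neg]
  field_simp

/-- The coefficient of `⟨α(w), t_kk⟩`. -/
def coefA (P : Params) (u : ℂ) (N k : ℕ) (x : ℂ) : ℂ :=
  theta P (qq P (1 - N + k) * u) * theta P (qq P (x + N - k + 1)) /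
    (theta P (qq P 1 * u) * theta P (qq P (x + 1)))

/-- The coefficient of `⟨β(w), t_{k,k+1}⟩`. -/
def coefB (P : Params) (u : ℂ) (N k : ℕ) (x : ℂ) : ℂ :=
  theta P (qq P (N - k)) * theta P (qq P (-(x + N - k)) * u) /
    (theta P (qq P 1 * u) * theta P (qq P (-(x + 1))))

/-- The coefficient of `⟨γ(w), t_{k,k-1}⟩`. -/
def coefC (P : Params) (u : ℂ) (k : ℕ) (x : ℂ) : ℂ :=
  theta P (qq P k) * theta P (qq P (x - k + 2) * u) /
    (theta P (qq P 1 * u) * theta P (qq P (x + 1)))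

/-- The coefficient of `⟨δ(w), t_kk⟩`. -/
def coefD (P : Params) (u : ℂ) (k : ℕ) (x : ℂ) : ℂ :=
  theta P (qq P (k - x - 1)) * theta P (qq P (1 - k) * u) /
    (theta P (qq P 1 * u) * theta P (qq P (-(x + 1))))

theorem meromorphic_coefA (u : ℂ) (N k : ℕ) : Meromorphic (coefA P u N k) := by
  unfold coefA
  fun_prop (disch := intro x; simp [qq_ne_zero])

theorem meromorphic_coefB {u : ℂ} (hu : u ≠ 0) (N k : ℕ) : Meromorphic (coefB P u N k) := by
  unfold coefB
  fun_prop (disch := intro x; simp [qq_ne_zero, hu])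

theorem meromorphic_coefC {u : ℂ} (hu : u ≠ 0) (k : ℕ) : Meromorphic (coefC P u k) := by
  unfold coefC
  fun_prop (disch := intro x; simp [qq_ne_zero, hu])

theorem meromorphic_coefD (u : ℂ) (k : ℕ) : Meromorphic (coefD P u k) := by
  unfold coefD
  fun_prop (disch := intro x; simp [qq_ne_zero])

/-- The entry `R^{1,-1}_{1,-1}`. -/
def entryA (P : Params) (u x : ℂ) : ℂ :=
  theta P u * theta P (qq P (x + 2)) / (theta P (qq P 1 * u) * theta P (qq P (x + 1)))

/-- The entry `R^{-1,1}_{1,-1}`. -/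
def entryB (P : Params) (u x : ℂ) : ℂ :=
  theta P (qq P 1) * theta P (qq P (-(x + 1)) * u) /
    (theta P (qq P 1 * u) * theta P (qq P (-(x + 1))))

/-- The entry `R^{1,-1}_{-1,1}`. -/
def entryC (P : Params) (u x : ℂ) : ℂ :=
  theta P (qq P 1) * theta P (qq P (x + 1) * u) / (theta P (qq P 1 * u) * theta P (qq P (x + 1)))

/-- The entry `R^{-1,1}_{-1,1}`. -/
def entryD (P : Params) (u x : ℂ) : ℂ :=
  theta P u * theta P (qq P (-x)) / (theta P (qq P 1 * u) * theta P (qq P (-(x + 1))))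

theorem meromorphic_entryA (u : ℂ) : Meromorphic (entryA P u) := by
  unfold entryA
  fun_prop (disch := intro x; simp [qq_ne_zero])

theorem meromorphic_entryB {u : ℂ} (hu : u ≠ 0) : Meromorphic (entryB P u) := by
  unfold entryB
  fun_prop (disch := intro x; simp [qq_ne_zero, hu])

theorem meromorphic_entryC {u : ℂ} (hu : u ≠ 0) : Meromorphic (entryC P u) := by
  unfold entryC
  fun_prop (disch := intro x; simp [qq_ne_zero, hu])

theorem meromorphic_entryD (u : ℂ) : Meromorphic (entryD P u) := by
  unfold entryD
  fun_prop (disch := intro x; simp [qq_ne_zero])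

theorem smul_toM (c : ℂ) {f g : ℂ → ℂ} (hf : Meromorphic f) (h : ∀ x, c * f x = g x) :
    c • toM f = toM g := by
  rw [Algebra.smul_def, ← toM_const, ← toM_mul (Meromorphic.const c) hf]
  exact congrArg toM (funext h)

theorem rMat_entryA (u : ℂ) : rMat P u true false true false = toM (entryA P u) := by
  refine smul_toM _ ?_ fun x => ?_
  · fun_prop (disch := intro x; simp [qq_ne_zero])
  · rw [entryA, mul_div_assoc', inv_mul_eq_div, div_div]

theorem rMat_entryB {u : ℂ} (hu : u ≠ 0) :
    rMat P u false true true false = toM (entryB P u) := by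
  refine smul_toM _ ?_ fun x => ?_
  · fun_prop (disch := intro x; simp [qq_ne_zero, hu])
  · rw [entryB, mul_div_assoc', inv_mul_eq_div, div_div]

theorem rMat_entryC {u : ℂ} (hu : u ≠ 0) :
    rMat P u true false false true = toM (entryC P u) := by
  refine smul_toM _ ?_ fun x => ?_
  · fun_prop (disch := intro x; simp [qq_ne_zero, hu])
  · rw [entryC, mul_div_assoc', inv_mul_eq_div, div_div]

theorem rMat_entryD (u : ℂ) : rMat P u false true false true = toM (entryD P u) := by
  refine smul_toM _ ?_ fun x => ?_
  · fun_prop (disch := intro x; simp [qq_ne_zero])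
  · rw [entryD, mul_div_assoc', inv_mul_eq_div, div_div]

theorem rMat_diag {u : ℂ} (hu : OffLattice P u) (a : Bool) : rMat P u a a a a = 1 := by
  have h := hu.theta_ne (c := 1) 1 (by simp)
  have : (theta P (qq P 1 * u))⁻¹ • toM (fun _ => theta P (qq P 1 * u)) = 1 := by
    rw [smul_toM (g := fun _ => 1) _ (Meromorphic.const _) fun x => inv_mul_cancel₀ h, toM_const,
      map_one]
  cases a <;> exact this

end operators

/-! ### Words in `α` and `γ` and their coproducts. -/

section words
variable {P : Params} {S : SpectralSet P}
open TensorProduct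

theorem SpectralSet.up_up (m n : ℕ) (z : S.carrier) : S.up m (S.up n z) = S.up (n + m) z := by
  refine Subtype.ext ?_
  simp only [SpectralSet.up]
  ring

theorem Ell.vec_zero (z : S.carrier) : Ell.vec 0 0 z = 1 := by simp [Ell.vec]

theorem Ell.vec_mul_alpha {N k : ℕ} (z : S.carrier) (hk : k ≤ N) :
    Ell.vec N k z * Ell.L true true (S.up N z) = Ell.vec (N + 1) (k + 1) z := by
  simp only [Ell.vec, Nat.add_sub_add_right, List.range_succ, List.map_append, List.map_cons,
    List.map_nil, List.prod_append, List.prod_cons, List.prod_nil, mul_one, Nat.sub_add_cancel hk,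
    mul_assoc]
  rfl

/-- The new `γ` moves to the left through the letters `α` by the residual relation `α(y)γ(q²y) =
γ(y)α(q²y)`, which exchanges the letters and keeps the order of the spectral parameters. -/
theorem Ell.vec_mul_gamma {N k : ℕ} (z : S.carrier) (hk : k ≤ N) :
    Ell.vec N k z * Ell.L false true (S.up N z) = Ell.vec (N + 1) k z := by
  induction k generalizing N with
  | zero => simp [Ell.vec, List.range_succ, Ell.gamma]
  | succ k ih =>
    obtain ⟨N, rfl⟩ : ∃ M, N = M + 1 := ⟨N - 1, by omega⟩
    have hk' : k ≤ N := by omega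
    have h := Ell.res_same true (S.up N z)
    rw [SpectralSet.up_up] at h
    rw [← Ell.vec_mul_alpha z hk', mul_assoc, h, ← mul_assoc, ih hk',
      Ell.vec_mul_alpha z (hk'.trans (Nat.le_succ N))]

/-- The product `L_{a_1,1}(z) L_{a_2,1}(q²z) ⋯`, where `a_1, a_2, …` is the reversed list. -/
def Ell.word (z : S.carrier) : List Bool → Ell S
  | [] => 1
  | a :: ws => Ell.word z ws * Ell.L a true (S.up ws.length z)

/-- The coefficients of the comultiplication of a word with respect to the vectors `v_j`. -/
def Ell.row (z : S.carrier) : List Bool → ℕ → Ell S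
  | [], 0 => 1
  | [], _ + 1 => 0
  | a :: ws, 0 => Ell.row z ws 0 * Ell.L a false (S.up ws.length z)
  | a :: ws, j + 1 => Ell.row z ws j * Ell.L a true (S.up ws.length z) +
      Ell.row z ws (j + 1) * Ell.L a false (S.up ws.length z)

theorem Ell.word_eq_vec (z : S.carrier) (ws : List Bool) :
    Ell.word z ws = Ell.vec ws.length (ws.count true) z := by
  induction ws with
  | nil => exact (Ell.vec_zero z).symm
  | cons a ws ih =>
    cases a
    · simp [Ell.word, ih, Ell.vec_mul_gamma z List.count_le_length]
    · simp [Ell.word, ih, Ell.vec_mul_alpha z List.count_le_length]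

theorem Ell.row_eq_zero (z : S.carrier) (ws : List Bool) {j : ℕ} (hj : ws.length < j) :
    Ell.row z ws j = 0 := by
  induction ws generalizing j with
  | nil =>
    obtain ⟨j, rfl⟩ : ∃ i, j = i + 1 := ⟨j - 1, by simp at hj; omega⟩
    rfl
  | cons a ws ih =>
    rw [List.length_cons] at hj
    obtain ⟨j, rfl⟩ : ∃ i, j = i + 1 := ⟨j - 1, by omega⟩
    rw [Ell.row, ih (by omega), ih (by omega), zero_mul, zero_mul, add_zero]

theorem Ell.mk_surjective : Function.Surjective (Ell.mk S) :=
  RingQuot.mkAlgHom_surjective ℂ (Rel S)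

/-- The quotient `Ell.TP` carries no product, but `Ell.J` is stable under right multiplication, so a
coproduct can be multiplied on the right through any representative. -/
theorem Ell.comul_mul_gen {a : Ell S} {s : Ell S ⊗[ℂ] Ell S} (h : Ell.comul a = (Ell.J S).mkQ s)
    (g : Gen S) : Ell.comul (a * Ell.gen g) = (Ell.J S).mkQ (s * Ell.comulGen g) := by
  obtain ⟨x, rfl⟩ := Ell.mk_surjective a
  rw [Ell.comul_mk, ← sub_eq_zero, ← map_sub, Submodule.mkQ_apply,
    Submodule.Quotient.mk_eq_zero] at h
  rw [Ell.gen, ← map_mul, Ell.comul_mk, map_mul, Ell.comulFree_ι, ← sub_eq_zero, ← map_sub,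
    Submodule.mkQ_apply, Submodule.Quotient.mk_eq_zero, ← sub_mul]
  exact Ell.J_mul h _

theorem Ell.comul_one : Ell.comul (1 : Ell S) = Ell.tp 1 1 := by
  have h := Ell.comul_mk (S := S) 1
  rw [map_one (Ell.mk S), map_one Ell.comulFree] at h
  exact h

theorem Ell.comul_gen (g : Gen S) : Ell.comul (Ell.gen g) = (Ell.J S).mkQ (Ell.comulGen g) := by
  rw [Ell.gen, Ell.comul_mk, Ell.comulFree_ι]

theorem Ell.comul_L (a b : Bool) (z : S.carrier) :
    Ell.comul (Ell.L a b z) = ∑ x, Ell.tp (Ell.L a x z) (Ell.L x b z) := by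
  rw [Ell.L, Ell.comul_gen, Ell.comulGen, map_sum]
  rfl

theorem Ell.comul_detInv (z : S.carrier) :
    Ell.comul (Ell.detInv z) = Ell.tp (Ell.detInv z) (Ell.detInv z) :=
  Ell.comul_gen _

theorem Ell.tp_add_left (a b c : Ell S) : Ell.tp (a + b) c = Ell.tp a c + Ell.tp b c := by
  simp [Ell.tp, add_tmul]

theorem Ell.tp_zero_left (c : Ell S) : Ell.tp 0 c = 0 := by
  simp [Ell.tp]

/-- A new letter `L_{a,1}` has coproduct `L_{a,1} ⊗ α + L_{a,-1} ⊗ γ`. In the second factor `α`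
raises the index `j` and `γ` keeps it, which is the recursion defining `Ell.row`. -/
theorem Ell.comul_word (z : S.carrier) (ws : List Bool) :
    Ell.comul (Ell.word z ws) =
      ∑ j ∈ Finset.range (ws.length + 1), Ell.tp (Ell.row z ws j) (Ell.vec ws.length j z) := by
  induction ws with
  | nil => simp [Ell.word, Ell.row, Ell.comul_one, Ell.vec_zero]
  | cons a ws ih =>
    simp only [Ell.tp, ← map_sum] at ih
    rw [Ell.word, Ell.L, Ell.comul_mul_gen ih, Ell.comulGen, Finset.sum_mul, map_sum]
    have hj : ∀ j ∈ Finset.range (ws.length + 1), (Ell.J S).mkQ ((Ell.row z ws j ⊗ₜ[ℂ]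
        Ell.vec ws.length j z) * ∑ x, Ell.L a x (S.up ws.length z) ⊗ₜ[ℂ]
          Ell.L x true (S.up ws.length z)) =
        Ell.tp (Ell.row z ws j * Ell.L a true (S.up ws.length z))
          (Ell.vec (ws.length + 1) (j + 1) z) +
        Ell.tp (Ell.row z ws j * Ell.L a false (S.up ws.length z))
          (Ell.vec (ws.length + 1) j z) := fun j hj => by
      have hj' : j ≤ ws.length := Nat.lt_succ_iff.1 (Finset.mem_range.1 hj)
      rw [← Ell.vec_mul_alpha z hj', ← Ell.vec_mul_gamma z hj']
      simp [mul_add, Ell.tp, Algebra.TensorProduct.tmul_mul_tmul]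
    rw [Finset.sum_congr rfl hj, Finset.sum_add_distrib, List.length_cons,
      Finset.sum_range_succ' _ (ws.length + 1)]
    simp only [Ell.row, Ell.tp_add_left, Finset.sum_add_distrib]
    rw [add_assoc]
    congr 1
    -- The two sums have different ranges; splitting off index `0` and the top index aligns them,
    -- and the top term vanishes because the row stops at the length of the word.
    have hl : Ell.tp (Ell.row z ws (ws.length + 1) * Ell.L a false (S.up ws.length z))
        (Ell.vec (ws.length + 1) (ws.length + 1) z) = 0 := by
      rw [Ell.row_eq_zero z ws (Nat.lt_succ_self _), zero_mul, Ell.tp_zero_left]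
    rw [Finset.sum_range_succ' _ ws.length]
    rw [Finset.sum_range_succ _ ws.length, hl, add_zero]

theorem Ell.comul_vec (z : S.carrier) (ws : List Bool) :
    Ell.comul (Ell.vec ws.length (ws.count true) z) =
      ∑ j ∈ Finset.range (ws.length + 1), Ell.tp (Ell.row z ws j) (Ell.vec ws.length j z) := by
  rw [← Ell.word_eq_vec, Ell.comul_word]

/-! ### Bidegrees of words, rows and the determinant. -/

section grading

theorem Ell.gen_mem_gr (g : Gen S) :
    Ell.gen g ∈ Ell.gr S (Gen.weight S g).1 (Gen.weight S g).2 :=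
  Submodule.subset_span ⟨[g], by simp, by simp⟩

theorem Ell.L_mem_gr (a b : Bool) (z : S.carrier) : Ell.L a b z ∈ Ell.gr S (wt a) (wt b) :=
  Ell.gen_mem_gr (Gen.L a b z)

theorem Ell.one_mem_gr : (1 : Ell S) ∈ Ell.gr S 0 0 :=
  Submodule.subset_span ⟨[], rfl, rfl⟩

theorem Ell.mul_mem_gr {k l m n : ℤ} {a b : Ell S} (ha : a ∈ Ell.gr S k l) (hb : b ∈ Ell.gr S m n) :
    a * b ∈ Ell.gr S (k + m) (l + n) := by
  have h := Submodule.mul_mem_mul ha hb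
  rw [Ell.gr, Ell.gr, Submodule.span_mul_span] at h
  refine Submodule.span_mono ?_ h
  rintro _ ⟨_, ⟨v, hv, rfl⟩, _, ⟨w, hw, rfl⟩, rfl⟩
  exact ⟨v ++ w, by simp [hv, hw], by simp⟩

theorem Ell.mem_gr_of_eq {k l m n : ℤ} {a : Ell S} (ha : a ∈ Ell.gr S k l) (hk : m = k)
    (hl : n = l) : a ∈ Ell.gr S m n := by
  subst hk hl; exact ha

theorem two_mul_count_cons (a : Bool) (ws : List Bool) :
    (2 * (a :: ws).count true - (a :: ws).length : ℤ) = 2 * ws.count true - ws.length + wt a := by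
  cases a
  · rw [List.count_cons_of_ne (by simp), List.length_cons, wt]; push_cast; ring
  · rw [List.count_cons_self, List.length_cons, wt]; push_cast; ring

theorem Ell.word_mem_gr (z : S.carrier) (ws : List Bool) :
    Ell.word z ws ∈ Ell.gr S (2 * ws.count true - ws.length) ws.length := by
  induction ws with
  | nil => exact Ell.one_mem_gr
  | cons a ws ih =>
    refine Ell.mem_gr_of_eq (Ell.mul_mem_gr ih (Ell.L_mem_gr a true (S.up ws.length z)))
      (two_mul_count_cons a ws) ?_
    rw [List.length_cons, wt]; push_cast; ring

/-- The multiplication rule of the pairing needs homogeneous tensor factors whose inner degrees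
agree; here the inner degree is `2j` minus the length, the left degree of the matching vector. -/
theorem Ell.row_mem_gr (z : S.carrier) (ws : List Bool) (j : ℕ) :
    Ell.row z ws j ∈ Ell.gr S (2 * ws.count true - ws.length) (2 * j - ws.length) := by
  induction ws generalizing j with
  | nil =>
    cases j with
    | zero => exact Ell.one_mem_gr
    | succ j => exact Submodule.zero_mem _
  | cons a ws ih =>
    have hf : ∀ i : ℕ, Ell.row z ws i * Ell.L a false (S.up ws.length z) ∈
        Ell.gr S (2 * (a :: ws).count true - (a :: ws).length) (2 * i - (a :: ws).length) := by
      intro i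
      refine Ell.mem_gr_of_eq (Ell.mul_mem_gr (ih i) (Ell.L_mem_gr a false (S.up ws.length z)))
        (two_mul_count_cons a ws) ?_
      rw [List.length_cons, wt]; push_cast; ring
    cases j with
    | zero => exact hf 0
    | succ j =>
      refine add_mem ?_ (hf (j + 1))
      refine Ell.mem_gr_of_eq (Ell.mul_mem_gr (ih j) (Ell.L_mem_gr a true (S.up ws.length z)))
        (two_mul_count_cons a ws) ?_
      rw [List.length_cons, wt]; push_cast; ring

theorem Ell.vec_mem_gr (z : S.carrier) {N k : ℕ} (hk : k ≤ N) :
    Ell.vec N k z ∈ Ell.gr S (2 * k - N) N := by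
  have h := Ell.word_mem_gr z (List.replicate k true ++ List.replicate (N - k) false)
  have hl : (List.replicate k true ++ List.replicate (N - k) false).length = N := by simp [hk]
  have hc : (List.replicate k true ++ List.replicate (N - k) false).count true = k := by
    simp [List.count_replicate]
  rwa [Ell.word_eq_vec, hl, hc] at h

theorem Ell.ml_mem_gr (f : Mer) : (Ell.ml f : Ell S) ∈ Ell.gr S 0 0 :=
  Ell.gen_mem_gr (Gen.ml f)

theorem Ell.mr_mem_gr (f : Mer) : (Ell.mr f : Ell S) ∈ Ell.gr S 0 0 :=
  Ell.gen_mem_gr (Gen.mr f)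

theorem Ell.det_mem_gr (z : S.carrier) : Ell.det z ∈ Ell.gr S 0 0 := by
  rw [Ell.det_eq]
  have h2 : Ell.L true true z * Ell.L false false (S.up 1 z) ∈ Ell.gr S 0 0 :=
    Ell.mem_gr_of_eq (Ell.mul_mem_gr (Ell.L_mem_gr _ _ _) (Ell.L_mem_gr _ _ _)) rfl rfl
  have h3 : Ell.L false true z * Ell.L true false (S.up 1 z) ∈ Ell.gr S 0 0 :=
    Ell.mem_gr_of_eq (Ell.mul_mem_gr (Ell.L_mem_gr _ _ _) (Ell.L_mem_gr _ _ _)) rfl rfl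
  have h1 : (Ell.mr (detF P) * Ell.ml (detF P)⁻¹ : Ell S) ∈ Ell.gr S 0 0 :=
    Ell.mem_gr_of_eq (Ell.mul_mem_gr (Ell.mr_mem_gr _) (Ell.ml_mem_gr _)) rfl rfl
  exact Ell.mem_gr_of_eq (Ell.mul_mem_gr h1 (sub_mem h2 h3)) rfl rfl

end grading
end words

/-! ### The recursions satisfied by the claimed coefficients. -/

section coefficients
variable {P : Params}

theorem differenceOp_mul_add {f₁ g₁ f₂ g₂ h : ℂ → ℂ} {a₁ b₁ c₁ a₂ b₂ c₂ d : ℤ}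
    (hf₁ : Meromorphic f₁) (hg₁ : Meromorphic g₁) (hf₂ : Meromorphic f₂) (hg₂ : Meromorphic g₂)
    (hh : Meromorphic h) (hd₁ : d = a₁ + b₁ + c₁) (hd₂ : d = a₂ + b₂ + c₂)
    (e : ∀ᶠ x in codiscrete ℂ,
      f₁ x * g₁ (x + (a₁ + b₁ : ℤ)) + f₂ x * g₂ (x + (a₂ + b₂ : ℤ)) = h x) :
    mulOp (toM f₁) * T a₁ * T b₁ * (mulOp (toM g₁) * T c₁) +
      mulOp (toM f₂) * T a₂ * T b₂ * (mulOp (toM g₂) * T c₂) = mulOp (toM h) * T d := by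
  have hg₁' : Meromorphic fun x => g₁ (x + ((a₁ + b₁ : ℤ) : ℂ)) :=
    Meromorphic.meromorphic_fun_comp_add_const_iff_meromorphic.2 hg₁
  have hg₂' : Meromorphic fun x => g₂ (x + ((a₂ + b₂ : ℤ) : ℂ)) :=
    Meromorphic.meromorphic_fun_comp_add_const_iff_meromorphic.2 hg₂
  rw [mulOp_T_mul, mulOp_T_mul, shift_toM hg₁, shift_toM hg₂, ← toM_mul hf₁ hg₁',
    ← toM_mul hf₂ hg₂', ← hd₁, ← hd₂, ← add_mul, ← mulOp_add,
    ← toM_add (f := fun x => f₁ x * g₁ (x + ((a₁ + b₁ : ℤ) : ℂ)))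
      (g := fun x => f₂ x * g₂ (x + ((a₂ + b₂ : ℤ) : ℂ))) (hf₁.mul hg₁') (hf₂.mul hg₂')]
  congr 2
  exact toM_congr ((hf₁.mul hg₁').add (hf₂.mul hg₂')) hh e

theorem differenceOp_eq_T {f : ℂ → ℂ} {d n : ℤ} (hf : Meromorphic f)
    (h : ∀ᶠ x in codiscrete ℂ, f x = 1) (hn : n = d) : mulOp (toM f) * T n = T d := by
  rw [toM_congr hf (Meromorphic.const 1) h, toM_const, map_one, mulOp_one, one_mul, hn]

/-- The value of `⟨α(w), t_kk⟩`. -/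
def opA (P : Params) (u : ℂ) (N k : ℕ) : Module.End ℂ Mer :=
  mulOp (toM (coefA P u N k)) * T (N - 2 * k - 1)

/-- The value of `⟨β(w), t_{k,k+1}⟩`. -/
def opB (P : Params) (u : ℂ) (N k : ℕ) : Module.End ℂ Mer :=
  mulOp (toM (coefB P u N k)) * T (N - 2 * k - 1)

/-- The value of `⟨γ(w), t_{k,k-1}⟩`. -/
def opC (P : Params) (u : ℂ) (N k : ℕ) : Module.End ℂ Mer :=
  mulOp (toM (coefC P u k)) * T (N - 2 * k + 1)

/-- The value of `⟨δ(w), t_kk⟩`. -/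
def opD (P : Params) (u : ℂ) (N k : ℕ) : Module.End ℂ Mer :=
  mulOp (toM (coefD P u k)) * T (N - 2 * k + 1)

/-- The coefficient depends on `N` and `k` only through `N - k`, so only the power of the shift
changes; the same holds for `opB`. -/
theorem opA_mul_T (u : ℂ) (N k : ℕ) : opA P u N k * T (-1) = opA P u (N + 1) (k + 1) := by
  rw [opA, opA, mul_assoc, T_mul_T]
  congr 2
  · congr 1
    funext x
    simp only [coefA]
    congr 4 <;> (congr 1; push_cast; ring)
  · push_cast; ring

theorem opB_mul_T (u : ℂ) (N k : ℕ) : opB P u N k * T (-1) = opB P u (N + 1) (k + 1) := by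
  rw [opB, opB, mul_assoc, T_mul_T]
  congr 2
  · congr 1
    funext x
    simp only [coefB]
    have e1 : ((N + 1 : ℕ) : ℂ) - (k + 1 : ℕ) = N - k := by push_cast; ring
    have e2 : -(x + ((N + 1 : ℕ) : ℂ) - (k + 1 : ℕ)) = -(x + N - k) := by push_cast; ring
    rw [e1, e2]
  · push_cast; ring

/-- The coefficient does not involve `N`; likewise for `opD`. -/
theorem opC_mul_T (u : ℂ) (N k : ℕ) : opC P u N k * T 1 = opC P u (N + 1) k := by
  rw [opC, opC, mul_assoc, T_mul_T]
  congr 2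
  push_cast; ring

theorem opD_mul_T (u : ℂ) (N k : ℕ) : opD P u N k * T 1 = opD P u (N + 1) k := by
  rw [opD, opD, mul_assoc, T_mul_T]
  congr 2
  push_cast; ring

variable {u : ℂ}

theorem eventually_coefA_self (hu : OffLattice P u) (N : ℕ) :
    ∀ᶠ x in codiscrete ℂ, coefA P u N N x = 1 := by
  filter_upwards [eventually_theta_qq_ne_zero P 1] with x hx
  have h1 := hu.theta_ne (c := 1) 1 (by simp)
  rw [coefA, sub_add_cancel, add_sub_cancel_right]
  exact div_self (mul_ne_zero h1 hx)

theorem theta_qq_neg_ne_zero {x : ℂ} (h : theta P (qq P x) ≠ 0) : theta P (qq P (-x)) ≠ 0 := by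
  rw [theta_qq_neg]
  exact mul_ne_zero (neg_ne_zero.2 (inv_ne_zero (qq_ne_zero P x))) h

theorem eventually_coefD_zero (hu : OffLattice P u) :
    ∀ᶠ x in codiscrete ℂ, coefD P u 0 x = 1 := by
  filter_upwards [eventually_theta_qq_ne_zero P 1] with x hx
  have h1 := hu.theta_ne (c := 1) 1 (by simp)
  rw [coefD, Nat.cast_zero, sub_zero, show (0 : ℂ) - x - 1 = -(x + 1) by ring, mul_comm]
  exact div_self (mul_ne_zero h1 (theta_qq_neg_ne_zero hx))

theorem opA_zero (hu : OffLattice P u) : opA P u 0 0 = T (-1) :=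
  differenceOp_eq_T (meromorphic_coefA u 0 0) (eventually_coefA_self hu 0) rfl

theorem opD_zero (hu : OffLattice P u) : opD P u 0 0 = T 1 :=
  differenceOp_eq_T (meromorphic_coefD u 0) (eventually_coefD_zero hu) rfl

/-- A factor `θ(1) = 0` appears, so the formula itself encodes that no index lies beyond `N`;
`opC_zero` does the same below `0`. -/
theorem opB_self (N : ℕ) : opB P u N N = 0 := by
  have : coefB P u N N = fun _ => 0 := by
    funext x
    rw [coefB, sub_self, theta_qq_zero, zero_mul, zero_div]
  rw [opB, this, toM_zero, mulOp_zero, zero_mul]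

theorem opC_zero (N : ℕ) : opC P u N 0 = 0 := by
  have : coefC P u 0 = fun _ => 0 := by
    funext x
    rw [coefC, Nat.cast_zero, theta_qq_zero, zero_mul, zero_div]
  rw [opC, this, toM_zero, mulOp_zero, zero_mul]

/-- Telescoping: both numerator thetas of the old coefficient cancel against the denominator of the
entry, taken at `q^{-2N}u` and at the shifted point. -/
theorem opA_mul_entryA (hu : OffLattice P u) (N : ℕ) :
    opA P u N 0 * T 1 * (mulOp (toM (entryA P (qq P (-N) * u))) * T 0) = opA P u (N + 1) 0 := by
  refine differenceOp_mul (meromorphic_coefA u N 0) (meromorphic_entryA _)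
    (meromorphic_coefA u (N + 1) 0) (by push_cast; ring) ?_
  filter_upwards [eventually_theta_qq_ne_zero P (N + 1)] with x hx
  have hv := (hu.mul N).theta_ne (c := 1) 1 (by simp)
  have e1 : qq P (1 - N + (0 : ℕ)) * u = qq P 1 * (qq P (-N) * u) := by
    rw [← mul_assoc, ← qq_add]; congr 2; push_cast; ring
  have e2 : qq P (1 - (N + 1 : ℕ) + (0 : ℕ)) * u = qq P (-N) * u := by
    congr 2; push_cast; ring
  have e3 : x + N - (0 : ℕ) + 1 = x + (N + 1) := by push_cast; ring
  have e4 : x + ((((N : ℤ) - 2 * (0 : ℕ) - 1 + 1 : ℤ)) : ℂ) + 1 = x + (N + 1) := by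
    push_cast; ring
  have e5 : x + (N + 1 : ℕ) - (0 : ℕ) + 1 =
      x + ((((N : ℤ) - 2 * (0 : ℕ) - 1 + 1 : ℤ)) : ℂ) + 2 := by
    push_cast; ring
  rw [coefA, coefA, entryA, e1, e2, e3, e4, e5]
  generalize theta P (qq P 1 * (qq P (-N) * u)) = A at hv ⊢
  field_simp

theorem opD_mul_entryD (hu : OffLattice P u) (N : ℕ) :
    opD P u N N * T (-1) * (mulOp (toM (entryD P (qq P (-N) * u))) * T 0) =
      opD P u (N + 1) (N + 1) := by
  refine differenceOp_mul (meromorphic_coefD u N) (meromorphic_entryD _)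
    (meromorphic_coefD u (N + 1)) (by push_cast; ring) ?_
  filter_upwards [eventually_theta_qq_ne_zero P (-N + 1)] with x hx
  have hv := (hu.mul N).theta_ne (c := 1) 1 (by simp)
  have e1 : qq P (1 - N) * u = qq P 1 * (qq P (-N) * u) := by
    rw [← mul_assoc, ← qq_add]; congr 2
  have e2 : qq P (1 - (N + 1 : ℕ)) * u = qq P (-N) * u := by
    congr 2; push_cast; ring
  have e3 : (N : ℂ) - x - 1 = -(x + (-N + 1)) := by ring
  have e4 : -(x + ((((N : ℤ) - 2 * N + 1 + -1 : ℤ)) : ℂ) + 1) = -(x + (-N + 1)) := by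
    push_cast; ring
  have e5 : ((N + 1 : ℕ) : ℂ) - x - 1 = -(x + ((((N : ℤ) - 2 * N + 1 + -1 : ℤ)) : ℂ)) := by
    push_cast; ring
  have hx' := theta_qq_neg_ne_zero hx
  rw [coefD, coefD, entryD, e1, e2, e3, e4, e5]
  generalize theta P (qq P 1 * (qq P (-N) * u)) = A at hv ⊢
  field_simp

/-- After the denominators are cleared this is `theta_three_term`, with `k²`, `n²`, `y²` there equal
to `q²`, `q^{2N}`, `q^{2y}` here. The variable `y` is kept free because both off-diagonal recursions
are specializations. -/
theorem theta_fusion (hu : OffLattice P u) (N : ℕ) {y : ℂ} (hy : theta P (qq P y) ≠ 0)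
    (hy' : theta P (qq P (N - y)) ≠ 0) :
    theta P (qq P 1) * theta P (qq P (-y) * (qq P (-N) * u)) /
        (theta P (qq P 1 * (qq P (-N) * u)) * theta P (qq P (-y))) +
      theta P (qq P N) * theta P (qq P (1 - y) * u) /
        (theta P (qq P 1 * u) * theta P (qq P (N - y))) *
        (theta P (qq P (-N) * u) * theta P (qq P (y + 1)) /
          (theta P (qq P 1 * (qq P (-N) * u)) * theta P (qq P y))) =
      theta P (qq P (N + 1)) * theta P (qq P (-y) * u) /
        (theta P (qq P 1 * u) * theta P (qq P (N - y))) := by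
  -- Halving the exponent supplies the square roots required by the three-term identity.
  have sq : ∀ c : ℂ, qq P (c / 2) ^ 2 = qq P c := fun c => by
    rw [pow_two, ← qq_add, add_halves]
  have h := theta_three_term P (qq_ne_zero P (1 / 2)) (qq_ne_zero P (N / 2))
    (qq_ne_zero P (y / 2)) hu.1
  simp only [sq] at h
  have a0 := qq_ne_zero P 1
  have a1 := qq_ne_zero P N
  have a2 := qq_ne_zero P y
  have h1 := hu.theta_ne (c := 1) 1 (by simp)
  have h2 := (hu.mul N).theta_ne (c := 1) 1 (by simp)
  have e1 : qq P (-y) * (qq P (-N) * u) = u / (qq P N * qq P y) := by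
    rw [qq_neg, qq_neg]; field_simp
  have e2 : qq P 1 * (qq P (-N) * u) = qq P 1 * u / qq P N := by
    rw [qq_neg]; field_simp
  have e3 : qq P (1 - y) * u = qq P 1 * u / qq P y := by
    rw [sub_eq_add_neg, qq_add, qq_neg]; field_simp
  have e4 : qq P (-N) * u = u / qq P N := by rw [qq_neg]; field_simp
  have e5 : qq P (y + 1) = qq P 1 * qq P y := by rw [qq_add, mul_comm]
  have e6 : qq P (-y) * u = u / qq P y := by rw [qq_neg]; field_simp
  have e7 : qq P (N - y) = qq P N / qq P y := by
    rw [sub_eq_add_neg, qq_add, qq_neg]; field_simp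
  rw [theta_qq_neg, e1, e3, e5, e6, qq_add P N 1]
  rw [e7] at hy' ⊢
  rw [e2] at h2 ⊢
  rw [e4]
  generalize theta P (qq P 1 * u / qq P N) = A₁ at *
  generalize theta P (qq P 1 * u) = A₂ at *
  generalize theta P (qq P N / qq P y) = A₃ at *
  generalize theta P (qq P 1 * u / qq P y) = A₄ at *
  generalize theta P (qq P 1 * qq P y) = A₅ at *
  generalize theta P (u / (qq P N * qq P y)) = A₆ at *
  field_simp
  linear_combination h

/-- The identity `theta_fusion` at `y = λ + N + 1`; the factor coming from `opD` has coefficient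
one. -/
theorem opB_fusion (hu : OffLattice P u) (N : ℕ) :
    opD P u N 0 * T (-1) * (mulOp (toM (entryB P (qq P (-N) * u))) * T 0) +
      opB P u N 0 * T 1 * (mulOp (toM (entryA P (qq P (-N) * u))) * T 0) = opB P u (N + 1) 0 := by
  refine differenceOp_mul_add (meromorphic_coefD u 0) (meromorphic_entryB (hu.mul N).1)
    (meromorphic_coefB hu.1 N 0) (meromorphic_entryA _) (meromorphic_coefB hu.1 (N + 1) 0)
    (by push_cast; ring) (by push_cast; ring) ?_
  filter_upwards [eventually_coefD_zero hu, eventually_theta_qq_ne_zero P (N + 1),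
    eventually_theta_qq_ne_zero P 1] with x h0 h1 h2
  have e0 : (N : ℂ) - (x + (N + 1)) = -(x + 1) := by ring
  have h := theta_fusion hu N h1 (by rw [e0]; exact theta_qq_neg_ne_zero h2)
  rw [e0] at h
  have e1 : x + ((((N : ℤ) - 2 * (0 : ℕ) + 1 + -1 : ℤ)) : ℂ) + 1 = x + (N + 1) := by
    push_cast; ring
  have e2 : x + ((((N : ℤ) - 2 * (0 : ℕ) - 1 + 1 : ℤ)) : ℂ) + 1 = x + (N + 1) := by
    push_cast; ring
  have e3 : x + ((((N : ℤ) - 2 * (0 : ℕ) - 1 + 1 : ℤ)) : ℂ) + 2 = x + (N + 1) + 1 := by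
    push_cast; ring
  have e4 : -(x + (N : ℂ) - (0 : ℕ)) = 1 - (x + (N + 1)) := by push_cast; ring
  have e5 : -(x + ((N + 1 : ℕ) : ℂ) - (0 : ℕ)) = -(x + (N + 1)) := by push_cast; ring
  have e6 : ((N + 1 : ℕ) : ℂ) - (0 : ℕ) = N + 1 := by push_cast; ring
  rw [h0, coefB, coefB, entryA, entryB, e1, e2, e3, e4, e5, e6, Nat.cast_zero, sub_zero, one_mul]
  exact h

/-- The reflection `λ ↦ -λ-2` exchanges the roles of `e_1` and `e_{-1}` in the `R`-matrix.
Accordingly this is `theta_fusion` at `y = N - 1 - λ`, the reflected value of the one used for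
`opB_fusion`. -/
theorem opC_fusion (hu : OffLattice P u) (N : ℕ) :
    opC P u N N * T (-1) * (mulOp (toM (entryD P (qq P (-N) * u))) * T 0) +
      opA P u N N * T 1 * (mulOp (toM (entryC P (qq P (-N) * u))) * T 0) =
        opC P u (N + 1) (N + 1) := by
  refine differenceOp_mul_add (meromorphic_coefC hu.1 N) (meromorphic_entryD _)
    (meromorphic_coefA u N N) (meromorphic_entryC (hu.mul N).1) (meromorphic_coefC hu.1 (N + 1))
    (by push_cast; ring) (by push_cast; ring) ?_
  filter_upwards [eventually_coefA_self hu N, eventually_theta_qq_ne_zero P (-N + 1),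
    eventually_theta_qq_ne_zero P 1] with x h0 h1 h2
  have e0 : (N : ℂ) - -(x + (-N + 1)) = x + 1 := by ring
  have h := theta_fusion hu N (theta_qq_neg_ne_zero h1) (by rw [e0]; exact h2)
  rw [e0, neg_neg] at h
  have e1 : x + ((((N : ℤ) - 2 * N + 1 + -1 : ℤ)) : ℂ) + 1 = x + (-N + 1) := by
    push_cast; ring
  have e2 : x + ((((N : ℤ) - 2 * N - 1 + 1 : ℤ)) : ℂ) + 1 = x + (-N + 1) := by
    push_cast; ring
  have e3 : -(x + ((((N : ℤ) - 2 * N + 1 + -1 : ℤ)) : ℂ)) = -(x + (-N + 1)) + 1 := by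
    push_cast; ring
  have e4 : x - (N : ℂ) + 2 = 1 - -(x + (-N + 1)) := by ring
  have e5 : x - ((N + 1 : ℕ) : ℂ) + 2 = x + (-N + 1) := by push_cast; ring
  rw [h0, coefC, coefC, entryD, entryC, e1, e2, e3, e4, e5, one_mul, add_comm]
  push_cast
  exact h

end coefficients

/-! ### Pairing the generators with the rows of words. -/

section pairing
variable {P : Params} {W Z : SpectralSet P}
  {pair : Ell W →ₗ[ℂ] Ell Z →ₗ[ℂ] Module.End ℂ Mer}

/-- Appending a letter on the right acts as a transfer matrix. The co-opposite coproduct puts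
`L_{xb}(w)` on the old part and `L_{ax}(w)` on the new letter, so the column index `b` is never
touched. -/
theorem IsEllPairing.pair_L_mul (h : IsEllPairing W Z pair) (a b c d : Bool) (w : W.carrier)
    (y : Z.carrier) (r : Ell Z) :
    pair (Ell.L a b w) (r * Ell.L c d y) =
      pair (Ell.L true b w) r * T 1 * (mulOp (rMat P (w / y) true d a c) * T (-wt a - wt c)) +
      pair (Ell.L false b w) r * T (-1) *
        (mulOp (rMat P (w / y) false d a c) * T (-wt a - wt c)) := by
  rw [h.mul_snd (Ell.L a b w) r (Ell.L c d y) Bool (fun x => Ell.L a x w) (fun x => Ell.L x b w)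
    (wt b) (wt a) wt (fun x => Ell.L_mem_gr _ _ _) (fun x => Ell.L_mem_gr _ _ _)
    (Ell.comul_L a b w), Fintype.sum_bool, h.gen, h.gen]
  rfl

theorem rMat_zero {u : ℂ} {i j x y : Bool} (h : rNum P u i j x y = 0) : rMat P u i j x y = 0 := by
  rw [rMat, h, smul_zero]

section entries
variable {w : W.carrier} {y : Z.carrier}

/-- In this and the next seven lemmas weight conservation, `x + d = a + c` for `R^{xd}_{ac}`, leaves
at most one of the two terms. The letters in the name are the signs of `a`, `c`, `d`. -/
theorem IsEllPairing.pair_mul_t_tt (h : IsEllPairing W Z pair) (b : Bool) (r : Ell Z)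
    (hu : OffLattice P (w / y)) :
    pair (Ell.L true b w) (r * Ell.L true true y) = pair (Ell.L true b w) r * T (-1) := by
  rw [h.pair_L_mul, rMat_diag hu, rMat_zero (i := false) rfl, mulOp_zero, zero_mul, mul_zero,
    add_zero, mulOp_one, one_mul, mul_assoc, T_mul_T]
  rfl

theorem IsEllPairing.pair_mul_t_tf (h : IsEllPairing W Z pair) (b : Bool) (r : Ell Z) :
    pair (Ell.L true b w) (r * Ell.L true false y) = 0 := by
  rw [h.pair_L_mul, rMat_zero (i := true) rfl, rMat_zero (i := false) rfl, mulOp_zero]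
  simp

theorem IsEllPairing.pair_mul_t_ft (h : IsEllPairing W Z pair) (b : Bool) (r : Ell Z)
    (hu : OffLattice P (w / y)) :
    pair (Ell.L true b w) (r * Ell.L false true y) =
      pair (Ell.L false b w) r * T (-1) * (mulOp (toM (entryB P (w / y))) * T 0) := by
  rw [h.pair_L_mul, rMat_zero (i := true) rfl, rMat_entryB hu.1, mulOp_zero, zero_mul, mul_zero,
    zero_add]
  rfl

theorem IsEllPairing.pair_mul_t_ff (h : IsEllPairing W Z pair) (b : Bool) (r : Ell Z) :
    pair (Ell.L true b w) (r * Ell.L false false y) =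
      pair (Ell.L true b w) r * T 1 * (mulOp (toM (entryA P (w / y))) * T 0) := by
  rw [h.pair_L_mul, rMat_zero (i := false) rfl, rMat_entryA, mulOp_zero, zero_mul, mul_zero,
    add_zero]
  rfl

theorem IsEllPairing.pair_mul_f_tt (h : IsEllPairing W Z pair) (b : Bool) (r : Ell Z) :
    pair (Ell.L false b w) (r * Ell.L true true y) =
      pair (Ell.L false b w) r * T (-1) * (mulOp (toM (entryD P (w / y))) * T 0) := by
  rw [h.pair_L_mul, rMat_zero (i := true) rfl, rMat_entryD, mulOp_zero, zero_mul, mul_zero,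
    zero_add]
  rfl

theorem IsEllPairing.pair_mul_f_tf (h : IsEllPairing W Z pair) (b : Bool) (r : Ell Z)
    (hu : OffLattice P (w / y)) :
    pair (Ell.L false b w) (r * Ell.L true false y) =
      pair (Ell.L true b w) r * T 1 * (mulOp (toM (entryC P (w / y))) * T 0) := by
  rw [h.pair_L_mul, rMat_zero (i := false) rfl, rMat_entryC hu.1, mulOp_zero, zero_mul, mul_zero,
    add_zero]
  rfl

theorem IsEllPairing.pair_mul_f_ft (h : IsEllPairing W Z pair) (b : Bool) (r : Ell Z) :
    pair (Ell.L false b w) (r * Ell.L false true y) = 0 := by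
  rw [h.pair_L_mul, rMat_zero (i := true) rfl, rMat_zero (i := false) rfl, mulOp_zero]
  simp

theorem IsEllPairing.pair_mul_f_ff (h : IsEllPairing W Z pair) (b : Bool) (r : Ell Z)
    (hu : OffLattice P (w / y)) :
    pair (Ell.L false b w) (r * Ell.L false false y) = pair (Ell.L false b w) r * T 1 := by
  rw [h.pair_L_mul, rMat_diag hu, rMat_zero (i := true) rfl, mulOp_zero, zero_mul, mul_zero,
    zero_add, mulOp_one, one_mul, mul_assoc, T_mul_T]
  rfl

end entries

theorem div_up (w : ℂ) (n : ℕ) (z : Z.carrier) :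
    w / (Z.up n z : ℂ) = qq P (-n) * (w / z) := by
  have h : ((Z.up n z : Z.carrier) : ℂ) = qq P n * z := by rw [qq_natCast]; rfl
  have := qq_ne_zero P n
  have := Z.ne_zero _ z.2
  rw [h, qq_neg]
  field_simp

theorem OffLattice.div_up {w : ℂ} {z : Z.carrier} (hu : OffLattice P (w / z)) (n : ℕ) :
    OffLattice P (w / (Z.up n z : ℂ)) := by
  rw [EllU2.div_up]; exact hu.mul n

theorem Ell.counit_L (a b : Bool) (w : W.carrier) :
    Ell.counit (Ell.L a b w) = if a = b then T (-wt a) else 0 := by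
  have h : Ell.counit (Ell.mk W (FreeAlgebra.ι ℂ (Gen.L a b w))) = _ :=
    RingQuot.liftAlgHom_mkAlgHom_apply ℂ _ _ _
  rw [Ell.L, Ell.gen, h, FreeAlgebra.lift_ι_apply, Ell.counitGen]

theorem Ell.counit_detInv (w : W.carrier) : Ell.counit (Ell.detInv w) = 1 := by
  have h : Ell.counit (Ell.mk W (FreeAlgebra.ι ℂ (Gen.detInv w))) = _ :=
    RingQuot.liftAlgHom_mkAlgHom_apply ℂ _ _ _
  rw [Ell.detInv, Ell.gen, h, FreeAlgebra.lift_ι_apply, Ell.counitGen]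

section rows
variable {w : W.carrier} {z : Z.carrier}

/-- A final `α` contributes only a shift when the row index of the generator is `1`. This is why
words ending in `α` are used for `α(w)` and `β(w)`. -/
theorem IsEllPairing.pair_t_row_true_cons (h : IsEllPairing W Z pair)
    (hu : OffLattice P (w / z)) (ws : List Bool) (b : Bool) (j : ℕ) :
    pair (Ell.L true b w) (Ell.row z (true :: ws) (j + 1)) =
      pair (Ell.L true b w) (Ell.row z ws j) * T (-1) := by
  rw [Ell.row, map_add, h.pair_mul_t_tf, add_zero, h.pair_mul_t_tt _ _ (hu.div_up _)]

/-- The counterpart for a final `γ` and row index `-1`; words ending in `γ` are used for `γ(w)` and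
`δ(w)`. -/
theorem IsEllPairing.pair_f_row_false_cons (h : IsEllPairing W Z pair)
    (hu : OffLattice P (w / z)) (ws : List Bool) (b : Bool) (j : ℕ) :
    pair (Ell.L false b w) (Ell.row z (false :: ws) j) =
      pair (Ell.L false b w) (Ell.row z ws j) * T 1 := by
  cases j with
  | zero => rw [Ell.row, h.pair_mul_f_ff _ _ (hu.div_up _)]
  | succ j => rw [Ell.row, map_add, h.pair_mul_f_ft, zero_add, h.pair_mul_f_ff _ _ (hu.div_up _)]

theorem IsEllPairing.pair_t_row_false_cons (h : IsEllPairing W Z pair)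
    (hu : OffLattice P (w / z)) (ws : List Bool) (b : Bool) (j : ℕ) :
    pair (Ell.L true b w) (Ell.row z (false :: ws) (j + 1)) =
      pair (Ell.L false b w) (Ell.row z ws j) * T (-1) *
        (mulOp (toM (entryB P (qq P (-ws.length) * (w / z)))) * T 0) +
      pair (Ell.L true b w) (Ell.row z ws (j + 1)) * T 1 *
        (mulOp (toM (entryA P (qq P (-ws.length) * (w / z)))) * T 0) := by
  rw [Ell.row, map_add, h.pair_mul_t_ft _ _ (hu.div_up _), h.pair_mul_t_ff, div_up]

theorem IsEllPairing.pair_f_row_true_cons (h : IsEllPairing W Z pair)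
    (hu : OffLattice P (w / z)) (ws : List Bool) (b : Bool) (j : ℕ) :
    pair (Ell.L false b w) (Ell.row z (true :: ws) (j + 1)) =
      pair (Ell.L false b w) (Ell.row z ws j) * T (-1) *
        (mulOp (toM (entryD P (qq P (-ws.length) * (w / z)))) * T 0) +
      pair (Ell.L true b w) (Ell.row z ws (j + 1)) * T 1 *
        (mulOp (toM (entryC P (qq P (-ws.length) * (w / z)))) * T 0) := by
  rw [Ell.row, map_add, h.pair_mul_f_tt, h.pair_mul_f_tf _ _ (hu.div_up _), div_up]

theorem IsEllPairing.pair_row_nil (h : IsEllPairing W Z pair) (a b : Bool) (j : ℕ) :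
    pair (Ell.L a b w) (Ell.row z [] j) = if j = 0 ∧ a = b then T (-wt a) else 0 := by
  cases j with
  | zero => rw [Ell.row, h.counit_fst, Ell.counit_L]; simp
  | succ j => simp [Ell.row]

/-- The pairing with the row of the word `γ(z) γ(q²z) ⋯`. -/
theorem IsEllPairing.pair_row_gammas (h : IsEllPairing W Z pair)
    (hu : OffLattice P (w / z)) (N j : ℕ) :
    pair (Ell.L true true w) (Ell.row z (List.replicate N false) j) =
        (if j = 0 then opA P (w / z) N 0 else 0) ∧
    pair (Ell.L true false w) (Ell.row z (List.replicate N false) j) =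
        (if j = 1 then opB P (w / z) N 0 else 0) ∧
    pair (Ell.L false true w) (Ell.row z (List.replicate N false) j) = 0 ∧
    pair (Ell.L false false w) (Ell.row z (List.replicate N false) j) =
        (if j = 0 then opD P (w / z) N 0 else 0) := by
  -- The four entries must be proved together: the recursion for row index `1` also involves row
  -- index `-1` of the shorter word.
  induction N generalizing j with
  | zero =>
    simp only [List.replicate_zero, h.pair_row_nil, opA_zero hu, opD_zero hu, opB_self]
    simp [wt]
  | succ N ih =>
    rw [List.replicate_succ]
    refine ⟨?_, ?_, ?_, ?_⟩
    · cases j with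
      | zero =>
        rw [Ell.row, h.pair_mul_t_ff, (ih 0).1, div_up, List.length_replicate]
        simpa using opA_mul_entryA hu N
      | succ j =>
        rw [h.pair_t_row_false_cons hu, (ih j).2.2.1, (ih (j + 1)).1]
        simp
    · cases j with
      | zero =>
        rw [Ell.row, h.pair_mul_t_ff, (ih 0).2.1]
        simp
      | succ j =>
        rw [h.pair_t_row_false_cons hu, (ih j).2.2.2, (ih (j + 1)).2.1, List.length_replicate]
        by_cases hj : j = 0
        · simpa [hj] using opB_fusion hu N
        · simp [hj]
    · rw [h.pair_f_row_false_cons hu, (ih j).2.2.1, zero_mul]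
    · rw [h.pair_f_row_false_cons hu, (ih j).2.2.2, ite_mul, opD_mul_T, zero_mul]

/-- The pairing with the row of the word `α(z) α(q²z) ⋯`. -/
theorem IsEllPairing.pair_row_alphas (h : IsEllPairing W Z pair)
    (hu : OffLattice P (w / z)) (N j : ℕ) :
    pair (Ell.L true true w) (Ell.row z (List.replicate N true) j) =
        (if N = j then opA P (w / z) N N else 0) ∧
    pair (Ell.L true false w) (Ell.row z (List.replicate N true) j) = 0 ∧
    pair (Ell.L false true w) (Ell.row z (List.replicate N true) j) =
        (if j + 1 = N then opC P (w / z) N N else 0) ∧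
    pair (Ell.L false false w) (Ell.row z (List.replicate N true) j) =
        (if N = j then opD P (w / z) N N else 0) := by
  induction N generalizing j with
  | zero =>
    simp only [List.replicate_zero, h.pair_row_nil, opA_zero hu, opD_zero hu]
    simp [wt, eq_comm]
  | succ N ih =>
    rw [List.replicate_succ]
    refine ⟨?_, ?_, ?_, ?_⟩
    · cases j with
      | zero => rw [Ell.row, h.pair_mul_t_tf]; simp
      | succ j =>
        rw [h.pair_t_row_true_cons hu, (ih j).1, ite_mul, opA_mul_T, zero_mul]
        simp
    · cases j with
      | zero => rw [Ell.row, h.pair_mul_t_tf]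
      | succ j => rw [h.pair_t_row_true_cons hu, (ih j).2.1, zero_mul]
    · cases j with
      | zero =>
        rw [Ell.row, h.pair_mul_f_tf _ _ (hu.div_up _), (ih 0).1, div_up, List.length_replicate]
        -- Index `0` is adjacent to the diagonal only for words of length one. There the fusion
        -- identity reduces to its second term, since `opC` vanishes at index `0`.
        by_cases hN : N = 0
        · subst hN
          have h0 := opC_fusion hu 0
          rw [opC_zero, zero_mul, zero_mul, zero_add] at h0
          simpa using h0
        · simp [hN]
      | succ j =>
        rw [h.pair_f_row_true_cons hu, (ih j).2.2.1, (ih (j + 1)).1, List.length_replicate]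
        by_cases hj : j + 1 = N
        · simpa [hj] using opC_fusion hu N
        · simp [hj, Ne.symm hj]
    · cases j with
      | zero => rw [Ell.row, h.pair_mul_f_tf _ _ (hu.div_up _), (ih 0).2.1]; simp
      | succ j =>
        rw [h.pair_f_row_true_cons hu, (ih j).2.2.2, (ih (j + 1)).2.1, List.length_replicate]
        by_cases hj : N = j
        · simpa [hj] using opD_mul_entryD hu j
        · simp [hj]

/-- The values of `α(w)` and `β(w)` on the row of the word `γ ⋯ γ α ⋯ α`. -/
theorem IsEllPairing.pair_row_gammas_alphas (h : IsEllPairing W Z pair)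
    (hu : OffLattice P (w / z)) (m k j : ℕ) :
    pair (Ell.L true true w) (Ell.row z (List.replicate k true ++ List.replicate m false) j) =
        (if k = j then opA P (w / z) (m + k) k else 0) ∧
    pair (Ell.L true false w) (Ell.row z (List.replicate k true ++ List.replicate m false) j) =
        (if k + 1 = j then opB P (w / z) (m + k) k else 0) := by
  induction k generalizing j with
  | zero =>
    have := h.pair_row_gammas hu m j
    simpa [eq_comm] using And.intro this.1 this.2.1
  | succ k ih =>
    rw [List.replicate_succ, List.cons_append]
    cases j with
    | zero => rw [Ell.row, h.pair_mul_t_tf, h.pair_mul_t_tf]; simp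
    | succ j =>
      rw [h.pair_t_row_true_cons hu, h.pair_t_row_true_cons hu, (ih j).1, (ih j).2, ite_mul,
        ite_mul, opA_mul_T, opB_mul_T, zero_mul]
      simp [add_assoc]

/-- The values of `γ(w)` and `δ(w)` on the row of the word `α ⋯ α γ ⋯ γ`. -/
theorem IsEllPairing.pair_row_alphas_gammas (h : IsEllPairing W Z pair)
    (hu : OffLattice P (w / z)) (m k j : ℕ) :
    pair (Ell.L false true w) (Ell.row z (List.replicate m false ++ List.replicate k true) j) =
        (if j + 1 = k then opC P (w / z) (m + k) k else 0) ∧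
    pair (Ell.L false false w) (Ell.row z (List.replicate m false ++ List.replicate k true) j) =
        (if k = j then opD P (w / z) (m + k) k else 0) := by
  induction m with
  | zero =>
    have := h.pair_row_alphas hu k j
    simpa using And.intro this.2.2.1 this.2.2.2
  | succ m ih =>
    rw [List.replicate_succ, List.cons_append, h.pair_f_row_false_cons hu,
      h.pair_f_row_false_cons hu, ih.1, ih.2, ite_mul, ite_mul, opC_mul_T, opD_mul_T, zero_mul,
      add_right_comm m 1 k]
    exact ⟨rfl, rfl⟩

end rows
end pairing

/-! ### Independence of the vectors `v_j`. -/

section uniqueness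
variable {P : Params} {W Z : SpectralSet P}
  {pair : Ell W →ₗ[ℂ] Ell Z →ₗ[ℂ] Module.End ℂ Mer}
open TensorProduct

theorem Ell.mr_smul (c : ℂ) (f : Mer) : (Ell.mr (c • f) : Ell Z) = c • Ell.mr f := by
  rw [Algebra.smul_def, Ell.mr_mul, Ell.mr_const, ← Algebra.smul_def]

/-- The contraction `a ⊗ b ↦ μ_r(φ(b)) a` of the second tensor factor with a functional that is
linear with respect to the left moment map. -/
def Ell.contract (φ : Ell Z →ₗ[ℂ] Mer) (hφ : ∀ f b, φ (Ell.ml f * b) = f * φ b) :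
    Ell.TP Z →ₗ[ℂ] Ell Z :=
  (Ell.J Z).liftQ (TensorProduct.lift (LinearMap.mk₂ ℂ (fun a b => Ell.mr (φ b) * a)
    (fun a a' b => mul_add _ _ _) (fun c a b => mul_smul_comm _ _ _)
    (fun a b b' => by rw [map_add, Ell.mr_add, add_mul])
    (fun c a b => by rw [map_smul, Ell.mr_smul, smul_mul_assoc]))) <| by
    rw [Ell.J, Submodule.span_le]
    rintro _ ⟨f, a, b, rfl⟩
    -- The map respects the balancing relation because `φ` is linear for `μ_l` and the functions
    -- under `μ_r` commute.
    simp only [SetLike.mem_coe, LinearMap.mem_ker, map_sub, TensorProduct.lift.tmul,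
      LinearMap.mk₂_apply, hφ, sub_eq_zero]
    rw [← mul_assoc, ← Ell.mr_mul, mul_comm]

theorem Ell.contract_tp (φ : Ell Z →ₗ[ℂ] Mer) (hφ : ∀ f b, φ (Ell.ml f * b) = f * φ b)
    (a b : Ell Z) : Ell.contract φ hφ (Ell.tp a b) = Ell.mr (φ b) * a :=
  ((Ell.J Z).liftQ_apply _ (a ⊗ₜ[ℂ] b)).trans (TensorProduct.lift.tmul a b)

theorem Ell.mr_cancel {f : Mer} (hf : f ≠ 0) {a b : Ell Z} (h : Ell.mr f * a = Ell.mr f * b) :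
    a = b := by
  have := congrArg (fun t => Ell.mr f⁻¹ * t) h
  simpa [← mul_assoc, ← Ell.mr_mul, inv_mul_cancel₀ hf, Ell.mr_one] using this

/-- For `k < N` the last letter can be taken to be `γ`, which the counit kills. -/
theorem Ell.counit_vec (z : Z.carrier) {N k : ℕ} (hk : k ≤ N) :
    Ell.counit (Ell.vec N k z) = if k = N then T (-N) else 0 := by
  induction N generalizing k with
  | zero =>
    obtain rfl : k = 0 := by omega
    simp [Ell.vec_zero, T_zero]
  | succ N ih =>
    rcases Nat.lt_or_ge k (N + 1) with hlt | hge
    · rw [← Ell.vec_mul_gamma z (Nat.lt_succ_iff.1 hlt), map_mul, Ell.counit_L]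
      simp [hlt.ne]
    · obtain rfl : k = N + 1 := le_antisymm hk hge
      rw [← Ell.vec_mul_alpha z le_rfl, map_mul, Ell.counit_L, ih le_rfl, if_pos rfl, if_pos rfl,
        if_pos rfl, T_mul_T, wt]
      congr 1
      push_cast; ring

/-- The constant factor `θ(q^{2(N-k)})` is nonzero by genericity of `p` and `q`; the theta function
in `λ` has only isolated zeros. -/
theorem toM_coefB_ne_zero {u : ℂ} (hu : OffLattice P u) {N k : ℕ} (hk : k < N) :
    toM (coefB P u N k) ≠ 0 := by
  refine toM_ne_zero_of_eventually (meromorphic_coefB hu.1 N k) ?_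
  filter_upwards [eventually_theta_ne_zero P (-1) (-((N : ℂ) - k)) u (by norm_num) hu.1,
    eventually_theta_qq_ne_zero P 1] with x h1 h2
  have h3 := theta_qq_ne_zero P (Nat.sub_pos_of_lt hk)
  rw [Nat.cast_sub hk.le] at h3
  rw [show -1 * x + -((N : ℂ) - k) = -(x + N - k) by ring] at h1
  exact div_ne_zero (mul_ne_zero h3 h1)
    (mul_ne_zero (hu.theta_ne (c := 1) 1 (by simp)) (theta_qq_neg_ne_zero h2))

theorem Ell.comul_vec_gammas_alphas (z : Z.carrier) {N k : ℕ} (hk : k ≤ N) :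
    Ell.comul (Ell.vec N k z) = ∑ j ∈ Finset.range (N + 1),
      Ell.tp (Ell.row z (List.replicate k true ++ List.replicate (N - k) false) j)
        (Ell.vec N j z) := by
  have h := Ell.comul_vec z (List.replicate k true ++ List.replicate (N - k) false)
  have hl : (List.replicate k true ++ List.replicate (N - k) false).length = N := by simp [hk]
  have hc : (List.replicate k true ++ List.replicate (N - k) false).count true = k := by
    simp [List.count_replicate]
  rwa [hl, hc] at h

theorem Ell.comul_vec_alphas_gammas (z : Z.carrier) {N k : ℕ} (hk : k ≤ N) :
    Ell.comul (Ell.vec N k z) = ∑ j ∈ Finset.range (N + 1),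
      Ell.tp (Ell.row z (List.replicate (N - k) false ++ List.replicate k true) j)
        (Ell.vec N j z) := by
  have h := Ell.comul_vec z (List.replicate (N - k) false ++ List.replicate k true)
  have hl : (List.replicate (N - k) false ++ List.replicate k true).length = N := by simp [hk]
  have hc : (List.replicate (N - k) false ++ List.replicate k true).count true = k := by
    simp [List.count_replicate]
  rwa [hl, hc] at h

/-- Each factor `β(w)` moves `v_k` to `v_{k+1}` with a nonzero coefficient and sends `v_N` to zero.
After `m` factors the counit detects whether `v_N` has been reached. -/
theorem IsEllPairing.pair_beta_pow (h : IsEllPairing W Z pair) {w : W.carrier} {z : Z.carrier}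
    (hu : OffLattice P (w / z)) {N : ℕ} (m k : ℕ) (hk : k ≤ N) :
    ∃ (c : Mer) (n : ℤ), pair (Ell.L true false w ^ m) (Ell.vec N k z) = mulOp c * T n ∧
      (c ≠ 0 ↔ k + m = N) := by
  induction m generalizing k with
  | zero =>
    rw [pow_zero, h.counit_snd, Ell.counit_vec z hk]
    by_cases hkN : k = N
    · exact ⟨1, -N, by simp [hkN, mulOp_one], by simp [hkN]⟩
    · exact ⟨0, 0, by simp [hkN, mulOp_zero], by simp [hkN]⟩
  | succ m ih =>
    set ws := List.replicate k true ++ List.replicate (N - k) false with hws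
    have hl : ws.length = N := by simp [hws, hk]
    have hrow : ∀ j, pair (Ell.L true false w) (Ell.row z ws j) =
        if k + 1 = j then opB P (w / z) N k else 0 := fun j => by
      have := (h.pair_row_gammas_alphas hu (N - k) k j).2
      rwa [Nat.sub_add_cancel hk] at this
    have hcomul := Ell.comul_vec_gammas_alphas z hk
    rw [Finset.sum_range] at hcomul
    have hp := h.mul_fst (Ell.L true false w) (Ell.L true false w ^ m) (Ell.vec N k z)
      (Fin (N + 1)) (fun j => Ell.row z ws j) (fun j => Ell.vec N j z) _ N
      (fun j => 2 * (j : ℕ) - N) (fun j => hl ▸ Ell.row_mem_gr z ws j)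
      (fun j => Ell.vec_mem_gr z (Nat.lt_succ_iff.1 j.2)) hcomul
    rw [pow_succ', hp]
    simp only [hrow]
    rcases hk.lt_or_eq with hlt | rfl
    · rw [Finset.sum_eq_single ⟨k + 1, by omega⟩ (fun j _ hj => by
        rw [if_neg fun e => hj (Fin.ext e.symm), zero_mul, zero_mul]) (by simp), if_pos rfl]
      obtain ⟨c, n, hc, hc0⟩ := ih (k + 1) hlt
      refine ⟨_, _, by rw [hc, opB, mulOp_T_mul], ?_⟩
      rw [mul_ne_zero_iff, map_ne_zero, hc0, add_right_comm, add_assoc]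
      exact and_iff_right (toM_coefB_ne_zero hu hlt)
    · refine ⟨0, 0, ?_, by simp⟩
      rw [mulOp_zero, zero_mul]
      refine Finset.sum_eq_zero fun j _ => ?_
      rw [if_neg (by omega), zero_mul, zero_mul]

/-- The vectors `v_0(z), …, v_N(z)` are linearly independent with respect to the left moment map. -/
theorem IsEllPairing.eq_of_sum_tp_eq (h : IsEllPairing W Z pair) {w : W.carrier} {z : Z.carrier}
    (hu : OffLattice P (w / z)) {N : ℕ} {s t : ℕ → Ell Z}
    (hst : ∑ j ∈ Finset.range (N + 1), Ell.tp (s j) (Ell.vec N j z) =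
      ∑ j ∈ Finset.range (N + 1), Ell.tp (t j) (Ell.vec N j z)) {j : ℕ} (hj : j ≤ N) :
    s j = t j := by
  -- Applying an operator `c T_n` to the constant function `1` returns its coefficient `c`. The
  -- exponent `N - j` makes this functional detect `v_j` alone.
  let φ : Ell Z →ₗ[ℂ] Mer :=
    (LinearMap.applyₗ (1 : Mer)).comp (pair (Ell.L true false w ^ (N - j)))
  have hφ : ∀ f b, φ (Ell.ml f * b) = f * φ b := fun f b => by
    simp only [φ, LinearMap.comp_apply, LinearMap.applyₗ_apply_apply, h.left_moment_snd]
    rfl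
  have hval : ∀ i ≤ N, φ (Ell.vec N i z) ≠ 0 ↔ i = j := fun i hi => by
    obtain ⟨c, n, hc, hc0⟩ := h.pair_beta_pow hu (N - j) i hi
    have : φ (Ell.vec N i z) = c := by
      simp only [φ, LinearMap.comp_apply, LinearMap.applyₗ_apply_apply, hc]
      simp [mulOp, T]
    rw [this, hc0]
    omega
  have hsum : ∀ r : ℕ → Ell Z, Ell.contract φ hφ
      (∑ j ∈ Finset.range (N + 1), Ell.tp (r j) (Ell.vec N j z)) =
        Ell.mr (φ (Ell.vec N j z)) * r j := fun r => by
    rw [map_sum, Finset.sum_eq_single j, Ell.contract_tp]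
    · intro i hi hij
      have hi' : i ≤ N := Nat.lt_succ_iff.1 (Finset.mem_range.1 hi)
      rw [Ell.contract_tp, not_not.1 (mt (hval i hi').1 hij), Ell.mr_zero, zero_mul]
    · intro hj'
      exact absurd (Finset.mem_range.2 (Nat.lt_succ_of_le hj)) hj'
  refine Ell.mr_cancel ((hval j hj).2 rfl) ?_
  rw [← hsum, ← hsum, hst]

end uniqueness

/-! ### Pairing with the determinant and its inverse. -/

section determinant
variable {P : Params} {W Z : SpectralSet P}
  {pair : Ell W →ₗ[ℂ] Ell Z →ₗ[ℂ] Module.End ℂ Mer}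

theorem IsEllPairing.pair_mul_L (h : IsEllPairing W Z pair) (X Y : Ell W) (a b : Bool)
    (y : Z.carrier) :
    pair (X * Y) (Ell.L a b y) = pair X (Ell.L a true y) * T 1 * pair Y (Ell.L true b y) +
      pair X (Ell.L a false y) * T (-1) * pair Y (Ell.L false b y) := by
  rw [h.mul_fst X Y (Ell.L a b y) Bool (fun x => Ell.L a x y) (fun x => Ell.L x b y) (wt a) (wt b)
    wt (fun x => Ell.L_mem_gr _ _ _) (fun x => Ell.L_mem_gr _ _ _) (Ell.comul_L a b y),
    Fintype.sum_bool]
  rfl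

/-- The prefactor of `det` acts by conjugation with `F`: in the co-opposite, `μ_r(F)` leaves on the
left, and `μ_l(F⁻¹)` commutes with the bracket and leaves on the right. -/
theorem IsEllPairing.pair_det (h : IsEllPairing W Z pair) (w : W.carrier) (a : Ell Z) :
    pair (Ell.det w) a = mulOp (detF P) * pair (Ell.L true true w * Ell.L false false (W.up 1 w) -
      Ell.L false true w * Ell.L true false (W.up 1 w)) a * mulOp (detF P)⁻¹ := by
  have hc : Ell.ml (detF P)⁻¹ * (Ell.L true true w * Ell.L false false (W.up 1 w) -
      Ell.L false true w * Ell.L true false (W.up 1 w)) =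
      (Ell.L true true w * Ell.L false false (W.up 1 w) -
      Ell.L false true w * Ell.L true false (W.up 1 w)) * Ell.ml (detF P)⁻¹ := by
    rw [mul_sub, sub_mul, Ell.ml_LL _ _ _ _ _ rfl, Ell.ml_LL _ _ _ _ _ rfl]
  rw [Ell.det_eq, mul_assoc, h.left_moment_fst, hc, h.right_moment_fst, mul_assoc]

theorem mulOp_conj {F E : Mer} {c : ℂ} {n : ℤ} (hF : F ≠ 0)
    (h : F * E = c • shift (n : ℂ) F) :
    mulOp F * (mulOp E * T n) * mulOp F⁻¹ = c • T n := by
  have hF' : shift (n : ℂ) F ≠ 0 := (map_ne_zero _).2 hF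
  rw [← mul_assoc, mul_assoc _ (T n), T_mulOp, ← mulOp_mul, ← mul_assoc, ← mulOp_mul, h, map_inv₀,
    smul_mul_assoc, mul_inv_cancel₀ hF', Algebra.smul_def, mul_one, mulOp_const, ← Algebra.smul_def]

/-- The function `λ ↦ q^λ θ(q^{-2(λ+1)})`. -/
def detFun (P : Params) (x : ℂ) : ℂ := (P.q : ℂ) ^ x * theta P (qq P (-(x + 1)))

theorem meromorphic_detFun : Meromorphic (detFun P) := by
  have hq : (P.q : ℂ) ≠ 0 := by exact_mod_cast P.q_pos.ne'
  have e : Meromorphic fun x : ℂ => (P.q : ℂ) ^ x := by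
    have : (fun x : ℂ => (P.q : ℂ) ^ x) = fun x => Complex.exp (Complex.log P.q * x) := by
      ext x; rw [Complex.cpow_def_of_ne_zero hq]
    rw [this]
    exact meromorphic_of_differentiable (by fun_prop)
  unfold detFun
  fun_prop (disch := intro x; simp [qq_ne_zero])

theorem detF_mul_toM {E : ℂ → ℂ} (hE : Meromorphic E) {c : ℂ} {n : ℤ}
    (h : ∀ᶠ x in codiscrete ℂ, detFun P x * E x = c * detFun P (x + n)) :
    detF P * toM E = c • shift (n : ℂ) (detF P) := by
  have hs : Meromorphic fun x => detFun P (x + n) :=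
    Meromorphic.meromorphic_fun_comp_add_const_iff_meromorphic.2 meromorphic_detFun
  change toM (detFun P) * toM E = c • shift (n : ℂ) (toM (detFun P))
  rw [shift_toM meromorphic_detFun, smul_toM c hs fun x => rfl, ← toM_mul meromorphic_detFun hE]
  exact toM_congr (meromorphic_detFun.mul hE) ((Meromorphic.const c).mul hs) h

/-- The scalar by which `det(w)` pairs with `α(y)` and `δ(y)`, where `u = w/y`. -/
def detScalar (P : Params) (u : ℂ) : ℂ := P.q * theta P u / theta P (qq P 1 * u)

theorem detScalar_ne_zero {u : ℂ} (hu : OffLattice P u) : detScalar P u ≠ 0 := by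
  have hq : (P.q : ℂ) ≠ 0 := by exact_mod_cast P.q_pos.ne'
  exact div_ne_zero (mul_ne_zero hq hu.theta_ne') (hu.theta_ne (c := 1) 1 (by simp))

/-- The function `F` is made for this: the `λ`-dependence of the entry is the quotient of a shift of
`F` by `F`, so conjugation leaves a scalar. The factor `q^λ` in `F` makes the scalar the same here
and in `detF_mul_entryA`. -/
theorem detF_mul_entryD {u : ℂ} :
    detF P * toM (entryD P u) = detScalar P u • shift ((-1 : ℤ) : ℂ) (detF P) := by
  have hq : (P.q : ℂ) ≠ 0 := by exact_mod_cast P.q_pos.ne'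
  refine detF_mul_toM (meromorphic_entryD u) ?_
  filter_upwards [eventually_theta_qq_ne_zero P 1] with x hx
  have hx' := theta_qq_neg_ne_zero hx
  have e1 : -(x + ((-1 : ℤ) : ℂ) + 1) = -x := by push_cast; ring
  have e2 : (P.q : ℂ) ^ x = P.q * (P.q : ℂ) ^ (x + ((-1 : ℤ) : ℂ)) := by
    rw [Complex.cpow_add _ _ hq]
    push_cast
    rw [Complex.cpow_neg_one]
    field_simp
  rw [detFun, detFun, entryD, detScalar, e1, e2]
  field_simp

theorem detF_mul_entryA {u : ℂ} :
    detF P * toM (entryA P u) = detScalar P u • shift ((1 : ℤ) : ℂ) (detF P) := by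
  have hq : (P.q : ℂ) ≠ 0 := by exact_mod_cast P.q_pos.ne'
  refine detF_mul_toM (meromorphic_entryA u) ?_
  filter_upwards [eventually_theta_qq_ne_zero P 1] with x hx
  have e0 : qq P 1 = (P.q : ℂ) ^ 2 := by simpa using qq_natCast P 1
  have e1 : -(x + ((1 : ℤ) : ℂ) + 1) = -(x + 2) := by push_cast; ring
  have e2 : (P.q : ℂ) ^ (x + ((1 : ℤ) : ℂ)) = P.q * (P.q : ℂ) ^ x := by
    rw [Complex.cpow_add _ _ hq]
    push_cast
    rw [Complex.cpow_one, mul_comm]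
  have e3 : qq P (x + 2) = qq P (x + 1) * (P.q : ℂ) ^ 2 := by
    rw [← e0, ← qq_add]; congr 1; ring
  rw [detFun, detFun, entryA, detScalar, e1, e2, theta_qq_neg, theta_qq_neg]
  have e4 : (qq P (x + 2))⁻¹ = (qq P (x + 1))⁻¹ * ((P.q : ℂ) ^ 2)⁻¹ := by rw [e3, mul_inv]
  have := qq_ne_zero P (x + 1)
  rw [e4]
  field_simp

/-- On the diagonal only one `R`-matrix product survives if the bracket is suitably written: `αδ -
γβ` against `δ(y)`, and its other form `δα - βγ` against `α(y)`. -/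
theorem IsEllPairing.pair_det_L (h : IsEllPairing W Z pair) {w : W.carrier} {y : Z.carrier}
    (hu' : OffLattice P ((W.up 1 w : ℂ) / y)) (a b : Bool) :
    pair (Ell.det w) (Ell.L a b y) = if a = b then detScalar P (w / y) • T (-wt a) else 0 := by
  by_cases hab : a = b
  swap
  · rw [if_neg hab]
    -- Off the diagonal the value lies in a component of unequal degrees of the difference
    -- operators, which is zero.
    rcases h.target 0 0 (wt a) (wt b) _ _ (Ell.det_mem_gr w) (Ell.L_mem_gr a b y) with h0 | h0
    · exact h0
    · exact absurd h0.1 (by cases a <;> cases b <;> simp [wt] at hab ⊢)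
  subst hab
  rw [if_pos rfl, h.pair_det]
  cases a
  · rw [map_sub, LinearMap.sub_apply, h.pair_mul_L, h.pair_mul_L]
    simp only [h.gen, rMat_diag hu', rMat_entryA]
    rw [rMat_zero (i := true) (j := true) (x := true) (y := false) rfl,
      rMat_zero (i := true) (j := true) (x := false) (y := false) rfl,
      rMat_zero (i := true) (j := false) (x := false) (y := false) rfl]
    simp only [mulOp_zero, zero_mul, zero_add, sub_zero, mulOp_one, one_mul]
    rw [mul_assoc (mulOp (toM _)) (T _) (T _), T_mul_T, mul_assoc (mulOp (toM _)) (T _) (T _),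
      T_mul_T]
    have key := mulOp_conj (n := 1) (detF_ne_zero P) (detF_mul_entryA (u := (w : ℂ) / y))
    exact key
  -- The residual relation `Ell.res_anti` rewrites the bracket so that its second product pairs to
  -- zero with `α(y)` and no theta identity is needed.
  · rw [← neg_neg (Ell.L true true w * Ell.L false false (W.up 1 w) -
      Ell.L false true w * Ell.L true false (W.up 1 w)), ← Ell.res_anti, neg_sub,
      map_sub, LinearMap.sub_apply, h.pair_mul_L, h.pair_mul_L]
    simp only [h.gen, rMat_diag hu', rMat_entryD]
    rw [rMat_zero (i := false) (j := false) (x := false) (y := true) rfl,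
      rMat_zero (i := false) (j := true) (x := true) (y := true) rfl,
      rMat_zero (i := false) (j := false) (x := true) (y := true) rfl]
    simp only [mulOp_zero, zero_mul, add_zero, sub_zero, mulOp_one, one_mul]
    rw [mul_assoc (mulOp (toM _)) (T _) (T _), T_mul_T, mul_assoc (mulOp (toM _)) (T _) (T _),
      T_mul_T]
    have key := mulOp_conj (n := -1) (detF_ne_zero P) (detF_mul_entryD (u := (w : ℂ) / y))
    exact key

/-- Pairing `det⁻¹(w) det(w) = 1` with a generator gives the counit; since `det(w)` pairs
diagonally, the sum over the inner index has one term, which can be solved for. -/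
theorem IsEllPairing.pair_detInv_L (h : IsEllPairing W Z pair) {w : W.carrier} {y : Z.carrier}
    (hu : OffLattice P (w / y)) (hu' : OffLattice P ((W.up 1 w : ℂ) / y)) (a b : Bool) :
    pair (Ell.detInv w) (Ell.L a b y) =
      if a = b then (detScalar P (w / y))⁻¹ • T (-wt a) else 0 := by
  have hs := detScalar_ne_zero hu
  have h1 := h.pair_mul_L (Ell.detInv w) (Ell.det w) a b y
  rw [Ell.detInv_det, h.counit_snd, Ell.counit_L] at h1
  simp only [h.pair_det_L hu'] at h1
  have h2 : (if a = b then T (-wt a) else 0) =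
      detScalar P (w / y) • pair (Ell.detInv w) (Ell.L a b y) := by
    rw [h1]
    cases b <;> simp [wt, mul_assoc, T_mul_T, T_zero]
  rw [← inv_smul_smul₀ hs (pair (Ell.detInv w) (Ell.L a b y)), ← h2, smul_ite, smul_zero]

/-- The element is grouplike of bidegree zero, so the coproduct has one term and the inner shift is
trivial. -/
theorem IsEllPairing.pair_detInv_mul (h : IsEllPairing W Z pair) (w : W.carrier) (a b : Ell Z) :
    pair (Ell.detInv w) (a * b) = pair (Ell.detInv w) a * pair (Ell.detInv w) b := by
  have hm : Ell.detInv w ∈ Ell.gr W 0 0 := Ell.gen_mem_gr (Gen.detInv w)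
  rw [h.mul_snd (Ell.detInv w) a b Unit (fun _ => Ell.detInv w) (fun _ => Ell.detInv w) 0 0
    (fun _ => 0) (fun _ => hm) (fun _ => hm) (by simp [Ell.comul_detInv])]
  simp [T_zero]

/-- The numerator of each scalar at `q^{-2i}u` is, apart from `q`, the denominator of the next one.
-/
theorem detScalar_telescope {u : ℂ} (hu : OffLattice P u) (N : ℕ) :
    ((P.q : ℂ) ^ N)⁻¹ * theta P (qq P 1 * u) / theta P (qq P (1 - N) * u) *
      (detScalar P (qq P (-N) * u))⁻¹ =
    ((P.q : ℂ) ^ (N + 1))⁻¹ * theta P (qq P 1 * u) / theta P (qq P (1 - (N + 1 : ℕ)) * u) := by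
  have hq : (P.q : ℂ) ≠ 0 := by exact_mod_cast P.q_pos.ne'
  have e1 : qq P 1 * (qq P (-N) * u) = qq P (1 - N) * u := by
    rw [← mul_assoc, ← qq_add]; congr 2
  have e2 : 1 - ((N + 1 : ℕ) : ℂ) = -N := by push_cast; ring
  have h1 : theta P (qq P (1 - N) * u) ≠ 0 := hu.theta_ne (1 - N) (by push_cast; rfl)
  have h2 : theta P (qq P (-N) * u) ≠ 0 := (hu.mul N).theta_ne'
  rw [detScalar, e1, e2, pow_succ]
  generalize theta P (qq P (1 - N) * u) = A at *
  generalize theta P (qq P (-N) * u) = B at *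
  field_simp

theorem IsEllPairing.pair_detInv_row (h : IsEllPairing W Z pair) {w : W.carrier} {z : Z.carrier}
    (hu : OffLattice P (w / z)) (hu' : OffLattice P ((W.up 1 w : ℂ) / z)) (ws : List Bool) (j : ℕ) :
    pair (Ell.detInv w) (Ell.row z ws j) = if ws.count true = j then
      (((P.q : ℂ) ^ ws.length)⁻¹ * theta P (qq P 1 * (w / z)) /
        theta P (qq P (1 - ws.length) * (w / z))) • T (ws.length - 2 * j) else 0 := by
  induction ws generalizing j with
  | nil =>
    cases j with
    | zero =>
      have h1 := hu.theta_ne (c := 1) 1 (by simp)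
      rw [Ell.row, h.counit_fst, Ell.counit_detInv]
      simp [T_zero, h1]
    | succ j => simp [Ell.row]
  | cons a ws ih =>
    have hL := fun c => h.pair_detInv_L (hu.div_up ws.length) (hu'.div_up ws.length) a c
    simp only [div_up] at hL
    have key : ∀ (i : ℕ) (n : ℤ), (((P.q : ℂ) ^ ws.length)⁻¹ * theta P (qq P 1 * (w / z)) /
        theta P (qq P (1 - ws.length) * (w / z))) • T (ws.length - 2 * i) *
        ((detScalar P (qq P (-ws.length) * (w / z)))⁻¹ • T n) =
        (((P.q : ℂ) ^ (ws.length + 1))⁻¹ * theta P (qq P 1 * (w / z)) /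
        theta P (qq P (1 - (ws.length + 1 : ℕ)) * (w / z))) • T (ws.length - 2 * i + n) := by
      intro i n
      rw [smul_mul_smul_comm, detScalar_telescope hu, T_mul_T]
    cases a
    · have hr : pair (Ell.detInv w) (Ell.row z (false :: ws) j) =
          pair (Ell.detInv w) (Ell.row z ws j) *
            ((detScalar P (qq P (-ws.length) * (w / z)))⁻¹ • T 1) := by
        cases j with
        | zero => rw [Ell.row, h.pair_detInv_mul, hL, if_pos rfl]; rfl
        | succ j =>
          rw [Ell.row, map_add, h.pair_detInv_mul, h.pair_detInv_mul, hL, hL, if_pos rfl,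
            if_neg (by simp), mul_zero, zero_add]
          rfl
      rw [hr, ih, ite_mul, zero_mul, key, List.count_cons_of_ne (by simp), List.length_cons]
      congr 3
      push_cast; ring
    · cases j with
      | zero =>
        rw [Ell.row, h.pair_detInv_mul, hL, if_neg (by simp), mul_zero, List.count_cons_self,
          if_neg (by simp)]
      | succ j =>
        rw [Ell.row, map_add, h.pair_detInv_mul, h.pair_detInv_mul, hL, hL, if_pos rfl,
          if_neg (by simp), mul_zero, add_zero, ih, ite_mul, zero_mul, key, List.count_cons_self,
          List.length_cons]
        simp only [Nat.add_right_cancel_iff]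
        congr 3
        push_cast [wt]; ring

end determinant

/-- By uniqueness `t k j` equals the row coefficient of both extremal words, so each value is read
off from the word for which it was computed. -/
theorem IsEllPairing.pair_matrixElements {P : Params} {W Z : SpectralSet P}
    {pair : Ell W →ₗ[ℂ] Ell Z →ₗ[ℂ] Module.End ℂ Mer} (h : IsEllPairing W Z pair)
    {w : W.carrier} {z : Z.carrier} (hu : OffLattice P (w / z))
    (hu' : OffLattice P ((W.up 1 w : ℂ) / z)) {N : ℕ} {t : ℕ → ℕ → Ell Z}
    (ht : IsMatrixElements N z t) {k j : ℕ} (hk : k ≤ N) (hj : j ≤ N) :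
    pair (Ell.alpha w) (t k j) = (if k = j then opA P (w / z) N k else 0) ∧
    pair (Ell.beta w) (t k j) = (if k + 1 = j then opB P (w / z) N k else 0) ∧
    pair (Ell.gamma w) (t k j) = (if j + 1 = k then opC P (w / z) N k else 0) ∧
    pair (Ell.delta w) (t k j) = (if k = j then opD P (w / z) N k else 0) ∧
    pair (Ell.detInv w) (t k j) = (if k = j then
      (((P.q : ℂ) ^ N)⁻¹ * theta P (qq P 1 * (w / z)) / theta P (qq P (1 - N) * (w / z))) •
        T (N - 2 * k) else 0) := by
  have e1 := h.eq_of_sum_tp_eq hu ((ht k hk).symm.trans (Ell.comul_vec_gammas_alphas z hk)) hj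
  have e2 := h.eq_of_sum_tp_eq hu ((ht k hk).symm.trans (Ell.comul_vec_alphas_gammas z hk)) hj
  have h1 := h.pair_row_gammas_alphas hu (N - k) k j
  have h2 := h.pair_row_alphas_gammas hu (N - k) k j
  have h3 := h.pair_detInv_row hu hu'
    (List.replicate k true ++ List.replicate (N - k) false) j
  have hl : (List.replicate k true ++ List.replicate (N - k) false).length = N := by simp [hk]
  have hc : (List.replicate k true ++ List.replicate (N - k) false).count true = k := by
    simp [List.count_replicate]
  rw [← e1, Nat.sub_add_cancel hk] at h1
  rw [← e2, Nat.sub_add_cancel hk] at h2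
  rw [← e1, hl, hc] at h3
  refine ⟨h1.1, h1.2, h2.1, h2.2, h3.trans ?_⟩
  by_cases hkj : k = j
  · rw [if_pos hkj, if_pos hkj, hkj]
  · rw [if_neg hkj, if_neg hkj]

end EllU2
end

theorem mainTheorem3 (P : Params) (W Z : SpectralSet P)
    (hWZ : ∀ w ∈ W.carrier, ∀ z ∈ Z.carrier, ∀ m n : ℤ,
      w / z ≠ (P.q : ℂ) ^ (2 * m) * (P.p : ℂ) ^ n)
    (pair : Ell W →ₗ[ℂ] Ell Z →ₗ[ℂ] Module.End ℂ Mer) (hpair : IsEllPairing W Z pair)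
    (N : ℕ) (z : Z.carrier) :
    (∃ t : ℕ → ℕ → Ell Z, IsMatrixElements N z t) ∧
    ∀ t : ℕ → ℕ → Ell Z, IsMatrixElements N z t →
    ∀ (w : W.carrier) (k j : ℕ), k ≤ N → j ≤ N →
      pair (Ell.alpha w) (t k j) =
        (if k = j then
          mulOp (toM fun x => theta P (qq P (1 - N + k) * (w / z)) * theta P (qq P (x + N - k + 1)) /
            (theta P (qq P 1 * (w / z)) * theta P (qq P (x + 1)))) * T (N - 2 * k - 1)
        else 0) ∧
      pair (Ell.beta w) (t k j) =
        (if k + 1 = j then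
          mulOp (toM fun x => theta P (qq P (N - k)) * theta P (qq P (-(x + N - k)) * (w / z)) /
            (theta P (qq P 1 * (w / z)) * theta P (qq P (-(x + 1))))) * T (N - 2 * k - 1)
        else 0) ∧
      pair (Ell.gamma w) (t k j) =
        (if j + 1 = k then
          mulOp (toM fun x => theta P (qq P k) * theta P (qq P (x - k + 2) * (w / z)) /
            (theta P (qq P 1 * (w / z)) * theta P (qq P (x + 1)))) * T (N - 2 * k + 1)
        else 0) ∧
      pair (Ell.delta w) (t k j) =
        (if k = j then
          mulOp (toM fun x => theta P (qq P (k - x - 1)) * theta P (qq P (1 - k) * (w / z)) /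
            (theta P (qq P 1 * (w / z)) * theta P (qq P (-(x + 1))))) * T (N - 2 * k + 1)
        else 0) ∧
      pair (Ell.detInv w) (t k j) =
        (if k = j then
          mulOp (toM fun _ => ((P.q : ℂ) ^ N)⁻¹ * theta P (qq P 1 * (w / z)) /
            theta P (qq P (1 - N) * (w / z))) * T (N - 2 * k)
        else 0) := by
  have hoff : ∀ w : W.carrier, OffLattice P (w / z) := fun w =>
    ⟨div_ne_zero (W.ne_zero _ w.2) (Z.ne_zero _ z.2), hWZ w w.2 z z.2⟩
  refine ⟨⟨fun k => Ell.row z (List.replicate k true ++ List.replicate (N - k) false),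
    fun k hk => Ell.comul_vec_gammas_alphas z hk⟩, fun t ht w k j hk hj => ?_⟩
  -- The parameter `q²w` enters because the determinant at `w` involves generators at `q²w`, whose
  -- pairing must be regular as well.
  obtain ⟨hA, hB, hC, hD, hI⟩ := hpair.pair_matrixElements (hoff w) (hoff (W.up 1 w)) ht hk hj
  refine ⟨hA, hB, hC, hD, ?_⟩
  rw [hI, toM_const, mulOp_const, ← Algebra.smul_def]
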